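/- Let $\mathbb T^2=\mathbb R^2/(2\pi\mathbb Z)^2$, let $k>0$ be irrational, and let $g,\tau,c\in\mathbb R$. For functions on $\mathbb T^2$ write $\partial_\alpha=\partial_{\alpha_1}+k\,\partial_{\alpha_2}$ (also denoted by a subscript $\alpha$), let $\hat u_{j}$ be the Fourier coefficients of $u$, let $P_0[u]=\hat u_{0,0}$ be the mean, $P=\mathrm{id}-P_0$, and let $$H[u](\alpha_1,\alpha_2)=\sum_{(j_1,j_2)\in\mathbb Z^2}(-i)\operatorname{sgn}(j_1+kj_2)\,\hat u_{j_1,j_2}\,e^{i(j_1\alpha_1+j_2\alpha_2)} .$$ Given real functions $\tilde\eta,\tilde\varphi$ on $\mathbb T^2$, put $$\xi_\alpha=1+H[\tilde\eta_\alpha],\quad J=\xi_\alpha^2+\tilde\eta_\alpha^2,\quad \tilde\psi=-H[\tilde\varphi],\quad \chi=\frac{\tilde\psi_\alpha}{J},\quad \kappa=\frac{\xi_\alpha\tilde\eta_{\alpha\alpha}-\tilde\eta_\alpha\,\partial_\alpha(\xi_\alpha)}{J^{3/2}} .$$ The torus equations of motion for $\tilde\zeta=\tilde\xi+i\tilde\eta$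 and $\tilde\varphi$ (as functions of $(\alpha_1,\alpha_2,t)$) are $$\tilde\xi=x_0(t)+H[\tilde\eta],\qquad \frac{dx_0}{dt}=P_0\big[\xi_\alpha(C_1-H[\chi])+\tilde\eta_\alpha\chi\big],$$ $$\tilde\eta_t=-\tilde\eta_\alpha H[\chi]-\xi_\alpha\chi+C_1\tilde\eta_\alpha,\qquad \tilde\varphi_t=P\Big[\frac{\tilde\psi_\alpha^2-\tilde\varphi_\alpha^2}{2J}-\tilde\varphi_\alpha H[\chi]+C_1\tilde\varphi_\alpha-g\tilde\eta+\tau\kappa\Big],$$ where at each time $$C_1=\Big[H(\chi)-\frac{\tilde\eta_\alpha\tilde\psi_\alpha}{\xi_\alpha J}\Big]_{(\alpha_1,\alpha_2)=(0,0)} .$$ A solution on a time interval is a pair $(\tilde\zeta,\tilde\varphi)$, real analytic in $(\alpha_1,\alpha_2,t)$ and $2\pi$-periodic in $\alpha_1$ and $\alpha_2$, that satisfies these equations with nowhere vanishing $J$ and with $\xi_\alpha(0,0,t)\neq0$. Let $\tilde\eta_0(\alpha_1,\alpha_2)=\sum_{j\in\mathbb Z^2}\hat\eta_{j}e^{i(j_1\alpha_1+j_2\alpha_2)}$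 be real-valued and even, with $\hat\eta_{-j}=\overline{\hat\eta_{j}}$ and $|\hat\eta_{j}|\le Ce^{-3\varepsilon K\max(|j_1|,|j_2|)}$ for some constants $C$ and $\varepsilon>0$, where $K=\max(k,1)$. Suppose that $\tilde\eta_0$ satisfies the traveling wave equation $$P\Big[\frac{c^2}{2J}+g\tilde\eta_0-\tau\kappa\Big]=0$$ (with $J,\kappa$ computed from $\tilde\eta_0$). Put $\tilde\xi_0=H[\tilde\eta_0]$, $\tilde\zeta_0=\tilde\xi_0+i\tilde\eta_0$, $\tilde\varphi_0=c\,\tilde\xi_0$, $\zeta_0(\alpha;\theta)=\alpha+\tilde\zeta_0(\alpha,\theta+k\alpha)$ and $\xi_0(\alpha;\theta)=\alpha+\tilde\xi_0(\alpha,\theta+k\alpha)$. Suppose that for each $\theta\in[0,2\pi)$ the map $\alpha\mapsto\zeta_0(\alpha;\theta)$ is injective on $\mathbb R$ with $\zeta_{0,\alpha}(\alpha;\theta)\ne0$ for all $\alpha\in\mathbb R$, and that $\xi_{0,\alpha}(\alpha;\theta)>0$ for all $\alpha,\theta\in[0,2\pi)$. Then there is exactly one function $\mathcal A_0:\mathbb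 R^2\to\mathbb R$ satisfying $$\mathcal A_0(x_1,x_2)+\tilde\xi_0\big(x_1+\mathcal A_0(x_1,x_2),\,x_2+k\mathcal A_0(x_1,x_2)\big)=0\qquad\text{for all }(x_1,x_2);$$ it is real analytic and $2\pi$-periodic in each variable. With $\alpha_0(t)=ct-\mathcal A_0(-ct,-kct)$, the functions $$\tilde\zeta(\alpha_1,\alpha_2,t)=\tilde\zeta_0\big(\alpha_1-\alpha_0(t),\alpha_2-k\alpha_0(t)\big)+ct-\alpha_0(t),\qquad \tilde\varphi(\alpha_1,\alpha_2,t)=\tilde\varphi_0\big(\alpha_1-\alpha_0(t),\alpha_2-k\alpha_0(t)\big)$$ form a solution of the torus equations of motion for all $t\in\mathbb R$, with $\tilde\zeta(\cdot,\cdot,0)=\tilde\zeta_0$, $\tilde\varphi(\cdot,\cdot,0)=\tilde\varphi_0$, and $\tilde\xi(0,0,t)=0$ for all $t$. Moreover, every solution on a time interval containing $0$ with these initial conditions coincides with it on that interval. -/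

import Mathlib

open Complex Set

noncomputable section

namespace TorusWave

/-! Functions on the torus `𝕋² = ℝ²/(2πℤ)²` are represented by functions on `ℝ × ℝ` that are
`2π`-periodic in each variable. -/

/-- `2π`-periodicity in each of the two variables. -/
def TorusPeriodic {E : Type*} (u : ℝ × ℝ → E) : Prop :=
  ∀ a : ℝ × ℝ, u (a.1 + 2 * Real.pi, a.2) = u a ∧ u (a.1, a.2 + 2 * Real.pi) = u a

/-- The character `e^{i(j₁α₁ + j₂α₂)}`. -/
def torusChar (j : ℤ × ℤ) (a : ℝ × ℝ) : ℂ :=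
  Complex.exp (Complex.I * ((j.1 : ℂ) * (a.1 : ℂ) + (j.2 : ℂ) * (a.2 : ℂ)))

/-- The Fourier coefficient `û_j = (2π)⁻² ∫_{𝕋²} u(α) e^{-i⟨j,α⟩} dα₁ dα₂`. -/
def torusCoeff (u : ℝ × ℝ → ℝ) (j : ℤ × ℤ) : ℂ :=
  (1 / (2 * (Real.pi : ℂ)) ^ 2) *
    ∫ s in (0 : ℝ)..(2 * Real.pi), ∫ r in (0 : ℝ)..(2 * Real.pi),
      (u (s, r) : ℂ) * torusChar (-j) (s, r)

/-- The mean `P₀[u] = (2π)⁻² ∫_{𝕋²} u dα₁ dα₂`. -/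
def torusMean (u : ℝ × ℝ → ℝ) : ℝ :=
  (1 / (2 * Real.pi) ^ 2) *
    ∫ s in (0 : ℝ)..(2 * Real.pi), ∫ r in (0 : ℝ)..(2 * Real.pi), u (s, r)

/-- The projection `P = id - P₀` onto functions of zero mean. -/
def zeroMeanPart (u : ℝ × ℝ → ℝ) (a : ℝ × ℝ) : ℝ := u a - torusMean u

/-- The torus version of the Hilbert transform, with symbol `-i sgn(j₁ + k j₂)`. The series of a
real function is real, so that taking the real part only changes the type. -/
def hilbert (k : ℝ) (u : ℝ × ℝ → ℝ) (a : ℝ × ℝ) : ℝ :=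
  (∑' j : ℤ × ℤ, -Complex.I * (Real.sign ((j.1 : ℝ) + k * (j.2 : ℝ)) : ℂ) *
    torusCoeff u j * torusChar j a).re

/-- The `α`-derivative on the torus, `∂_{α₁} + k ∂_{α₂}`. -/
def dAlpha (k : ℝ) (u : ℝ × ℝ → ℝ) (a : ℝ × ℝ) : ℝ := lineDeriv ℝ u a (1, k)

/-- `ξ_α = 1 + H[η_α]`; on the torus this is `1 + ∂_α ξ̃`. -/
def xiAlpha (k : ℝ) (η : ℝ × ℝ → ℝ) (a : ℝ × ℝ) : ℝ := 1 + hilbert k (dAlpha k η) a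

/-- `J = ξ_α² + η_α²`. -/
def jac (k : ℝ) (η : ℝ × ℝ → ℝ) (a : ℝ × ℝ) : ℝ := xiAlpha k η a ^ 2 + dAlpha k η a ^ 2

/-- The curvature `κ = (ξ_α η_αα - η_α ξ_αα) / J^{3/2}`. -/
def curvature (k : ℝ) (η : ℝ × ℝ → ℝ) (a : ℝ × ℝ) : ℝ :=
  (xiAlpha k η a * dAlpha k (dAlpha k η) a - dAlpha k η a * dAlpha k (xiAlpha k η) a) /
    jac k η a ^ (3 / 2 : ℝ)

/-- The stream function on the surface, `ψ = -H[φ]`. -/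
def stream (k : ℝ) (φ : ℝ × ℝ → ℝ) (a : ℝ × ℝ) : ℝ := -hilbert k φ a

/-- `χ = ψ_α / J`. -/
def chi (k : ℝ) (η φ : ℝ × ℝ → ℝ) (a : ℝ × ℝ) : ℝ := dAlpha k (stream k φ) a / jac k η a

/-- The right-hand side of the equation for `η_t`:
`-η_α H[χ] - ξ_α χ + C₁ η_α`. -/
def etaRHS (k C₁ : ℝ) (η φ : ℝ × ℝ → ℝ) (a : ℝ × ℝ) : ℝ :=
  -(dAlpha k η a) * hilbert k (chi k η φ) a - xiAlpha k η a * chi k η φ a + C₁ * dAlpha k η a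

/-- The right-hand side of the equation for `φ_t`:
`P[(ψ_α² - φ_α²)/(2J) - φ_α H[χ] + C₁ φ_α - g η + τ κ]`. -/
def phiRHS (k g τ C₁ : ℝ) (η φ : ℝ × ℝ → ℝ) : ℝ × ℝ → ℝ :=
  zeroMeanPart fun a =>
    (dAlpha k (stream k φ) a ^ 2 - dAlpha k φ a ^ 2) / (2 * jac k η a)
      - dAlpha k φ a * hilbert k (chi k η φ) a + C₁ * dAlpha k φ a - g * η a
      + τ * curvature k η a

/-- The right-hand side of the equation for `dx₀/dt`: `P₀[ξ_α V/s_α - η_α U/s_α]`, where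
`V/s_α = -H[χ] + C₁` and `U/s_α = -χ`. -/
def xZeroRHS (k C₁ : ℝ) (η φ : ℝ × ℝ → ℝ) : ℝ :=
  torusMean fun a =>
    xiAlpha k η a * (-hilbert k (chi k η φ) a + C₁) - dAlpha k η a * (-chi k η φ a)

/-- The choice `C₁ = [H(ψ_α/J) - η_α ψ_α / (ξ_α J)]` at `(α₁, α₂) = (0, 0)`. -/
def pinnedC₁ (k : ℝ) (η φ : ℝ × ℝ → ℝ) : ℝ :=
  hilbert k (chi k η φ) (0, 0) -
    dAlpha k η (0, 0) * dAlpha k (stream k φ) (0, 0) / (xiAlpha k η (0, 0) * jac k η (0, 0))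

/-- `(ζ, φ)`, with `ζ = ξ + iη`, is a (real-analytic) solution on the time interval `I` of the torus
version of the equations of motion in the conformal framework, for the coefficient `C₁(t)`.
Here `ξ` is reconstructed from `η` and `x₀` by `ξ = x₀(t) + H[η]`. -/
structure IsTorusSolution (k g τ : ℝ) (C₁ : ℝ → ℝ) (I : Set ℝ)
    (ζ : ℝ → ℝ × ℝ → ℂ) (φ : ℝ → ℝ × ℝ → ℝ) : Prop where
  analytic_zeta : AnalyticOnNhd ℝ (fun p : ℝ × (ℝ × ℝ) => ζ p.1 p.2) (I ×ˢ univ)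
  analytic_phi : AnalyticOnNhd ℝ (fun p : ℝ × (ℝ × ℝ) => φ p.1 p.2) (I ×ˢ univ)
  periodic_zeta : ∀ t ∈ I, TorusPeriodic (ζ t)
  periodic_phi : ∀ t ∈ I, TorusPeriodic (φ t)
  jac_ne_zero : ∀ t ∈ I, ∀ a, jac k (fun b => (ζ t b).im) a ≠ 0
  reconstruct : ∃ x₀ : ℝ → ℝ, ∀ t ∈ I,
    (∀ a, (ζ t a).re = x₀ t + hilbert k (fun b => (ζ t b).im) a) ∧
    HasDerivWithinAt x₀ (xZeroRHS k (C₁ t) (fun b => (ζ t b).im) (φ t)) I t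
  eta_eq : ∀ t ∈ I, ∀ a,
    HasDerivWithinAt (fun s => (ζ s a).im)
      (etaRHS k (C₁ t) (fun b => (ζ t b).im) (φ t) a) I t
  phi_eq : ∀ t ∈ I, ∀ a,
    HasDerivWithinAt (fun s => φ s a)
      (phiRHS k g τ (C₁ t) (fun b => (ζ t b).im) (φ t) a) I t

/-- A solution of the torus equations in which `C₁` is given, at every time, by `pinnedC₁`
(whose denominator is required not to vanish). -/
def IsPinnedTorusSolution (k g τ : ℝ) (I : Set ℝ)
    (ζ : ℝ → ℝ × ℝ → ℂ) (φ : ℝ → ℝ × ℝ → ℝ) : Prop :=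
  (∀ t ∈ I, xiAlpha k (fun b => (ζ t b).im) (0, 0) ≠ 0) ∧
  IsTorusSolution k g τ (fun t => pinnedC₁ k (fun b => (ζ t b).im) (φ t)) I ζ φ

/-- The torus version of the traveling wave equation `P[c²/(2J) + gη - τκ] = 0`. -/
def IsTravelingProfile (k g τ c : ℝ) (η : ℝ × ℝ → ℝ) : Prop :=
  ∀ a, zeroMeanPart
    (fun b => c ^ 2 / (2 * jac k η b) + g * η b - τ * curvature k η b) a = 0

/-- `ζ̃₀ = ξ̃₀ + iη̃₀` with `ξ̃₀ = H[η̃₀]`. -/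
def zetaZero (k : ℝ) (η₀ : ℝ × ℝ → ℝ) (a : ℝ × ℝ) : ℂ :=
  (hilbert k η₀ a : ℂ) + Complex.I * (η₀ a : ℂ)

/-- `φ̃₀ = c ξ̃₀`. -/
def phiZero (k c : ℝ) (η₀ : ℝ × ℝ → ℝ) (a : ℝ × ℝ) : ℝ := c * hilbert k η₀ a

/-- `ξ₀(α; θ) = α + ξ̃₀(α, θ + kα)`. -/
def xiLine (k : ℝ) (η₀ : ℝ × ℝ → ℝ) (θ α : ℝ) : ℝ := α + hilbert k η₀ (α, θ + k * α)

/-- `ζ₀(α; θ) = α + ζ̃₀(α, θ + kα)`. -/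
def zetaLine (k : ℝ) (η₀ : ℝ × ℝ → ℝ) (θ α : ℝ) : ℂ := (α : ℂ) + zetaZero k η₀ (α, θ + k * α)

/-- The shifted traveling form
`ζ̃(α₁, α₂, t) = ζ̃₀(α₁ - α₀(t), α₂ - kα₀(t)) + ct - α₀(t)`. -/
def shiftedZeta (k c : ℝ) (η₀ : ℝ × ℝ → ℝ) (α₀ : ℝ → ℝ) (t : ℝ) (a : ℝ × ℝ) : ℂ :=
  zetaZero k η₀ (a.1 - α₀ t, a.2 - k * α₀ t) + ((c * t - α₀ t : ℝ) : ℂ)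

/-- The shifted traveling form `φ̃(α₁, α₂, t) = φ̃₀(α₁ - α₀(t), α₂ - kα₀(t))`. -/
def shiftedPhi (k c : ℝ) (η₀ : ℝ × ℝ → ℝ) (α₀ : ℝ → ℝ) (t : ℝ) (a : ℝ × ℝ) : ℝ :=
  phiZero k c η₀ (a.1 - α₀ t, a.2 - k * α₀ t)

end TorusWave

end

open Complex Set

noncomputable section

namespace TorusWave

open Filter Topology
open scoped Interval ComplexConjugate ContDiff

/-! ### Characters -/

/-! Existence. Since `H` has symbol -i sgn, the function f = ξ_α + iη_α of a profile has its
spectrum in {j₁ + k j₂ ≤ 0} and mean one. As Re f = ξ_α > 0, its reciprocal (ξ_α - iη_α)/J has the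
same two properties (`coeff_inv_of_lower`). Comparing real and imaginary parts gives H[η_α/J] = 1 -
ξ_α/J (`hilbert_dAlpha_div_jac`). With φ = c H[η] one has ψ_α = c η_α, so χ = c η_α/J and H[χ] = c(1
- ξ_α/J) are explicit. The equations collapse: the right-hand sides for η and φ become (C₁ - c)η_α
and (C₁ - c)φ_α, the second by the traveling wave equation; dx₀/dt = C₁; and the pinned choice is C₁
= c - c/ξ_α(0,0). The solution is therefore the initial profile transported along (1, k) by a phase
α₀(t) with α₀' = c/ξ_α evaluated at (-α₀, -kα₀). This is the time derivative of the constraint ct -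
α₀ + ξ̃₀(-α₀, -kα₀) = 0, which is the implicit equation at (-ct, -kct) with value ct - α₀.
Positivity of ξ_α makes that equation strictly monotone along each line, and the inverse function
theorem makes its solution analytic (`exists_unique_implicit`). Evenness of η₀ gives α₀(0) = 0.

Uniqueness. The right-hand sides lose spatial derivatives, so the argument works order by order in
time and uses analyticity. If the difference of two solutions vanishes to order n ≥ 1 at t = 0, so
do its spatial derivatives, and the difference together with the α-derivatives in the equations is
O(tⁿ). The right-hand sides then differ by O(tⁿ), so the time derivative of the difference is O(tⁿ)
and the order of vanishing is n + 1 (`VanishOrder.succ`). Hence all time derivatives vanish at 0,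
and the identity theorem on the interval concludes (`eta_phi_unique`). Finally x₀ is recovered from
its derivative and initial value (`shifted_unique`). The norm for these estimates must control `H`
as well as products and reciprocals. The Wiener norm, the sum of the absolute values of the Fourier
coefficients, does: `H` is a contraction, products are submultiplicative, and a small perturbation
of 1 is inverted by a Neumann series. Four spatial derivatives dominate it
(`Smooth.hasW_of_derivBound`). Once the last Hilbert transform has been taken, the sup norm suffices
for the square root in the curvature, the mean and the value at the origin. -/

lemma torusChar_zero (a : ℝ × ℝ) : torusChar 0 a = 1 := by simp [torusChar]

lemma torusChar_add (i j : ℤ × ℤ) (a : ℝ × ℝ) :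
    torusChar (i + j) a = torusChar i a * torusChar j a := by
  simp only [torusChar, ← Complex.exp_add, Prod.fst_add, Prod.snd_add]
  push_cast; ring_nf

lemma torusChar_add_right (j : ℤ × ℤ) (a b : ℝ × ℝ) :
    torusChar j (a + b) = torusChar j a * torusChar j b := by
  simp only [torusChar, ← Complex.exp_add, Prod.fst_add, Prod.snd_add]
  push_cast; ring_nf

lemma torusChar_eq_exp_ofReal (j : ℤ × ℤ) (a : ℝ × ℝ) :
    torusChar j a = Complex.exp (((j.1 * a.1 + j.2 * a.2 : ℝ) : ℂ) * I) := by
  simp only [torusChar]; push_cast; ring_nf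

lemma norm_torusChar (j : ℤ × ℤ) (a : ℝ × ℝ) : ‖torusChar j a‖ = 1 := by
  rw [torusChar_eq_exp_ofReal, Complex.norm_exp_ofReal_mul_I]

lemma torusChar_neg (j : ℤ × ℤ) (a : ℝ × ℝ) : torusChar (-j) a = conj (torusChar j a) := by
  simp only [torusChar, ← Complex.exp_conj, Prod.fst_neg, Prod.snd_neg, map_mul, map_add,
    Complex.conj_I, Complex.conj_ofReal, map_intCast]
  push_cast; ring_nf

lemma continuous_torusChar (j : ℤ × ℤ) : Continuous (torusChar j) := by
  unfold torusChar; fun_prop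

lemma torusChar_eq_mul (j : ℤ × ℤ) (s r : ℝ) :
    torusChar j (s, r) = Complex.exp (I * j.1 * s) * Complex.exp (I * j.2 * r) := by
  simp only [torusChar, ← Complex.exp_add]; ring_nf

lemma torusChar_apply_zero (j : ℤ × ℤ) : torusChar j (0, 0) = 1 := by simp [torusChar]

lemma exp_int_mul_two_pi (n : ℤ) : Complex.exp (I * n * ((2 * Real.pi : ℝ) : ℂ)) = 1 := by
  rw [Complex.exp_eq_one_iff]; exact ⟨n, by push_cast; ring⟩

lemma torusPeriodic_torusChar (j : ℤ × ℤ) : TorusPeriodic (torusChar j) := by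
  rintro ⟨s, r⟩
  simp only [torusChar_eq_mul, Complex.ofReal_add, mul_add, Complex.exp_add, exp_int_mul_two_pi,
    mul_one, and_self]

/-! ### Means and Fourier coefficients of complex functions -/

/-- The mean of a complex function on the torus. -/
def cmean (u : ℝ × ℝ → ℂ) : ℂ :=
  (1 / (2 * (Real.pi : ℂ)) ^ 2) *
    ∫ s in (0 : ℝ)..(2 * Real.pi), ∫ r in (0 : ℝ)..(2 * Real.pi), u (s, r)

/-- The Fourier coefficients of a complex function on the torus. -/
def cCoeff (u : ℝ × ℝ → ℂ) (j : ℤ × ℤ) : ℂ := cmean fun a => u a * torusChar (-j) a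

lemma torusCoeff_eq (u : ℝ × ℝ → ℝ) : torusCoeff u = cCoeff fun a => (u a : ℂ) := rfl

lemma continuous_inner_integral {E : Type*} [NormedAddCommGroup E] [NormedSpace ℝ E]
    {u : ℝ × ℝ → E} (hu : Continuous u) :
    Continuous fun s => ∫ r in (0 : ℝ)..(2 * Real.pi), u (s, r) :=
  intervalIntegral.continuous_parametric_intervalIntegral_of_continuous' (by fun_prop) _ _

lemma cmean_add {u v : ℝ × ℝ → ℂ} (hu : Continuous u) (hv : Continuous v) :
    cmean (fun a => u a + v a) = cmean u + cmean v := by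
  have h : ∀ s : ℝ, ∫ r in (0 : ℝ)..(2 * Real.pi), (u (s, r) + v (s, r)) =
      (∫ r in (0 : ℝ)..(2 * Real.pi), u (s, r)) + ∫ r in (0 : ℝ)..(2 * Real.pi), v (s, r) :=
    fun s => intervalIntegral.integral_add
      (Continuous.intervalIntegrable (by fun_prop) _ _)
      (Continuous.intervalIntegrable (by fun_prop) _ _)
  simp only [cmean, h]
  rw [intervalIntegral.integral_add ((continuous_inner_integral hu).intervalIntegrable _ _)
    ((continuous_inner_integral hv).intervalIntegrable _ _), mul_add]

lemma cmean_const_mul (z : ℂ) (u : ℝ × ℝ → ℂ) : cmean (fun a => z * u a) = z * cmean u := by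
  simp only [cmean, intervalIntegral.integral_const_mul]; ring

lemma cmean_ofReal (u : ℝ × ℝ → ℝ) : cmean (fun a => (u a : ℂ)) = torusMean u := by
  simp only [cmean, torusMean, intervalIntegral.integral_ofReal]; push_cast; ring

lemma norm_cmean_le {u : ℝ × ℝ → ℂ} {M : ℝ}
    (h : ∀ s ∈ Icc 0 (2 * Real.pi), ∀ r ∈ Icc 0 (2 * Real.pi), ‖u (s, r)‖ ≤ M) :
    ‖cmean u‖ ≤ M := by
  have hp : (0 : ℝ) < 2 * Real.pi := by positivity
  have h1 : ∀ s ∈ Ι (0 : ℝ) (2 * Real.pi),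
      ‖∫ r in (0 : ℝ)..(2 * Real.pi), u (s, r)‖ ≤ M * (2 * Real.pi) := by
    intro s hs
    rw [uIoc_of_le hp.le] at hs
    have := intervalIntegral.norm_integral_le_of_norm_le_const (a := 0) (b := 2 * Real.pi)
      (f := fun r => u (s, r)) (C := M) (fun r hr => by
        rw [uIoc_of_le hp.le] at hr
        exact h s (Ioc_subset_Icc_self hs) r (Ioc_subset_Icc_self hr))
    rwa [sub_zero, abs_of_pos hp] at this
  have h2 := intervalIntegral.norm_integral_le_of_norm_le_const h1
  rw [sub_zero, abs_of_pos hp] at h2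
  have h3 : ‖(1 / (2 * (Real.pi : ℂ)) ^ 2)‖ = 1 / (2 * Real.pi) ^ 2 := by
    have : (1 / (2 * (Real.pi : ℂ)) ^ 2) = ((1 / (2 * Real.pi) ^ 2 : ℝ) : ℂ) := by push_cast; ring
    rw [this, Complex.norm_real, Real.norm_of_nonneg (by positivity)]
  rw [cmean, norm_mul, h3]
  calc 1 / (2 * Real.pi) ^ 2 * _ ≤ 1 / (2 * Real.pi) ^ 2 * (M * (2 * Real.pi) * (2 * Real.pi)) := by
        gcongr
    _ = M := by field_simp

lemma integral_exp_int (n : ℤ) :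
    ∫ r in (0 : ℝ)..(2 * Real.pi), Complex.exp (I * n * r) = if n = 0 then 2 * Real.pi else 0 := by
  split_ifs with hn
  · simp [hn]
  · have : (I * n : ℂ) ≠ 0 := mul_ne_zero I_ne_zero (by exact_mod_cast hn)
    rw [integral_exp_mul_complex this, exp_int_mul_two_pi]; simp

lemma cmean_torusChar (j : ℤ × ℤ) : cmean (torusChar j) = if j = 0 then 1 else 0 := by
  simp only [cmean, torusChar_eq_mul, intervalIntegral.integral_const_mul,
    intervalIntegral.integral_mul_const, integral_exp_int]
  have hp : (Real.pi : ℂ) ≠ 0 := by exact_mod_cast Real.pi_ne_zero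
  by_cases h1 : j.1 = 0 <;> by_cases h2 : j.2 = 0 <;>
    simp [h1, h2, Prod.ext_iff]
  field_simp

/-! ### Absolutely convergent Fourier series -/

/-- `u` is the sum of the absolutely convergent Fourier series with coefficients `c`. -/
structure HasW (u : ℝ × ℝ → ℂ) (c : ℤ × ℤ → ℂ) : Prop where
  summable : Summable fun j => ‖c j‖
  hasSum : ∀ a, HasSum (fun j => c j * torusChar j a) (u a)

/-- The Wiener norm of a coefficient family. -/
def wNorm (c : ℤ × ℤ → ℂ) : ℝ := ∑' j, ‖c j‖

lemma wNorm_nonneg (c : ℤ × ℤ → ℂ) : 0 ≤ wNorm c := tsum_nonneg fun _ => norm_nonneg _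

lemma norm_mul_torusChar (z : ℂ) (j : ℤ × ℤ) (a : ℝ × ℝ) : ‖z * torusChar j a‖ = ‖z‖ := by
  rw [norm_mul, norm_torusChar, mul_one]

lemma HasW.of_summable {c : ℤ × ℤ → ℂ} (h : Summable fun j => ‖c j‖) :
    HasW (fun a => ∑' j, c j * torusChar j a) c :=
  ⟨h, fun a => (Summable.of_norm (by simpa only [norm_mul_torusChar] using h)).hasSum⟩

lemma HasW.eq_tsum {u : ℝ × ℝ → ℂ} {c : ℤ × ℤ → ℂ} (h : HasW u c) :
    u = fun a => ∑' j, c j * torusChar j a := funext fun a => (h.hasSum a).tsum_eq.symm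

lemma HasW.continuous {u : ℝ × ℝ → ℂ} {c : ℤ × ℤ → ℂ} (h : HasW u c) : Continuous u := by
  rw [h.eq_tsum]
  exact continuous_tsum (fun j => continuous_const.mul (continuous_torusChar j)) h.summable
    fun j a => (norm_mul_torusChar _ _ _).le

lemma HasW.periodic {u : ℝ × ℝ → ℂ} {c : ℤ × ℤ → ℂ} (h : HasW u c) : TorusPeriodic u := by
  intro a
  simp only [h.eq_tsum, (torusPeriodic_torusChar _ a).1, (torusPeriodic_torusChar _ a).2, and_self]

lemma HasW.norm_le {u : ℝ × ℝ → ℂ} {c : ℤ × ℤ → ℂ} (h : HasW u c) (a : ℝ × ℝ) :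
    ‖u a‖ ≤ wNorm c := by
  rw [h.eq_tsum]
  exact (norm_tsum_le_tsum_norm (by simpa only [norm_mul_torusChar] using h.summable)).trans
    (by simp only [norm_mul_torusChar]; rfl)

lemma HasW.norm_coeff_le {u : ℝ × ℝ → ℂ} {c : ℤ × ℤ → ℂ} (h : HasW u c) (j : ℤ × ℤ) :
    ‖c j‖ ≤ wNorm c := h.summable.le_tsum j fun _ _ => norm_nonneg _

lemma HasW.add {u v : ℝ × ℝ → ℂ} {c d : ℤ × ℤ → ℂ} (hu : HasW u c) (hv : HasW v d) :
    HasW (fun a => u a + v a) (fun j => c j + d j) :=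
  ⟨(hu.summable.add hv.summable).of_nonneg_of_le (fun _ => norm_nonneg _) fun _ => norm_add_le _ _,
    fun a => by simpa only [add_mul] using (hu.hasSum a).add (hv.hasSum a)⟩

lemma wNorm_add_le {u v : ℝ × ℝ → ℂ} {c d : ℤ × ℤ → ℂ} (hu : HasW u c) (hv : HasW v d) :
    wNorm (fun j => c j + d j) ≤ wNorm c + wNorm d := by
  rw [wNorm, wNorm, wNorm, ← hu.summable.tsum_add hv.summable]
  exact (hu.add hv).summable.tsum_le_tsum (fun _ => norm_add_le _ _)
    (hu.summable.add hv.summable)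

lemma HasW.const_mul {u : ℝ × ℝ → ℂ} {c : ℤ × ℤ → ℂ} (z : ℂ) (hu : HasW u c) :
    HasW (fun a => z * u a) (fun j => z * c j) :=
  ⟨by simpa only [norm_mul] using hu.summable.mul_left ‖z‖,
    fun a => by simpa only [mul_assoc] using (hu.hasSum a).mul_left z⟩

lemma wNorm_const_mul (z : ℂ) (c : ℤ × ℤ → ℂ) : wNorm (fun j => z * c j) = ‖z‖ * wNorm c := by
  simp only [wNorm, norm_mul, tsum_mul_left]

lemma HasW.sub {u v : ℝ × ℝ → ℂ} {c d : ℤ × ℤ → ℂ} (hu : HasW u c) (hv : HasW v d) :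
    HasW (fun a => u a - v a) (fun j => c j - d j) := by
  simpa [sub_eq_add_neg] using hu.add (hv.const_mul (-1))

lemma hasW_torusChar (i : ℤ × ℤ) : HasW (torusChar i) (Pi.single i 1) := by
  have hz : ∀ j, j ≠ i → (Pi.single i 1 : ℤ × ℤ → ℂ) j = 0 :=
    fun j hj => Pi.single_eq_of_ne hj _
  refine ⟨summable_of_ne_finset_zero (s := {i}) fun j hj => by
    rw [hz j (by simpa using hj), norm_zero], fun a => ?_⟩
  have := hasSum_single (f := fun j => (Pi.single i 1 : ℤ × ℤ → ℂ) j * torusChar j a) i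
    fun j hj => by rw [hz j hj, zero_mul]
  simpa using this

lemma hasW_one : HasW (fun _ => 1) (Pi.single 0 1) := by
  have := hasW_torusChar 0
  rwa [show torusChar 0 = fun _ => 1 from funext torusChar_zero] at this

lemma hasSum_of_eq {ι : Type*} {f g : ι → ℂ} {z : ℂ} (h : HasSum f z) (e : ∀ i, f i = g i) :
    HasSum g z := by
  rwa [show g = f from (funext e).symm]

lemma HasW.mul_torusChar {u : ℝ × ℝ → ℂ} {c : ℤ × ℤ → ℂ} (hu : HasW u c) (i : ℤ × ℤ) :
    HasW (fun a => u a * torusChar i a) (fun j => c (j - i)) := by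
  refine ⟨hu.summable.comp_injective (sub_left_injective (b := i)), fun a => ?_⟩
  have := (hu.hasSum a).mul_right (torusChar i a)
  rw [← (Equiv.subRight i).hasSum_iff] at this
  refine hasSum_of_eq this fun j => ?_
  change c (j - i) * torusChar (j - i) a * torusChar i a = _
  rw [mul_assoc, ← torusChar_add, sub_add_cancel]

/-- Finite partial sums have the right mean by linearity, and the remainder is uniformly bounded by
the ℓ¹ tail of the coefficients, which tends to zero. -/
lemma HasW.cmean_eq {u : ℝ × ℝ → ℂ} {c : ℤ × ℤ → ℂ} (hu : HasW u c) : cmean u = c 0 := by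
  have hs : ∀ s : Finset (ℤ × ℤ), HasW (fun a => ∑ j ∈ s, c j * torusChar j a)
      (fun i => ∑ j ∈ s, c j * (Pi.single j 1 : ℤ × ℤ → ℂ) i) ∧
      cmean (fun a => ∑ j ∈ s, c j * torusChar j a) = ∑ j ∈ s, if j = 0 then c j else 0 := by
    intro s
    induction s using Finset.induction_on with
    | empty =>
      refine ⟨?_, by simp [cmean]⟩
      simpa using hasW_one.const_mul 0
    | insert j s hj ih =>
      have h1 := (hasW_torusChar j).const_mul (c j)
      refine ⟨by simpa only [Finset.sum_insert hj] using h1.add ih.1, ?_⟩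
      simp only [Finset.sum_insert hj]
      rw [cmean_add h1.continuous ih.1.continuous, ih.2, cmean_const_mul, cmean_torusChar]
      simp
  have hb : ∀ s : Finset (ℤ × ℤ), 0 ∈ s → ‖cmean u - c 0‖ ≤ ∑' j : {j // j ∉ s}, ‖c j‖ := by
    intro s h0
    obtain ⟨h1, h2⟩ := hs s
    have h3 : cmean u = cmean (fun a => ∑ j ∈ s, c j * torusChar j a) +
        cmean (fun a => u a - ∑ j ∈ s, c j * torusChar j a) := by
      rw [← cmean_add h1.continuous (hu.sub h1).continuous]; simp
    rw [h3, h2, Finset.sum_ite_eq' s 0, if_pos h0, add_sub_cancel_left]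
    refine norm_cmean_le fun x _ y _ => ?_
    have hsum := (hu.hasSum (x, y)).summable
    rw [← (hu.hasSum (x, y)).tsum_eq, ← hsum.sum_add_tsum_compl (s := s), add_sub_cancel_left]
    have hn : Summable fun j : {j // j ∉ s} => ‖c j * torusChar j (x, y)‖ := by
      simp only [norm_mul_torusChar]; exact hu.summable.subtype _
    exact (norm_tsum_le_tsum_norm hn).trans (by simp only [norm_mul_torusChar]; rfl)
  have ht := tendsto_tsum_compl_atTop_zero fun j => ‖c j‖
  have : ‖cmean u - c 0‖ ≤ 0 := ge_of_tendsto ht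
    ((eventually_ge_atTop {0}).mono fun s hsub => hb s (hsub (Finset.mem_singleton_self _)))
  exact sub_eq_zero.1 (norm_le_zero_iff.1 this)

/-- Multiplying by a character shifts the coefficients, so every coefficient is a mean. Coefficients
are hence unique, and identities between functions can be checked on coefficients. -/
lemma HasW.cCoeff_eq {u : ℝ × ℝ → ℂ} {c : ℤ × ℤ → ℂ} (hu : HasW u c) : cCoeff u = c := by
  funext j
  rw [cCoeff, (hu.mul_torusChar (-j)).cmean_eq, sub_neg_eq_add, zero_add]

lemma HasW.unique {u : ℝ × ℝ → ℂ} {c d : ℤ × ℤ → ℂ} (hu : HasW u c) (hv : HasW u d) : c = d := by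
  rw [← hu.cCoeff_eq, hv.cCoeff_eq]

lemma HasW.conj {u : ℝ × ℝ → ℂ} {c : ℤ × ℤ → ℂ} (hu : HasW u c) :
    HasW (fun a => conj (u a)) (fun j => conj (c (-j))) := by
  refine ⟨by simp only [RCLike.norm_conj]; exact hu.summable.comp_injective neg_injective,
    fun a => ?_⟩
  have := (hu.hasSum a).map (starRingEnd ℂ) Complex.continuous_conj
  rw [← (Equiv.neg (ℤ × ℤ)).hasSum_iff] at this
  convert this using 2 with j
  simp only [Function.comp, Equiv.neg_apply, map_mul, torusChar_neg, Complex.conj_conj]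

lemma HasW.translate {u : ℝ × ℝ → ℂ} {c : ℤ × ℤ → ℂ} (hu : HasW u c) (b : ℝ × ℝ) :
    HasW (fun a => u (a + b)) (fun j => c j * torusChar j b) :=
  ⟨by simpa only [norm_mul_torusChar] using hu.summable, fun a => by
    convert hu.hasSum (a + b) using 2 with j
    rw [torusChar_add_right]; ring⟩

lemma wNorm_translate (c : ℤ × ℤ → ℂ) (b : ℝ × ℝ) :
    wNorm (fun j => c j * torusChar j b) = wNorm c := by
  simp only [wNorm, norm_mul_torusChar]

/-- Convolution of coefficient families. -/
def wConv (c d : ℤ × ℤ → ℂ) (j : ℤ × ℤ) : ℂ := ∑' i, c i * d (j - i)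

/-- The reindexing `(j, i) ↦ (i, j - i)`. -/
def convEquiv : (ℤ × ℤ) × (ℤ × ℤ) ≃ (ℤ × ℤ) × (ℤ × ℤ) where
  toFun p := (p.2, p.1 - p.2)
  invFun p := (p.1 + p.2, p.1)
  left_inv p := by simp
  right_inv p := by simp

lemma summable_conv {c d : ℤ × ℤ → ℂ} (hc : Summable fun j => ‖c j‖)
    (hd : Summable fun j => ‖d j‖) :
    Summable fun p : (ℤ × ℤ) × (ℤ × ℤ) => ‖c p.2‖ * ‖d (p.1 - p.2)‖ :=
  convEquiv.summable_iff.2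
    (hc.mul_of_nonneg hd (fun _ => norm_nonneg _) (fun _ => norm_nonneg _))

lemma norm_wConv_le {c d : ℤ × ℤ → ℂ} (hc : Summable fun j => ‖c j‖)
    (hd : Summable fun j => ‖d j‖) (j : ℤ × ℤ) :
    ‖wConv c d j‖ ≤ ∑' i, ‖c i‖ * ‖d (j - i)‖ := by
  have := (summable_conv hc hd).prod_factor j
  exact (norm_tsum_le_tsum_norm (by simpa only [norm_mul] using this)).trans
    (by simp only [norm_mul]; rfl)

/-- The double series of the product is absolutely summable, so it may be summed along the fibres i
+ (j - i) = j. -/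
lemma HasW.mul {u v : ℝ × ℝ → ℂ} {c d : ℤ × ℤ → ℂ} (hu : HasW u c) (hv : HasW v d) :
    HasW (fun a => u a * v a) (wConv c d) := by
  refine ⟨(summable_conv hu.summable hv.summable).prod.of_nonneg_of_le (fun _ => norm_nonneg _)
    (norm_wConv_le hu.summable hv.summable), fun a => ?_⟩
  have h1 : Summable fun p : (ℤ × ℤ) × (ℤ × ℤ) =>
      (c p.1 * torusChar p.1 a) * (d p.2 * torusChar p.2 a) :=
    summable_mul_of_summable_norm (f := fun i => c i * torusChar i a)
      (g := fun i => d i * torusChar i a)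
      (by simpa only [norm_mul_torusChar] using hu.summable)
      (by simpa only [norm_mul_torusChar] using hv.summable)
  have h2 := (hu.hasSum a).mul (hv.hasSum a) h1
  rw [← convEquiv.hasSum_iff] at h2
  have h3 : ∀ j : ℤ × ℤ, HasSum (fun i => c i * torusChar i a * (d (j - i) * torusChar (j - i) a))
      (wConv c d j * torusChar j a) := by
    intro j
    have h4 : Summable fun i => c i * d (j - i) :=
      Summable.of_norm (by
        simpa only [norm_mul] using (summable_conv hu.summable hv.summable).prod_factor j)
    refine hasSum_of_eq (h4.hasSum.mul_right (torusChar j a)) fun i => ?_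
    rw [show torusChar j a = torusChar i a * torusChar (j - i) a by
      rw [← torusChar_add, add_sub_cancel] ]
    ring
  exact h2.prod_fiberwise h3

lemma wNorm_wConv_le {c d : ℤ × ℤ → ℂ} (hc : Summable fun j => ‖c j‖)
    (hd : Summable fun j => ‖d j‖) : wNorm (wConv c d) ≤ wNorm c * wNorm d := by
  have hs := summable_conv hc hd
  have h1 : wNorm (wConv c d) ≤ ∑' j, ∑' i, ‖c i‖ * ‖d (j - i)‖ :=
    ((HasW.of_summable hc).mul (HasW.of_summable hd)).summable.tsum_le_tsum
      (norm_wConv_le hc hd) hs.prod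
  refine h1.trans_eq ?_
  rw [← hs.tsum_prod, wNorm, wNorm, hc.tsum_mul_tsum hd
    (hc.mul_of_nonneg hd (fun _ => norm_nonneg _) (fun _ => norm_nonneg _))]
  exact convEquiv.tsum_eq fun p : (ℤ × ℤ) × (ℤ × ℤ) => ‖c p.1‖ * ‖d p.2‖

/-- A bounded Fourier multiplier preserves absolutely convergent series. -/
lemma HasW.multiplier {u : ℝ × ℝ → ℂ} {c m : ℤ × ℤ → ℂ} (hu : HasW u c) (hm : ∀ j, ‖m j‖ ≤ 1) :
    HasW (fun a => ∑' j, m j * c j * torusChar j a) (fun j => m j * c j) :=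
  .of_summable (hu.summable.of_nonneg_of_le (fun _ => norm_nonneg _) fun j => by
    rw [norm_mul]; exact mul_le_of_le_one_left (norm_nonneg _) (hm j))

lemma wNorm_multiplier_le {c m : ℤ × ℤ → ℂ} (hc : Summable fun j => ‖c j‖)
    (hm : ∀ j, ‖m j‖ ≤ 1) : wNorm (fun j => m j * c j) ≤ wNorm c :=
  ((HasW.of_summable hc).multiplier hm).summable.tsum_le_tsum (fun j => by
    rw [norm_mul]; exact mul_le_of_le_one_left (norm_nonneg _) (hm j)) hc

/-- Summability of the norms makes the family `c n j` absolutely summable over ℕ × ℤ², so the two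
summations commute. This gives convergence of the Neumann series below. -/
lemma HasW.tsum {u : ℕ → ℝ × ℝ → ℂ} {c : ℕ → ℤ × ℤ → ℂ} (hu : ∀ n, HasW (u n) (c n))
    (hs : Summable fun n => wNorm (c n)) :
    HasW (fun a => ∑' n, u n a) (fun j => ∑' n, c n j) ∧
      wNorm (fun j => ∑' n, c n j) ≤ ∑' n, wNorm (c n) := by
  have h1 : Summable fun p : ℕ × (ℤ × ℤ) => ‖c p.1 p.2‖ :=
    (summable_prod_of_nonneg fun _ => norm_nonneg _).2 ⟨fun n => (hu n).summable, hs⟩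
  have h1' : Summable fun p : (ℤ × ℤ) × ℕ => ‖c p.2 p.1‖ :=
    (Equiv.prodComm _ _).summable_iff.2 h1
  have hle : ∀ j, ‖∑' n, c n j‖ ≤ ∑' n, ‖c n j‖ := fun j =>
    norm_tsum_le_tsum_norm (h1'.prod_factor j)
  have hsum : Summable fun j => ‖∑' n, c n j‖ :=
    h1'.prod.of_nonneg_of_le (fun _ => norm_nonneg _) hle
  refine ⟨⟨hsum, fun a => ?_⟩, ?_⟩
  · have h2 : Summable fun p : ℕ × (ℤ × ℤ) => c p.1 p.2 * torusChar p.2 a :=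
      Summable.of_norm (by simpa only [norm_mul_torusChar] using h1)
    have h3 : HasSum (fun p : ℕ × (ℤ × ℤ) => c p.1 p.2 * torusChar p.2 a) (∑' n, u n a) := by
      have := h2.hasSum.prod_fiberwise fun n => (hu n).hasSum a
      rw [this.tsum_eq]; exact h2.hasSum
    rw [← (Equiv.prodComm _ _).hasSum_iff] at h3
    have h4 : ∀ j, HasSum (fun n => c n j * torusChar j a) ((∑' n, c n j) * torusChar j a) :=
      fun j => by
        have : Summable fun n => c n j := Summable.of_norm (h1'.prod_factor j)
        exact this.hasSum.mul_right _
    exact h3.prod_fiberwise h4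
  · refine (hsum.tsum_le_tsum hle h1'.prod).trans_eq ?_
    change _ = ∑' n, ∑' j, ‖c n j‖
    rw [← h1'.tsum_prod, ← h1.tsum_prod]
    exact (Equiv.prodComm (ℤ × ℤ) ℕ).tsum_eq fun p : ℕ × (ℤ × ℤ) => ‖c p.1 p.2‖

/-- Neumann series in the Wiener algebra. -/
lemma HasW.inv_one_add {u : ℝ × ℝ → ℂ} {c : ℤ × ℤ → ℂ} (hu : HasW u c) (hc : wNorm c ≤ 1 / 2) :
    ∃ d, HasW (fun a => (1 + u a)⁻¹) d ∧ wNorm d ≤ 2 := by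
  have hpow : ∀ n : ℕ, ∃ d, HasW (fun a => (-u a) ^ n) d ∧ wNorm d ≤ (1 / 2) ^ n := by
    intro n
    induction n with
    | zero =>
      refine ⟨_, by simpa using hasW_one, ?_⟩
      rw [wNorm, tsum_eq_single 0 fun j hj => by rw [Pi.single_eq_of_ne hj, norm_zero] ]
      simp
    | succ n ih =>
      obtain ⟨d, hd, hn⟩ := ih
      have h1 := hu.const_mul (-1)
      refine ⟨_, by simpa only [pow_succ, neg_one_mul (u _)] using hd.mul h1, ?_⟩
      refine (wNorm_wConv_le hd.summable h1.summable).trans ?_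
      rw [wNorm_const_mul, pow_succ, norm_neg, norm_one, one_mul]
      exact mul_le_mul hn hc (wNorm_nonneg _) (by positivity)
  choose d hd hn using hpow
  have hg : Summable fun n : ℕ => ((1 : ℝ) / 2) ^ n := summable_geometric_two
  have hs : Summable fun n => wNorm (d n) := hg.of_nonneg_of_le (fun _ => wNorm_nonneg _) hn
  obtain ⟨h1, h2⟩ := HasW.tsum hd hs
  refine ⟨_, ?_, h2.trans ((hs.tsum_le_tsum hn hg).trans_eq tsum_geometric_two)⟩
  convert h1 using 2 with a
  rw [tsum_geometric_of_norm_lt_one, sub_neg_eq_add]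
  rw [norm_neg]
  linarith [hu.norm_le a]

/-! ### Smooth functions on the torus -/

/-- Smooth functions on the torus. -/
structure Smooth {E : Type*} [NormedAddCommGroup E] [NormedSpace ℝ E] (u : ℝ × ℝ → E) : Prop where
  contDiff : ContDiff ℝ ∞ u
  periodic : TorusPeriodic u

section Smooth

variable {E : Type*} [NormedAddCommGroup E] [NormedSpace ℝ E]

lemma Smooth.continuous {u : ℝ × ℝ → E} (hu : Smooth u) : Continuous u := hu.contDiff.continuous

lemma Smooth.differentiable {u : ℝ × ℝ → E} (hu : Smooth u) : Differentiable ℝ u :=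
  hu.contDiff.differentiable (by simp)

lemma Smooth.lineDeriv_eq {u : ℝ × ℝ → E} (hu : Smooth u) (v : ℝ × ℝ) :
    (fun a => lineDeriv ℝ u a v) = fun a => fderiv ℝ u a v :=
  funext fun a => (hu.differentiable a).lineDeriv_eq_fderiv

lemma Smooth.lineDeriv {u : ℝ × ℝ → E} (hu : Smooth u) (v : ℝ × ℝ) :
    Smooth fun a => lineDeriv ℝ u a v := by
  refine ⟨?_, fun a => ?_⟩
  · rw [hu.lineDeriv_eq]
    exact (hu.contDiff.fderiv_right (m := ∞) (by simp)).clm_apply contDiff_const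
  · have h1 : ∀ a : ℝ × ℝ, u (a + (2 * Real.pi, 0)) = u a := fun a => by
      simpa [Prod.add_def] using (hu.periodic a).1
    have h2 : ∀ a : ℝ × ℝ, u (a + (0, 2 * Real.pi)) = u a := fun a => by
      simpa [Prod.add_def] using (hu.periodic a).2
    have e1 : (a.1 + 2 * Real.pi, a.2) = a + (2 * Real.pi, 0) := by ext <;> simp
    have e2 : (a.1, a.2 + 2 * Real.pi) = a + (0, 2 * Real.pi) := by ext <;> simp
    simp only [_root_.lineDeriv, e1, e2, add_right_comm a _ (_ • v), h1, h2, and_self]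

lemma Smooth.hasLineDerivAt {u : ℝ × ℝ → E} (hu : Smooth u) (a v : ℝ × ℝ) :
    HasLineDerivAt ℝ u (_root_.lineDeriv ℝ u a v) a v :=
  (hu.differentiable a).lineDifferentiableAt.hasLineDerivAt

lemma Smooth.add {u v : ℝ × ℝ → E} (hu : Smooth u) (hv : Smooth v) :
    Smooth fun a => u a + v a :=
  ⟨hu.contDiff.add hv.contDiff, fun a => by
    simp only [(hu.periodic a).1, (hu.periodic a).2, (hv.periodic a).1, (hv.periodic a).2,
      and_self]⟩

lemma Smooth.sub {u v : ℝ × ℝ → E} (hu : Smooth u) (hv : Smooth v) :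
    Smooth fun a => u a - v a :=
  ⟨hu.contDiff.sub hv.contDiff, fun a => by
    simp only [(hu.periodic a).1, (hu.periodic a).2, (hv.periodic a).1, (hv.periodic a).2,
      and_self]⟩

lemma Smooth.mul {A : Type*} [NormedRing A] [NormedAlgebra ℝ A] {u v : ℝ × ℝ → A}
    (hu : Smooth u) (hv : Smooth v) : Smooth fun a => u a * v a :=
  ⟨hu.contDiff.mul hv.contDiff, fun a => by
    simp only [(hu.periodic a).1, (hu.periodic a).2, (hv.periodic a).1, (hv.periodic a).2,
      and_self]⟩

lemma Smooth.inv {A : Type*} [NormedField A] [NormedAlgebra ℝ A] {u : ℝ × ℝ → A}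
    (hu : Smooth u) (h0 : ∀ a, u a ≠ 0) : Smooth fun a => (u a)⁻¹ :=
  ⟨hu.contDiff.inv h0, fun a => by simp only [(hu.periodic a).1, (hu.periodic a).2, and_self]⟩

lemma smooth_const (z : E) : Smooth fun _ : ℝ × ℝ => z := ⟨contDiff_const, fun _ => ⟨rfl, rfl⟩⟩

lemma Smooth.ofReal {u : ℝ × ℝ → ℝ} (hu : Smooth u) : Smooth fun a => (u a : ℂ) :=
  ⟨Complex.ofRealCLM.contDiff.comp hu.contDiff, fun a => by
    simp only [(hu.periodic a).1, (hu.periodic a).2, and_self]⟩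

lemma Smooth.translate {u : ℝ × ℝ → E} (hu : Smooth u) (b : ℝ × ℝ) :
    Smooth fun a => u (a + b) := by
  refine ⟨hu.contDiff.comp (contDiff_id.add contDiff_const), fun a => ?_⟩
  have e1 : (a.1 + 2 * Real.pi, a.2) + b = ((a + b).1 + 2 * Real.pi, (a + b).2) := by
    ext <;> simp; ring
  have e2 : (a.1, a.2 + 2 * Real.pi) + b = ((a + b).1, (a + b).2 + 2 * Real.pi) := by
    ext <;> simp; ring
  simp only [e1, e2, (hu.periodic (a + b)).1, (hu.periodic (a + b)).2, and_self]

end Smooth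

lemma smooth_torusChar (j : ℤ × ℤ) : Smooth (torusChar j) :=
  ⟨by
    rw [funext (torusChar_eq_exp_ofReal j)]
    have h : ContDiff ℝ ∞ fun a : ℝ × ℝ => (j.1 * a.1 + j.2 * a.2 : ℝ) := by fun_prop
    have : ContDiff ℝ ∞ fun a : ℝ × ℝ => ((j.1 * a.1 + j.2 * a.2 : ℝ) : ℂ) :=
      Complex.ofRealCLM.contDiff.comp h
    exact (this.mul contDiff_const).cexp, torusPeriodic_torusChar j⟩

/-- The frequency `⟨j, v⟩` of a character in the direction `v`. -/
def freq (v : ℝ × ℝ) (j : ℤ × ℤ) : ℝ := j.1 * v.1 + j.2 * v.2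

lemma hasLineDerivAt_torusChar (j : ℤ × ℤ) (a v : ℝ × ℝ) :
    HasLineDerivAt ℝ (torusChar j) (I * freq v j * torusChar j a) a v := by
  have h : HasDerivAt (fun t : ℝ => ((freq v j * t : ℝ) : ℂ) * I) (freq v j * I) 0 := by
    have := ((hasDerivAt_id (0 : ℝ)).const_mul (freq v j)).ofReal_comp.mul_const I
    simpa using this
  have h2 := (h.cexp.const_mul (torusChar j a))
  have e : (fun t : ℝ => torusChar j (a + t • v)) =
      fun t : ℝ => torusChar j a * Complex.exp (((freq v j * t : ℝ) : ℂ) * I) := by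
    funext t
    rw [torusChar_add_right, torusChar_eq_exp_ofReal j (t • v)]
    simp only [freq, Prod.smul_fst, Prod.smul_snd, smul_eq_mul]
    ring_nf
  rw [HasLineDerivAt, e]
  exact h2.congr_deriv (by simp only [mul_zero, ofReal_zero, zero_mul, Complex.exp_zero]; ring)

/-! ### Integration by parts on the torus -/

lemma cmean_swap {u : ℝ × ℝ → ℂ} (hu : Continuous u) :
    cmean u = cmean fun a => u (a.2, a.1) := by
  simp only [cmean]
  rw [MeasureTheory.intervalIntegral_intervalIntegral_swap (F := fun s r => u (s, r))]
  have hK : IsCompact (uIcc 0 (2 * Real.pi) ×ˢ uIcc 0 (2 * Real.pi)) :=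
    isCompact_uIcc.prod isCompact_uIcc
  exact (hu.continuousOn.integrableOn_compact hK).mono_set
    (prod_mono uIoc_subset_uIcc uIoc_subset_uIcc)

lemma cmean_lineDeriv_snd {u : ℝ × ℝ → ℂ} (hu : Smooth u) :
    cmean (fun a => lineDeriv ℝ u a (0, 1)) = 0 := by
  have h : ∀ s : ℝ, ∫ r in (0 : ℝ)..(2 * Real.pi), lineDeriv ℝ u (s, r) (0, 1) = 0 := by
    intro s
    have hd : ∀ r : ℝ, HasDerivAt (fun r => u (s, r)) (lineDeriv ℝ u (s, r) (0, 1)) r := by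
      intro r
      have h1 := hu.hasLineDerivAt (s, r) (0, 1)
      have h2 : HasDerivAt (fun x : ℝ => x - r) 1 r := (hasDerivAt_id r).sub_const r
      have h3 := HasDerivAt.scomp (g₁ := fun t : ℝ => u ((s, r) + t • (0, 1))) r
        (by rw [sub_self]; exact h1) h2
      simpa [Function.comp_def] using h3
    rw [intervalIntegral.integral_eq_sub_of_hasDerivAt (fun r _ => hd r)
      ((((hu.lineDeriv (0, 1)).continuous).comp (Continuous.prodMk_right s)).intervalIntegrable _ _)]
    have := (hu.periodic (s, 0)).2
    simp only [zero_add] at this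
    rw [this, sub_self]
  simp only [cmean, h]; simp

lemma Smooth.swap {u : ℝ × ℝ → ℂ} (hu : Smooth u) : Smooth fun a => u (a.2, a.1) :=
  ⟨hu.contDiff.comp (by fun_prop), fun a =>
    ⟨(hu.periodic (a.2, a.1)).2, (hu.periodic (a.2, a.1)).1⟩⟩

lemma cmean_lineDeriv_fst {u : ℝ × ℝ → ℂ} (hu : Smooth u) :
    cmean (fun a => lineDeriv ℝ u a (1, 0)) = 0 := by
  rw [cmean_swap (hu.lineDeriv _).continuous, ← cmean_lineDeriv_snd hu.swap]
  congr 1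

lemma cmean_lineDeriv {u : ℝ × ℝ → ℂ} (hu : Smooth u) (v : ℝ × ℝ) :
    cmean (fun a => lineDeriv ℝ u a v) = 0 := by
  have : (fun a => lineDeriv ℝ u a v) = fun a =>
      (v.1 : ℂ) * lineDeriv ℝ u a (1, 0) + (v.2 : ℂ) * lineDeriv ℝ u a (0, 1) := by
    funext a
    simp only [(hu.differentiable a).lineDeriv_eq_fderiv]
    conv_lhs => rw [show v = v.1 • ((1 : ℝ), (0 : ℝ)) + v.2 • ((0 : ℝ), (1 : ℝ)) by ext <;> simp]
    rw [map_add, map_smul, map_smul, Complex.real_smul, Complex.real_smul]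
  rw [this, cmean_add ((smooth_const _).mul (hu.lineDeriv _)).continuous
    ((smooth_const _).mul (hu.lineDeriv _)).continuous, cmean_const_mul, cmean_const_mul,
    cmean_lineDeriv_fst hu, cmean_lineDeriv_snd hu]
  simp

/-- Integration by parts: the derivative of u times the character of -j has mean zero. -/
lemma cCoeff_lineDeriv {u : ℝ × ℝ → ℂ} (hu : Smooth u) (v : ℝ × ℝ) (j : ℤ × ℤ) :
    cCoeff (fun a => lineDeriv ℝ u a v) j = I * freq v j * cCoeff u j := by
  have h := cmean_lineDeriv (hu.mul (smooth_torusChar (-j))) v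
  have e : (fun a => lineDeriv ℝ (fun a => u a * torusChar (-j) a) a v) = fun a =>
      lineDeriv ℝ u a v * torusChar (-j) a + (-(I * freq v j)) * (u a * torusChar (-j) a) := by
    funext a
    have h1 := hu.hasLineDerivAt a v
    have h2 := hasLineDerivAt_torusChar (-j) a v
    have h3 : HasLineDerivAt ℝ (fun a => u a * torusChar (-j) a) _ a v := HasDerivAt.mul h1 h2
    rw [h3.lineDeriv]
    simp [freq]; ring
  rw [e, cmean_add ((hu.lineDeriv v).mul (smooth_torusChar _)).continuous
    ((smooth_const _).mul (hu.mul (smooth_torusChar _))).continuous, cmean_const_mul] at h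
  simp only [cCoeff]
  linear_combination h

/-! ### Absolute convergence of Fourier series of smooth functions -/

/-- On the circle, a continuous function with summable Fourier coefficients is the sum of its
Fourier series, and here that series is zero. -/
lemma eq_zero_of_forall_integral_eq_zero {h : ℝ → ℂ} (hc : Continuous h)
    (hp : ∀ x, h (x + 2 * Real.pi) = h x)
    (h0 : ∀ n : ℤ, ∫ x in (0 : ℝ)..(2 * Real.pi), h x * Complex.exp (I * n * x) = 0) (x : ℝ) :
    h x = 0 := by
  have : Fact (0 < 2 * Real.pi) := ⟨by positivity⟩
  have hper : Function.Periodic h (2 * Real.pi) := hp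
  let f : C(AddCircle (2 * Real.pi), ℂ) :=
    ⟨hper.lift, continuous_coinduced_dom.2 hc⟩
  have hf : ∀ x : ℝ, f (x : AddCircle (2 * Real.pi)) = h x := fun x => hper.lift_coe x
  have hcoef : fourierCoeff f = 0 := by
    funext n
    rw [fourierCoeff_eq_intervalIntegral f n 0]
    have e : ∀ x : ℝ, (fourier (-n) (x : AddCircle (2 * Real.pi)) : ℂ) • f x =
        h x * Complex.exp (I * ((-n : ℤ) : ℂ) * x) := by
      intro x
      rw [hf, fourier_coe_apply, smul_eq_mul, mul_comm]
      congr 2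
      have : (Real.pi : ℂ) ≠ 0 := by exact_mod_cast Real.pi_ne_zero
      push_cast
      field_simp
    simp only [e, zero_add, h0]; simp
  have := has_pointwise_sum_fourier_series_of_summable (f := f)
    (by rw [hcoef]; exact summable_zero) (x : AddCircle (2 * Real.pi))
  simp only [hcoef, Pi.zero_apply, zero_smul] at this
  rw [← hf]
  exact this.unique hasSum_zero

/-- The one-variable statement is applied twice: first, in s, to the partial Fourier coefficients in
r, then to each slice in r. -/
lemma eq_zero_of_cCoeff_eq_zero {u : ℝ × ℝ → ℂ} (hc : Continuous u) (hp : TorusPeriodic u)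
    (h0 : ∀ j, cCoeff u j = 0) (a : ℝ × ℝ) : u a = 0 := by
  have hpi : (Real.pi : ℂ) ≠ 0 := by exact_mod_cast Real.pi_ne_zero
  have h1 : ∀ (n : ℤ) (s : ℝ),
      ∫ r in (0 : ℝ)..(2 * Real.pi), u (s, r) * Complex.exp (I * n * r) = 0 := by
    intro n
    refine eq_zero_of_forall_integral_eq_zero (continuous_inner_integral
      (u := fun a => u a * Complex.exp (I * n * a.2)) (by fun_prop))
      (fun s => by simp only [fun r => (hp (s, r)).1]) fun m => ?_
    have := h0 (-m, -n)
    simp only [cCoeff, cmean, torusChar_eq_mul, Prod.fst_neg, Prod.snd_neg, neg_neg] at this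
    rw [mul_eq_zero, or_iff_right (by simp [hpi])] at this
    rw [← this]
    congr 1 with s
    rw [← intervalIntegral.integral_mul_const]
    congr 1 with r
    ring
  exact eq_zero_of_forall_integral_eq_zero (h := fun r => u (a.1, r))
    (hc.comp (Continuous.prodMk_right _)) (fun r => (hp (a.1, r)).2) (fun n => h1 n a.1) a.2

/-- The difference of u and its Fourier series is continuous and periodic with vanishing
coefficients, hence zero. -/
lemma hasW_of_summable_cCoeff {u : ℝ × ℝ → ℂ} (hc : Continuous u) (hp : TorusPeriodic u)
    (hs : Summable fun j => ‖cCoeff u j‖) : HasW u (cCoeff u) := by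
  have hv := HasW.of_summable hs
  have h0 := eq_zero_of_cCoeff_eq_zero (u := fun a => u a - ∑' j, cCoeff u j * torusChar j a)
    (hc.sub hv.continuous) (fun a => by
      simp only [(hp a).1, (hp a).2, (hv.periodic a).1, (hv.periodic a).2, and_self]) fun j => by
      have h1 : Continuous fun a => u a * torusChar (-j) a := hc.mul (continuous_torusChar _)
      have h2 : Continuous fun a => (-1) * ((∑' i, cCoeff u i * torusChar i a) * torusChar (-j) a) :=
        continuous_const.mul (hv.continuous.mul (continuous_torusChar _))
      have h3 := cmean_add h1 h2
      rw [cmean_const_mul] at h3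
      change _ = cCoeff u j + -1 * cCoeff _ j at h3
      rw [hv.cCoeff_eq] at h3
      simp only [cCoeff, sub_mul] at h3 ⊢
      simpa [sub_eq_add_neg] using h3
  refine ⟨hs, fun a => ?_⟩
  rw [sub_eq_zero.1 (h0 a)]
  exact hv.hasSum a

/-- The weight `(1 + j₁²)⁻¹ (1 + j₂²)⁻¹`. -/
def sqWeight (j : ℤ × ℤ) : ℝ := (1 + (j.1 : ℝ) ^ 2)⁻¹ * (1 + (j.2 : ℝ) ^ 2)⁻¹

lemma summable_sqWeight : Summable sqWeight := by
  have h : Summable fun n : ℤ => (1 + (n : ℝ) ^ 2)⁻¹ := by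
    have h2 : Summable fun n : ℤ => 1 / (n : ℝ) ^ 2 := Real.summable_one_div_int_pow.2 (by norm_num)
    refine Summable.of_norm_bounded_eventually h2 ?_
    rw [Filter.eventually_cofinite]
    refine (Set.finite_singleton (0 : ℤ)).subset fun n hn => ?_
    by_contra h0
    refine hn ?_
    have : (n : ℝ) ≠ 0 := by exact_mod_cast h0
    rw [Real.norm_of_nonneg (by positivity), one_div]
    gcongr
    linarith
  exact h.mul_of_nonneg h (fun _ => by positivity) fun _ => by positivity

/-- The supremum on `[0, 2π]²` of `u`, `∂₁²u`, `∂₂²u` and `∂₁²∂₂²u` is at most `M`. -/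
structure DerivBound (u : ℝ × ℝ → ℂ) (M : ℝ) : Prop where
  zero : ∀ a ∈ Icc 0 (2 * Real.pi) ×ˢ Icc 0 (2 * Real.pi), ‖u a‖ ≤ M
  fst : ∀ a ∈ Icc 0 (2 * Real.pi) ×ˢ Icc 0 (2 * Real.pi),
    ‖lineDeriv ℝ (fun b => lineDeriv ℝ u b (1, 0)) a (1, 0)‖ ≤ M
  snd : ∀ a ∈ Icc 0 (2 * Real.pi) ×ˢ Icc 0 (2 * Real.pi),
    ‖lineDeriv ℝ (fun b => lineDeriv ℝ u b (0, 1)) a (0, 1)‖ ≤ M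
  fst_snd : ∀ a ∈ Icc 0 (2 * Real.pi) ×ˢ Icc 0 (2 * Real.pi),
    ‖lineDeriv ℝ (fun c => lineDeriv ℝ (fun b => lineDeriv ℝ (fun b => lineDeriv ℝ u b (1, 0))
      b (1, 0)) c (0, 1)) a (0, 1)‖ ≤ M

lemma norm_cCoeff_le {u : ℝ × ℝ → ℂ} {M : ℝ}
    (h : ∀ a ∈ Icc 0 (2 * Real.pi) ×ˢ Icc 0 (2 * Real.pi), ‖u a‖ ≤ M) (j : ℤ × ℤ) :
    ‖cCoeff u j‖ ≤ M :=
  norm_cmean_le fun s hs r hr => by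
    rw [norm_mul, norm_torusChar, mul_one]; exact h (s, r) ⟨hs, hr⟩

/-- Expanding (1 + j₁²)(1 + j₂²)|û_j| gives four terms, the absolute values of the coefficients of
u, ∂₁²u, ∂₂²u and ∂₁²∂₂²u, each at most M; hence the factor 4. -/
lemma Smooth.norm_cCoeff_le {u : ℝ × ℝ → ℂ} (hu : Smooth u) {M : ℝ} (hM : DerivBound u M)
    (j : ℤ × ℤ) : ‖cCoeff u j‖ ≤ 4 * M * sqWeight j := by
  have h0 := TorusWave.norm_cCoeff_le hM.zero j
  have h1 := TorusWave.norm_cCoeff_le hM.fst j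
  have h2 := TorusWave.norm_cCoeff_le hM.snd j
  have h3 := TorusWave.norm_cCoeff_le hM.fst_snd j
  have d1 := hu.lineDeriv (1, 0)
  have d2 := hu.lineDeriv (0, 1)
  have d11 := d1.lineDeriv (1, 0)
  have d112 := d11.lineDeriv (0, 1)
  rw [cCoeff_lineDeriv d1, cCoeff_lineDeriv hu] at h1
  rw [cCoeff_lineDeriv d2, cCoeff_lineDeriv hu] at h2
  rw [cCoeff_lineDeriv d112, cCoeff_lineDeriv d11, cCoeff_lineDeriv d1, cCoeff_lineDeriv hu] at h3
  have f1 : freq (1, 0) j = j.1 := by simp [freq]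
  have f2 : freq (0, 1) j = j.2 := by simp [freq]
  simp only [f1, f2, norm_mul, Complex.norm_I, one_mul, Complex.norm_real, Real.norm_eq_abs]
    at h1 h2 h3
  have e1 : |(j.1 : ℝ)| * |(j.1 : ℝ)| = (j.1 : ℝ) ^ 2 := by rw [← sq, sq_abs]
  have e2 : |(j.2 : ℝ)| * |(j.2 : ℝ)| = (j.2 : ℝ) ^ 2 := by rw [← sq, sq_abs]
  rw [← mul_assoc, e1] at h1
  rw [← mul_assoc, e2] at h2
  rw [← mul_assoc, e2, ← mul_assoc (|(j.1 : ℝ)|), e1] at h3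
  rw [sqWeight, ← mul_inv, ← div_eq_mul_inv, le_div_iff₀ (by positivity)]
  linarith

lemma Smooth.hasW_of_derivBound {u : ℝ × ℝ → ℂ} (hu : Smooth u) {M : ℝ} (hM : DerivBound u M) :
    HasW u (cCoeff u) ∧ wNorm (cCoeff u) ≤ 4 * M * ∑' j, sqWeight j := by
  have hs := summable_sqWeight.mul_left (4 * M)
  have hs' : Summable fun j => ‖cCoeff u j‖ :=
    hs.of_nonneg_of_le (fun _ => norm_nonneg _) (hu.norm_cCoeff_le hM)
  exact ⟨hasW_of_summable_cCoeff hu.continuous hu.periodic hs',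
    (hs'.tsum_le_tsum (hu.norm_cCoeff_le hM) hs).trans_eq tsum_mul_left⟩

lemma Smooth.exists_derivBound {u : ℝ × ℝ → ℂ} (hu : Smooth u) : ∃ M, DerivBound u M := by
  have hK : IsCompact (Icc 0 (2 * Real.pi) ×ˢ Icc 0 (2 * Real.pi)) :=
    isCompact_Icc.prod isCompact_Icc
  have d1 := hu.lineDeriv (1, 0)
  have d2 := hu.lineDeriv (0, 1)
  have d11 := d1.lineDeriv (1, 0)
  have d112 := d11.lineDeriv (0, 1)
  obtain ⟨M0, h0⟩ := hK.exists_bound_of_continuousOn hu.continuous.continuousOn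
  obtain ⟨M1, h1⟩ := hK.exists_bound_of_continuousOn (d1.lineDeriv (1, 0)).continuous.continuousOn
  obtain ⟨M2, h2⟩ := hK.exists_bound_of_continuousOn (d2.lineDeriv (0, 1)).continuous.continuousOn
  obtain ⟨M3, h3⟩ :=
    hK.exists_bound_of_continuousOn (d112.lineDeriv (0, 1)).continuous.continuousOn
  exact ⟨max (max M0 M1) (max M2 M3),
    fun a ha => (h0 a ha).trans (by simp), fun a ha => (h1 a ha).trans (by simp),
    fun a ha => (h2 a ha).trans (by simp), fun a ha => (h3 a ha).trans (by simp)⟩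

lemma Smooth.hasW {u : ℝ × ℝ → ℂ} (hu : Smooth u) : HasW u (cCoeff u) := by
  obtain ⟨M, hM⟩ := hu.exists_derivBound
  exact (hu.hasW_of_derivBound hM).1

/-! ### Real analyticity of Fourier series with exponentially decaying coefficients -/

/-- The sup norm of a frequency. -/
def supNorm (j : ℤ × ℤ) : ℝ := max |(j.1 : ℝ)| |(j.2 : ℝ)|

lemma supNorm_nonneg (j : ℤ × ℤ) : 0 ≤ supNorm j := le_max_of_le_left (abs_nonneg _)

lemma summable_exp_neg_abs {σ : ℝ} (hσ : 0 < σ) : Summable fun n : ℤ => Real.exp (-σ * |(n : ℝ)|) := by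
  have h : Summable fun n : ℕ => Real.exp (n * (-σ)) :=
    Real.summable_exp_nat_mul_iff.2 (by linarith)
  refine Summable.of_nat_of_neg ?_ ?_ <;> simpa [mul_comm] using h

lemma summable_exp_neg_supNorm {σ : ℝ} (hσ : 0 < σ) :
    Summable fun j => Real.exp (-σ * supNorm j) := by
  have h := summable_exp_neg_abs (half_pos hσ)
  refine (h.mul_of_nonneg h (fun _ => (Real.exp_pos _).le)
    fun _ => (Real.exp_pos _).le).of_nonneg_of_le (fun _ => (Real.exp_pos _).le) fun j => ?_
  rw [← Real.exp_add, Real.exp_le_exp]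
  have h1 : |(j.1 : ℝ)| ≤ supNorm j := le_max_left _ _
  have h2 : |(j.2 : ℝ)| ≤ supNorm j := le_max_right _ _
  nlinarith

/-- The linear form `v ↦ i⟨j, v⟩`. -/
def freqForm (j : ℤ × ℤ) : ℝ × ℝ →L[ℝ] ℂ :=
  ((j.1 : ℝ) • ContinuousLinearMap.fst ℝ ℝ ℝ +
    (j.2 : ℝ) • ContinuousLinearMap.snd ℝ ℝ ℝ).smulRight I

lemma freqForm_apply (j : ℤ × ℤ) (v : ℝ × ℝ) : freqForm j v = freq v j * I := by
  simp [freqForm, freq]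

lemma norm_freqForm_le (j : ℤ × ℤ) : ‖freqForm j‖ ≤ 2 * supNorm j := by
  refine ContinuousLinearMap.opNorm_le_bound _ (by linarith [supNorm_nonneg j]) fun v => ?_
  rw [freqForm_apply, norm_mul, Complex.norm_I, mul_one, Complex.norm_real, Real.norm_eq_abs]
  have h1 : |(j.1 : ℝ)| ≤ supNorm j := le_max_left _ _
  have h2 : |(j.2 : ℝ)| ≤ supNorm j := le_max_right _ _
  have h3 : |v.1| ≤ ‖v‖ := norm_fst_le v
  have h4 : |v.2| ≤ ‖v‖ := norm_snd_le v
  calc |freq v j| ≤ |(j.1 : ℝ)| * |v.1| + |(j.2 : ℝ)| * |v.2| := by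
        rw [freq, ← abs_mul, ← abs_mul]; exact abs_add_le _ _
    _ ≤ supNorm j * ‖v‖ + supNorm j * ‖v‖ := by gcongr <;> exact supNorm_nonneg j
    _ = 2 * supNorm j * ‖v‖ := by ring

lemma torusChar_eq_exp_freqForm (j : ℤ × ℤ) (v : ℝ × ℝ) :
    torusChar j v = Complex.exp (freqForm j v) := by
  rw [freqForm_apply, torusChar_eq_exp_ofReal]; rfl

/-- The `n`-th Taylor form of the character `torusChar j` at `0`. -/
def charTaylor (n : ℕ) (j : ℤ × ℤ) : ContinuousMultilinearMap ℝ (fun _ : Fin n => ℝ × ℝ) ℂ :=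
  ((n.factorial : ℝ)⁻¹) • (ContinuousMultilinearMap.mkPiAlgebraFin ℝ n ℂ).compContinuousLinearMap
    fun _ => freqForm j

lemma charTaylor_apply (n : ℕ) (j : ℤ × ℤ) (v : ℝ × ℝ) :
    charTaylor n j (fun _ => v) = freqForm j v ^ n / n.factorial := by
  simp [charTaylor]; ring

lemma norm_charTaylor_le (n : ℕ) (j : ℤ × ℤ) :
    ‖charTaylor n j‖ ≤ (2 * supNorm j) ^ n / n.factorial := by
  rw [charTaylor, norm_smul, norm_inv, Real.norm_natCast, div_eq_inv_mul]
  gcongr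
  refine (ContinuousMultilinearMap.norm_compContinuousLinearMap_le _ _).trans ?_
  rw [ContinuousMultilinearMap.norm_mkPiAlgebraFin, one_mul, Finset.prod_const, Finset.card_univ,
    Fintype.card_fin]
  exact pow_le_pow_left₀ (norm_nonneg _) (norm_freqForm_le j) n

/-- Each character is the exponential of a linear form of norm at most 2|j|, so its Taylor forms are
bounded by (2|j|)ⁿ/n!. Exponential decay of the coefficients makes the sum over frequencies and
degrees absolutely convergent on a small ball, and the two summations can be exchanged. -/
lemma HasW.analyticOnNhd {u : ℝ × ℝ → ℂ} {c : ℤ × ℤ → ℂ} (hu : HasW u c) {C σ : ℝ} (hσ : 0 < σ)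
    (hc : ∀ j, ‖c j‖ ≤ C * Real.exp (-σ * supNorm j)) : AnalyticOnNhd ℝ u univ := by
  intro a _
  -- With this radius, exp(2|j|r) = exp(σ|j|/2) uses only half of the decay rate, and exp(-σ|j|/2)
  -- remains summable.
  set r : NNReal := ⟨σ / 4, by positivity⟩ with hr
  have hrσ : (r : ℝ) = σ / 4 := rfl
  have hB : Summable fun j => ‖c j‖ * Real.exp (2 * supNorm j * r) := by
    refine ((summable_exp_neg_supNorm (half_pos hσ)).mul_left C).of_nonneg_of_le
      (fun _ => by positivity) fun j => ?_
    refine (mul_le_mul_of_nonneg_right (hc j) (Real.exp_pos _).le).trans_eq ?_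
    rw [mul_assoc, ← Real.exp_add, hrσ]
    ring_nf
  have hle : ∀ (n : ℕ) (j : ℤ × ℤ), ‖(c j * torusChar j a) • charTaylor n j‖ * (r : ℝ) ^ n ≤
      ‖c j‖ * Real.exp (2 * supNorm j * r) := by
    intro n j
    rw [norm_smul, norm_mul_torusChar, mul_assoc]
    refine mul_le_mul_of_nonneg_left ?_ (norm_nonneg _)
    refine (mul_le_mul_of_nonneg_right (norm_charTaylor_le n j) (by positivity)).trans ?_
    rw [div_mul_eq_mul_div, ← mul_pow]
    exact Real.pow_div_factorial_le_exp _
      (mul_nonneg (mul_nonneg two_pos.le (supNorm_nonneg j)) r.2) n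
  have hr0 : (0 : ℝ) < r := by rw [hrσ]; positivity
  have hsn : ∀ n : ℕ, Summable fun j => ‖(c j * torusChar j a) • charTaylor n j‖ := by
    intro n
    refine (hB.mul_right ((r : ℝ) ^ n)⁻¹).of_nonneg_of_le (fun _ => norm_nonneg _) fun j => ?_
    rw [← div_eq_mul_inv, le_div_iff₀ (by positivity)]
    exact hle n j
  let p : FormalMultilinearSeries ℝ (ℝ × ℝ) ℂ :=
    fun n => ∑' j, (c j * torusChar j a) • charTaylor n j
  refine ⟨p, r, ?_, by exact_mod_cast hr0, fun {y} hy => ?_⟩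
  · refine p.le_radius_of_bound (∑' j, ‖c j‖ * Real.exp (2 * supNorm j * r)) fun n => ?_
    calc ‖p n‖ * (r : ℝ) ^ n
        ≤ (∑' j, ‖(c j * torusChar j a) • charTaylor n j‖) * (r : ℝ) ^ n := by
          gcongr; exact norm_tsum_le_tsum_norm (hsn n)
      _ = ∑' j, ‖(c j * torusChar j a) • charTaylor n j‖ * (r : ℝ) ^ n := tsum_mul_right.symm
      _ ≤ _ := ((hsn n).mul_right _).tsum_le_tsum (hle n) hB
  · have hy' : ‖y‖ < r := by simpa using hy
    have hterm : ∀ (n : ℕ) (j : ℤ × ℤ), ((c j * torusChar j a) • charTaylor n j) (fun _ => y) =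
        c j * torusChar j a * (freqForm j y ^ n / n.factorial) := by
      intro n j
      rw [_root_.smul_apply, charTaylor_apply, smul_eq_mul]
    have hexp : ∀ z : ℂ, HasSum (fun n : ℕ => z ^ n / n.factorial) (Complex.exp z) := fun z => by
      rw [Complex.exp_eq_exp_ℂ]; exact NormedSpace.expSeries_div_hasSum_exp z
    have hexpR : ∀ z : ℝ, HasSum (fun n : ℕ => z ^ n / n.factorial) (Real.exp z) := fun z => by
      rw [Real.exp_eq_exp_ℝ]; exact NormedSpace.expSeries_div_hasSum_exp z
    have hj : ∀ j : ℤ × ℤ, HasSum (fun n : ℕ => c j * torusChar j a *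
        (freqForm j y ^ n / n.factorial)) (c j * torusChar j (a + y)) := fun j => by
      rw [torusChar_add_right, ← mul_assoc, torusChar_eq_exp_freqForm j y]
      exact (hexp _).mul_left _
    have hnorm : ∀ j : ℤ × ℤ, HasSum (fun n : ℕ => ‖c j * torusChar j a *
        (freqForm j y ^ n / n.factorial)‖) (‖c j‖ * Real.exp ‖freqForm j y‖) := fun j => by
      have : ∀ n : ℕ, ‖c j * torusChar j a * (freqForm j y ^ n / n.factorial)‖ =
          ‖c j‖ * (‖freqForm j y‖ ^ n / n.factorial) := fun n => by
        rw [norm_mul, norm_mul_torusChar, norm_div, norm_pow, Complex.norm_natCast]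
      simp only [this]
      exact (hexpR _).mul_left _
    have hsum : Summable fun q : (ℤ × ℤ) × ℕ => c q.1 * torusChar q.1 a *
        (freqForm q.1 y ^ q.2 / q.2.factorial) := by
      refine Summable.of_norm ((summable_prod_of_nonneg fun _ => norm_nonneg _).2
        ⟨fun j => (hnorm j).summable, ?_⟩)
      simp only [fun j => (hnorm j).tsum_eq]
      refine hB.of_nonneg_of_le (fun _ => by positivity) fun j => ?_
      gcongr
      refine (ContinuousLinearMap.le_opNorm _ _).trans ?_
      exact mul_le_mul (norm_freqForm_le j) hy'.le (norm_nonneg _)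
        (mul_nonneg two_pos.le (supNorm_nonneg j))
    have hU : HasSum (fun q : (ℤ × ℤ) × ℕ => c q.1 * torusChar q.1 a *
        (freqForm q.1 y ^ q.2 / q.2.factorial)) (u (a + y)) := by
      have h1 := hsum.hasSum.prod_fiberwise hj
      exact h1.unique (hu.hasSum (a + y)) ▸ hsum.hasSum
    rw [← (Equiv.prodComm ℕ (ℤ × ℤ)).hasSum_iff] at hU
    refine hU.prod_fiberwise fun n => ?_
    have h2 := ContinuousMultilinearMap.hasSum_eval
      (Summable.of_norm (hsn n)).hasSum (fun _ => y)
    exact hasSum_of_eq h2 (hterm n)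

/-! ### The Hilbert transform -/

/-- The symbol of the Hilbert transform. -/
def hMult (k : ℝ) (j : ℤ × ℤ) : ℂ := -I * (Real.sign ((j.1 : ℝ) + k * (j.2 : ℝ)) : ℂ)

lemma norm_hMult_le (k : ℝ) (j : ℤ × ℤ) : ‖hMult k j‖ ≤ 1 := by
  rw [hMult, norm_mul, norm_neg, Complex.norm_I, one_mul, Complex.norm_real]
  rcases Real.sign_apply_eq ((j.1 : ℝ) + k * (j.2 : ℝ)) with h | h | h <;> simp [h]

lemma hMult_neg (k : ℝ) (j : ℤ × ℤ) : hMult k (-j) = conj (hMult k j) := by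
  have : (((-j).1 : ℤ) : ℝ) + k * (((-j).2 : ℤ) : ℝ) = -((j.1 : ℝ) + k * (j.2 : ℝ)) := by
    push_cast [Prod.fst_neg, Prod.snd_neg]; ring
  rw [hMult, this, Real.sign_neg, hMult]
  simp

lemma HasW.ext_of_coeff {u v : ℝ × ℝ → ℂ} {c : ℤ × ℤ → ℂ} (hu : HasW u c) (hv : HasW v c) :
    u = v := by rw [hu.eq_tsum, hv.eq_tsum]

lemma HasW.coeff_neg {u : ℝ × ℝ → ℝ} {c : ℤ × ℤ → ℂ} (hu : HasW (fun a => (u a : ℂ)) c)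
    (j : ℤ × ℤ) : c (-j) = conj (c j) := by
  have h := hu.conj
  simp only [Complex.conj_ofReal] at h
  have := congrFun (h.unique hu) (-j)
  rw [neg_neg] at this
  exact this.symm

/-- The symbol and the coefficients of a real function are both Hermitian, so the multiplier series
equals its own conjugate and the real part in `hilbert` discards nothing. -/
lemma HasW.hilbert {u : ℝ × ℝ → ℝ} {c : ℤ × ℤ → ℂ} (hu : HasW (fun a => (u a : ℂ)) c) (k : ℝ) :
    HasW (fun a => (hilbert k u a : ℂ)) (fun j => hMult k j * c j) := by
  have h := hu.multiplier (norm_hMult_le k)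
  have h2 := h.conj
  have e : (fun j => conj (hMult k (-j) * c (-j))) = fun j => hMult k j * c j := by
    funext j
    rw [hMult_neg, hu.coeff_neg, map_mul, Complex.conj_conj, Complex.conj_conj]
  rw [e] at h2
  have h3 := h2.ext_of_coeff h
  have h4 : (fun a => (TorusWave.hilbert k u a : ℂ)) =
      fun a => ∑' j, hMult k j * c j * torusChar j a := by
    funext a
    rw [← Complex.conj_eq_iff_re.1 (congrFun h3 a), TorusWave.hilbert, torusCoeff_eq, hu.cCoeff_eq]
    rfl
  rw [h4]; exact h

lemma HasW.hilbert_sub {u v : ℝ × ℝ → ℝ} {c d : ℤ × ℤ → ℂ} (hu : HasW (fun a => (u a : ℂ)) c)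
    (hv : HasW (fun a => (v a : ℂ)) d) (k : ℝ) (a : ℝ × ℝ) :
    TorusWave.hilbert k (fun b => u b - v b) a =
      TorusWave.hilbert k u a - TorusWave.hilbert k v a := by
  have h : HasW (fun a => ((u a - v a : ℝ) : ℂ)) (fun j => c j - d j) := by
    simpa only [Complex.ofReal_sub] using hu.sub hv
  have h1 := (hu.hilbert k).sub (hv.hilbert k)
  simp only [← mul_sub] at h1
  have := congrFun ((h.hilbert k).ext_of_coeff h1) a
  exact_mod_cast this

lemma HasW.hilbert_const_mul {u : ℝ × ℝ → ℝ} {c : ℤ × ℤ → ℂ} (hu : HasW (fun a => (u a : ℂ)) c)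
    (k z : ℝ) (a : ℝ × ℝ) :
    TorusWave.hilbert k (fun b => z * u b) a = z * TorusWave.hilbert k u a := by
  have h : HasW (fun a => ((z * u a : ℝ) : ℂ)) (fun j => z * c j) := by
    simpa only [Complex.ofReal_mul] using hu.const_mul z
  have h1 := (hu.hilbert k).const_mul z
  simp only [← mul_assoc, mul_comm (z : ℂ) (hMult k _)] at h1
  have h2 := h.hilbert k
  simp only [← mul_assoc] at h2
  have := congrFun (h2.ext_of_coeff h1) a
  exact_mod_cast this

lemma HasW.hilbert_translate {u : ℝ × ℝ → ℝ} {c : ℤ × ℤ → ℂ} (hu : HasW (fun a => (u a : ℂ)) c)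
    (k : ℝ) (b a : ℝ × ℝ) :
    TorusWave.hilbert k (fun a => u (a + b)) a = TorusWave.hilbert k u (a + b) := by
  have h1 := (hu.translate b).hilbert k
  simp only [← mul_assoc] at h1
  exact_mod_cast congrFun (h1.ext_of_coeff ((hu.hilbert k).translate b)) a

/-- Irrationality of k enters here: zero is the only frequency at which the symbol of `H` vanishes,
so that H² = -P. -/
lemma freq_ne_zero {k : ℝ} (hk : Irrational k) {j : ℤ × ℤ} (hj : j ≠ 0) :
    (j.1 : ℝ) + k * (j.2 : ℝ) ≠ 0 := by
  intro h
  by_cases h2 : j.2 = 0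
  · simp only [h2, Int.cast_zero, mul_zero, add_zero, Int.cast_eq_zero] at h
    exact hj (Prod.ext h h2)
  · refine (hk.mul_intCast h2).ne_int (-j.1) ?_
    push_cast; linarith

lemma hMult_mul_self {k : ℝ} (hk : Irrational k) {j : ℤ × ℤ} (hj : j ≠ 0) :
    hMult k j * hMult k j = -1 := by
  rcases Real.sign_apply_eq_of_ne_zero _ (freq_ne_zero hk hj) with h | h <;> simp [hMult, h]

/-- On functions with absolutely convergent series, `H² = -P`. -/
lemma HasW.hilbert_hilbert {u : ℝ × ℝ → ℝ} {c : ℤ × ℤ → ℂ} (hu : HasW (fun a => (u a : ℂ)) c)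
    {k : ℝ} (hk : Irrational k) (h0 : c 0 = 0) (a : ℝ × ℝ) :
    TorusWave.hilbert k (TorusWave.hilbert k u) a = -u a := by
  have h1 := (hu.hilbert k).hilbert k
  have h2 := hu.const_mul (-1)
  have e : (fun j => hMult k j * (hMult k j * c j)) = fun j => -1 * c j := by
    funext j
    by_cases hj : j = 0
    · simp [hj, h0]
    · rw [← mul_assoc, hMult_mul_self hk hj]
  rw [e] at h1
  have := congrFun (h1.ext_of_coeff h2) a
  rw [neg_one_mul] at this
  exact_mod_cast this

lemma HasW.torusMean_eq {u : ℝ × ℝ → ℝ} {c : ℤ × ℤ → ℂ} (hu : HasW (fun a => (u a : ℂ)) c) :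
    (torusMean u : ℂ) = c 0 := by rw [← cmean_ofReal, hu.cmean_eq]

/-- Termwise differentiation of an absolutely convergent series. -/
lemma HasW.hasLineDerivAt {u u' : ℝ × ℝ → ℂ} {c : ℤ × ℤ → ℂ} {v : ℝ × ℝ} (hu : HasW u c)
    (hu' : HasW u' fun j => I * freq v j * c j) (a : ℝ × ℝ) : HasLineDerivAt ℝ u (u' a) a v := by
  have h1 : ∀ (j : ℤ × ℤ) (t : ℝ), HasDerivAt (fun t : ℝ => c j * torusChar j (a + t • v))
      (I * freq v j * c j * torusChar j (a + t • v)) t := by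
    intro j t
    have h2 := hasLineDerivAt_torusChar j (a + t • v) v
    have h3 : HasDerivAt (fun s : ℝ => s - t) 1 t := (hasDerivAt_id t).sub_const t
    have h4 := (HasDerivAt.scomp (g₁ := fun s : ℝ => torusChar j (a + t • v + s • v)) t
      (by rw [sub_self]; exact h2) h3).const_mul (c j)
    have e : ∀ s : ℝ, a + t • v + (s - t) • v = a + s • v := fun s => by
      rw [sub_smul]; abel
    simp only [Function.comp_def, e, one_smul] at h4
    exact h4.congr_deriv (by ring)
  have h5 := hasDerivAt_tsum hu'.summable h1 (fun j t => (norm_mul_torusChar _ _ _).le) (y₀ := 0)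
    (by simpa only [zero_smul, add_zero] using (hu.hasSum a).summable) 0
  rw [hu.eq_tsum, hu'.eq_tsum]
  simpa only [HasLineDerivAt, zero_smul, add_zero] using h5

lemma HasLineDerivAt.re_ofReal {u : ℝ × ℝ → ℝ} {u' : ℝ} {a v : ℝ × ℝ}
    (h : HasLineDerivAt ℝ (fun a => (u a : ℂ)) (u' : ℂ) a v) : HasLineDerivAt ℝ u u' a v := by
  have := Complex.reCLM.hasFDerivAt.comp_hasDerivAt (0 : ℝ) h
  simpa [HasLineDerivAt, Function.comp_def] using this

lemma Smooth.dAlpha {u : ℝ × ℝ → ℝ} (hu : Smooth u) (k : ℝ) : Smooth (dAlpha k u) :=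
  hu.lineDeriv (1, k)

lemma Smooth.lineDeriv_ofReal {u : ℝ × ℝ → ℝ} (hu : Smooth u) (a v : ℝ × ℝ) :
    _root_.lineDeriv ℝ (fun a => (u a : ℂ)) a v = (_root_.lineDeriv ℝ u a v : ℝ) := by
  have h := hu.hasLineDerivAt a v
  have : HasLineDerivAt ℝ (fun a => (u a : ℂ)) ((_root_.lineDeriv ℝ u a v : ℝ) : ℂ) a v :=
    HasDerivAt.ofReal_comp h
  exact this.lineDeriv

lemma Smooth.hasW_dAlpha {u : ℝ × ℝ → ℝ} (hu : Smooth u) (k : ℝ) :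
    HasW (fun a => (TorusWave.dAlpha k u a : ℂ)) (fun j => I * freq (1, k) j * torusCoeff u j) := by
  have h := (hu.dAlpha k).ofReal.hasW
  have e : (fun a => (TorusWave.dAlpha k u a : ℂ)) =
      fun a => _root_.lineDeriv ℝ (fun a => (u a : ℂ)) a (1, k) :=
    funext fun a => (hu.lineDeriv_ofReal a (1, k)).symm
  rw [e] at h ⊢
  convert h using 2 with j
  rw [cCoeff_lineDeriv hu.ofReal, torusCoeff_eq]

lemma Smooth.hasW_ofReal {u : ℝ × ℝ → ℝ} (hu : Smooth u) :
    HasW (fun a => (u a : ℂ)) (torusCoeff u) := hu.ofReal.hasW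

/-- The series is differentiated termwise in the direction (1, k) only, so smoothness of `hilbert k
u` is not required. -/
lemma Smooth.hasLineDerivAt_hilbert {u : ℝ × ℝ → ℝ} (hu : Smooth u) (k : ℝ) (a : ℝ × ℝ) :
    HasLineDerivAt ℝ (hilbert k u) (hilbert k (TorusWave.dAlpha k u) a) a (1, k) := by
  have h1 := hu.hasW_ofReal.hilbert k
  have h2 := (hu.hasW_dAlpha k).hilbert k
  refine HasLineDerivAt.re_ofReal (h1.hasLineDerivAt (v := (1, k))
    (u' := fun a => (hilbert k (TorusWave.dAlpha k u) a : ℂ)) ?_ a)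
  convert h2 using 2 with j
  ring

lemma Smooth.dAlpha_hilbert {u : ℝ × ℝ → ℝ} (hu : Smooth u) (k : ℝ) :
    TorusWave.dAlpha k (hilbert k u) = hilbert k (TorusWave.dAlpha k u) :=
  funext fun a => (hu.hasLineDerivAt_hilbert k a).lineDeriv

/-! ### Periodicity and compactness -/

lemma TorusPeriodic.exists_mem_Ico {E : Type*} {u : ℝ × ℝ → E} (hu : TorusPeriodic u)
    (a : ℝ × ℝ) : ∃ b : ℝ × ℝ, b.1 ∈ Ico 0 (2 * Real.pi) ∧ b.2 ∈ Ico 0 (2 * Real.pi) ∧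
      u a = u b := by
  have hp : (0 : ℝ) < 2 * Real.pi := by positivity
  have h1 : ∀ y, Function.Periodic (fun x => u (x, y)) (2 * Real.pi) := fun y x => (hu (x, y)).1
  have h2 : ∀ x, Function.Periodic (fun y => u (x, y)) (2 * Real.pi) := fun x y => (hu (x, y)).2
  obtain ⟨x, hx, hx'⟩ := (h1 a.2).exists_mem_Ico₀ hp a.1
  obtain ⟨y, hy, hy'⟩ := (h2 x).exists_mem_Ico₀ hp a.2
  exact ⟨(x, y), hx, hy, by rw [← hy', ← hx']⟩

lemma TorusPeriodic.exists_pos_le {u : ℝ × ℝ → ℝ} (hu : TorusPeriodic u) (hc : Continuous u)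
    (h0 : ∀ a, 0 < u a) : ∃ δ > 0, ∀ a, δ ≤ u a := by
  have hK : IsCompact (Icc 0 (2 * Real.pi) ×ˢ Icc 0 (2 * Real.pi)) :=
    isCompact_Icc.prod isCompact_Icc
  have hp : (0 : ℝ) ≤ 2 * Real.pi := by positivity
  obtain ⟨b, _, hb⟩ := hK.exists_isMinOn ⟨(0, 0), ⟨by simp [hp], by simp [hp]⟩⟩ hc.continuousOn
  refine ⟨u b, h0 b, fun a => ?_⟩
  obtain ⟨d, hd1, hd2, hd⟩ := hu.exists_mem_Ico a
  rw [hd]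
  exact hb ⟨Ico_subset_Icc_self hd1, Ico_subset_Icc_self hd2⟩

lemma HasW.congr {u v : ℝ × ℝ → ℂ} {c : ℤ × ℤ → ℂ} (hu : HasW u c) (h : ∀ a, v a = u a) :
    HasW v c := by rwa [show v = u from funext h]

/-! ### Reciprocals of functions with spectrum in a half plane -/

lemma torusMean_nonneg {u : ℝ × ℝ → ℝ} (hu : ∀ a, 0 ≤ u a) : 0 ≤ torusMean u := by
  have hp : (0 : ℝ) ≤ 2 * Real.pi := by positivity
  exact mul_nonneg (by positivity) (intervalIntegral.integral_nonneg hp fun s _ =>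
    intervalIntegral.integral_nonneg hp fun r _ => hu _)

lemma cmean_re {u : ℝ × ℝ → ℂ} (hu : Continuous u) :
    (cmean u).re = torusMean fun a => (u a).re := by
  have h1 : Continuous fun a => ((u a).re : ℂ) := by fun_prop
  have h2 : Continuous fun a => I * ((u a).im : ℂ) := by fun_prop
  have e : u = fun a => ((u a).re : ℂ) + I * ((u a).im : ℂ) := by
    funext a; rw [mul_comm]; exact (Complex.re_add_im (u a)).symm
  rw [e, cmean_add h1 h2, cmean_const_mul, cmean_ofReal, cmean_ofReal]
  simp

/-- Parseval: conjugation reverses the frequencies, which turns the convolution at 0 into the ℓ²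
pairing. -/
lemma HasW.wConv_eq_mean {u v : ℝ × ℝ → ℂ} {c d : ℤ × ℤ → ℂ} (hu : HasW u c) (hv : HasW v d) :
    cmean (fun a => u a * conj (v a)) = ∑' i, c i * conj (d i) := by
  rw [(hu.mul hv.conj).cmean_eq, wConv]
  simp

lemma wConv_eq_zero {c d : ℤ × ℤ → ℂ} {j : ℤ × ℤ} (h : ∀ i, c i = 0 ∨ d (j - i) = 0) :
    wConv c d j = 0 := by
  have : ∀ i, c i * d (j - i) = 0 := fun i => by rcases h i with h | h <;> simp [h]
  simp [wConv, this]

/-- If `f` has spectrum in `{j₁ + k j₂ ≤ 0}`, mean one, and a real part bounded below by a positive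
constant, then `1/f` has spectrum in the same half plane, and mean one. -/
lemma coeff_inv_of_lower {k : ℝ} (hk : Irrational k) {f w : ℝ × ℝ → ℂ} {c d : ℤ × ℤ → ℂ}
    (hf : HasW f c) (hw : HasW w d) (hc : ∀ j : ℤ × ℤ, 0 < (j.1 : ℝ) + k * j.2 → c j = 0)
    (hc0 : c 0 = 1) {δ : ℝ} (hδ : 0 < δ) (hre : ∀ a, δ ≤ (f a).re) (hfw : ∀ a, f a * w a = 1) :
    (∀ j : ℤ × ℤ, 0 < (j.1 : ℝ) + k * j.2 → d j = 0) ∧ d 0 = 1 := by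
  have hadd : ∀ i j : ℤ × ℤ, ((j.1 : ℝ) + k * j.2) =
      ((i.1 : ℝ) + k * i.2) + (((j - i).1 : ℝ) + k * (j - i).2) := fun i j => by
    push_cast [Prod.fst_sub, Prod.snd_sub]; ring
  classical
  set mp : ℤ × ℤ → ℂ := fun j => if 0 < (j.1 : ℝ) + k * j.2 then 1 else 0 with hmp
  set mm : ℤ × ℤ → ℂ := fun j => if 0 < (j.1 : ℝ) + k * j.2 then 0 else 1 with hmm
  have hp := hw.multiplier (m := mp) fun j => by simp only [hmp]; split_ifs <;> simp
  have hm := hw.multiplier (m := mm) fun j => by simp only [hmm]; split_ifs <;> simp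
  set wp := fun a => ∑' j, mp j * d j * torusChar j a
  set wm := fun a => ∑' j, mm j * d j * torusChar j a
  -- `wp` carries the strictly positive frequencies of w and `wm` the remaining ones; the aim is
  -- `wp` = 0.
  have hsplit : w = fun a => wp a + wm a := by
    refine hw.ext_of_coeff ?_
    convert hp.add hm using 2 with j
    simp only [hmp, hmm]; split_ifs <;> simp
  have hone := hf.mul hw
  simp only [hfw] at hone
  have hone' := hone.unique hasW_one
  have hdec : ∀ j, wConv c d j = wConv c (fun j => mp j * d j) j +
      wConv c (fun j => mm j * d j) j := by
    have h1 := (hf.mul hp).add (hf.mul hm)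
    have h2 : (fun a => f a * wp a + f a * wm a) = fun _ => 1 := by
      funext a; rw [← mul_add, ← hfw a, hsplit]
    rw [h2] at h1
    exact fun j => congrFun (hone.unique h1) j
  -- The product f·wm has no positive frequency, and f·wp + f·wm = 1 has none either; so f·wp has
  -- none.
  have hz : ∀ j : ℤ × ℤ, 0 < (j.1 : ℝ) + k * j.2 → wConv c (fun j => mp j * d j) j = 0 := by
    intro j hj
    have h1 : wConv c (fun j => mm j * d j) j = 0 := by
      refine wConv_eq_zero fun i => ?_
      by_cases hi : 0 < (i.1 : ℝ) + k * i.2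
      · exact Or.inl (hc i hi)
      · right
        have := hadd i j
        have : 0 < ((j - i).1 : ℝ) + k * (j - i).2 := by linarith
        simp only [hmm, if_pos this, zero_mul]
    have h2 := hdec j
    have hj0 : j ≠ 0 := by rintro rfl; simp at hj
    rw [h1, add_zero, hone', Pi.single_eq_of_ne hj0] at h2
    exact h2.symm
  -- Here f·wp and wp have disjoint spectra, hence they are orthogonal.
  have hmean : cmean (fun a => f a * wp a * conj (wp a)) = 0 := by
    rw [(hf.mul hp).wConv_eq_mean hp]
    refine (tsum_congr fun i => ?_).trans tsum_zero
    by_cases hi : 0 < (i.1 : ℝ) + k * i.2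
    · rw [hz i hi, zero_mul]
    · simp only [hmp, if_neg hi, zero_mul, map_zero, mul_zero]
  -- The real part of the mean of f|wp|² is zero and bounds δ times the mean of |wp|² from above;
  -- Parseval then kills every positive coefficient.
  have hpos : ∀ j : ℤ × ℤ, 0 < (j.1 : ℝ) + k * j.2 → d j = 0 := by
    have h1 : cmean (fun a => f a * wp a * conj (wp a) + ((-δ : ℝ) : ℂ) * (wp a * conj (wp a))) =
        ((-δ : ℝ) : ℂ) * ∑' i, mp i * d i * conj (mp i * d i) := by
      rw [cmean_add ((hf.mul hp).mul hp.conj).continuous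
        ((hp.mul hp.conj).const_mul _).continuous, cmean_const_mul, hmean, zero_add,
        hp.wConv_eq_mean hp]
    have h2 := congrArg Complex.re h1
    rw [cmean_re (((hf.mul hp).mul hp.conj).add ((hp.mul hp.conj).const_mul _)).continuous] at h2
    have h3 : ∀ z : ℂ, z * conj z = ((‖z‖ ^ 2 : ℝ) : ℂ) := fun z => by
      rw [Complex.mul_conj, Complex.normSq_eq_norm_sq]
    have h4 : 0 ≤ torusMean fun a =>
        (f a * wp a * conj (wp a) + ((-δ : ℝ) : ℂ) * (wp a * conj (wp a))).re := by
      refine torusMean_nonneg fun a => ?_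
      rw [mul_assoc, h3, ← add_mul, Complex.re_mul_ofReal, Complex.add_re]
      refine mul_nonneg ?_ (by positivity)
      rw [Complex.ofReal_re]
      linarith [hre a]
    simp only [h3] at h2
    rw [← Complex.ofReal_tsum, ← Complex.ofReal_mul, Complex.ofReal_re] at h2
    have hsum : Summable fun i => ‖mp i * d i‖ ^ 2 := by
      refine (hp.summable.mul_left (wNorm fun j => mp j * d j)).of_nonneg_of_le
        (fun _ => by positivity) fun i => ?_
      rw [sq]
      exact mul_le_mul_of_nonneg_right (hp.norm_coeff_le i) (norm_nonneg _)
    intro j hj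
    have h5 := hsum.le_tsum j fun _ _ => by positivity
    have h6 : ‖mp j * d j‖ ^ 2 ≤ 0 := by
      simp only [h3] at h4
      rw [h2] at h4
      nlinarith
    have h7 : mp j * d j = 0 := by
      rw [← norm_eq_zero]
      exact pow_eq_zero_iff two_ne_zero |>.1 (le_antisymm h6 (by positivity))
    simpa only [hmp, if_pos hj, one_mul] using h7
  -- In the zeroth coefficient of f·w = 1, a term i ≠ 0 has either i or -i of positive frequency, so
  -- only c₀d₀ survives.
  refine ⟨hpos, ?_⟩
  have h1 := congrFun hone' 0
  rw [Pi.single_eq_same, wConv, tsum_eq_single 0, hc0, one_mul, sub_self] at h1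
  · exact h1
  · intro i hi
    rcases lt_or_gt_of_ne (freq_ne_zero hk hi) with h | h
    · rw [hpos (0 - i) (by push_cast [zero_sub, Prod.fst_neg, Prod.snd_neg]; linarith), mul_zero]
    · rw [hc i h, zero_mul]

/-- The Hilbert transform relates the real and imaginary parts of a function with spectrum in
`{j₁ + k j₂ ≤ 0}`. -/
lemma hilbert_im_of_lower {k : ℝ} (hk : Irrational k) {p q : ℝ × ℝ → ℝ} {cp cq : ℤ × ℤ → ℂ}
    (hp : HasW (fun a => (p a : ℂ)) cp) (hq : HasW (fun a => (q a : ℂ)) cq)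
    (hd : ∀ j : ℤ × ℤ, 0 < (j.1 : ℝ) + k * j.2 → cp j + I * cq j = 0)
    (hd0 : cp 0 + I * cq 0 = 1) (a : ℝ × ℝ) : hilbert k q a = p a - 1 := by
  have hp0 : conj (cp 0) = cp 0 := by rw [← hp.coeff_neg, neg_zero]
  have hq0 : conj (cq 0) = cq 0 := by rw [← hq.coeff_neg, neg_zero]
  have h1 : HasW (fun a => ((p a - 1 : ℝ) : ℂ)) (fun j => cp j - (Pi.single 0 1 : ℤ × ℤ → ℂ) j) := by
    simpa using hp.sub hasW_one
  have h2 := hq.hilbert k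
  have e : (fun j => cp j - (Pi.single 0 1 : ℤ × ℤ → ℂ) j) = fun j => hMult k j * cq j := by
    funext j
    by_cases hj : j = 0
    · subst hj
      have h3 := congrArg conj hd0
      rw [map_add, map_mul, hp0, hq0, Complex.conj_I, map_one] at h3
      have h4 : cp 0 = 1 := by linear_combination (hd0 + h3) / 2
      simp [hMult, h4]
    · rw [Pi.single_eq_of_ne hj, sub_zero]
      -- For positive frequency the hypothesis reads p̂ = -i q̂, which is the symbol of `H`.
      -- Negative frequencies follow by conjugation, since p and q are real.
      rcases lt_or_gt_of_ne (freq_ne_zero hk hj) with h | h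
      · have h3 := hd (-j) (by push_cast [Prod.fst_neg, Prod.snd_neg]; linarith)
        have h4 := congrArg conj h3
        rw [hp.coeff_neg, hq.coeff_neg] at h4
        simp only [map_add, map_mul, Complex.conj_conj, Complex.conj_I, map_zero] at h4
        rw [hMult, Real.sign_of_neg h]
        push_cast
        linear_combination h4
      · have h3 := hd j h
        rw [hMult, Real.sign_of_pos h]
        push_cast
        linear_combination h3
  rw [e] at h1
  exact_mod_cast (congrFun (h2.ext_of_coeff h1) a)

/-! ### Conformal profiles -/

/-- A smooth profile whose Hilbert transform is smooth, and with `ξ_α > 0`. -/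
structure GraphProfile (k : ℝ) (η : ℝ × ℝ → ℝ) : Prop where
  irrational : Irrational k
  smooth : Smooth η
  smooth_hilbert : Smooth (hilbert k η)
  xiAlpha_pos : ∀ a, 0 < xiAlpha k η a

namespace GraphProfile

variable {k : ℝ} {η : ℝ × ℝ → ℝ}

lemma xiAlpha_eq (h : GraphProfile k η) (a : ℝ × ℝ) :
    xiAlpha k η a = 1 + dAlpha k (hilbert k η) a := by
  rw [xiAlpha, h.smooth.dAlpha_hilbert]

lemma smooth_xiAlpha (h : GraphProfile k η) : Smooth (xiAlpha k η) := by
  rw [funext h.xiAlpha_eq]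
  exact (smooth_const 1).add (h.smooth_hilbert.dAlpha k)

lemma jac_pos (h : GraphProfile k η) (a : ℝ × ℝ) : 0 < jac k η a :=
  add_pos_of_pos_of_nonneg (pow_pos (h.xiAlpha_pos a) 2) (sq_nonneg _)

lemma smooth_jac (h : GraphProfile k η) : Smooth (jac k η) := by
  have h1 := h.smooth_xiAlpha
  have h2 := h.smooth.dAlpha k
  have e : jac k η = fun a => xiAlpha k η a * xiAlpha k η a + dAlpha k η a * dAlpha k η a := by
    funext a; simp only [jac, sq]
  rw [e]
  exact (h1.mul h1).add (h2.mul h2)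

lemma smooth_inv_jac (h : GraphProfile k η) : Smooth fun a => (jac k η a)⁻¹ :=
  h.smooth_jac.inv fun a => (h.jac_pos a).ne'

lemma hasW_xiAlpha (h : GraphProfile k η) : HasW (fun a => (xiAlpha k η a : ℂ)) (fun j =>
    (Pi.single 0 1 : ℤ × ℤ → ℂ) j + hMult k j * (I * freq (1, k) j * torusCoeff η j)) := by
  simpa [xiAlpha] using hasW_one.add ((h.smooth.hasW_dAlpha k).hilbert k)

lemma torusMean_xiAlpha (h : GraphProfile k η) : torusMean (xiAlpha k η) = 1 := by
  have := h.hasW_xiAlpha.torusMean_eq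
  simp only [Pi.single_eq_same, hMult, Prod.fst_zero, Prod.snd_zero] at this
  simp only [Int.cast_zero, mul_zero, add_zero, Real.sign_zero, Complex.ofReal_zero, zero_mul]
    at this
  exact_mod_cast this

/-- The Hilbert transform of `η_α / J`. -/
lemma hilbert_dAlpha_div_jac (h : GraphProfile k η) (a : ℝ × ℝ) :
    hilbert k (fun b => dAlpha k η b / jac k η b) a = 1 - xiAlpha k η a / jac k η a := by
  have hη := h.smooth.hasW_dAlpha k
  have hξ := h.hasW_xiAlpha
  -- This is f = ξ_α + iη_α: for positive frequency the symbol -i of `H` cancels the factor i.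
  have hf := hξ.add (hη.const_mul I)
  have sp := h.smooth_xiAlpha.mul h.smooth_inv_jac
  have sq := (h.smooth.dAlpha k).mul h.smooth_inv_jac
  have hp := sp.hasW_ofReal
  have hq := sq.hasW_ofReal.const_mul (-1)
  -- This is (ξ_α - iη_α)/J, the reciprocal of f.
  have hw := hp.add (hq.const_mul I)
  obtain ⟨δ, hδ, hle⟩ := h.smooth_xiAlpha.periodic.exists_pos_le h.smooth_xiAlpha.continuous
    h.xiAlpha_pos
  have hprod : ∀ a, ((xiAlpha k η a : ℂ) + I * (dAlpha k η a : ℂ)) *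
      (((xiAlpha k η a * (jac k η a)⁻¹ : ℝ) : ℂ) +
        I * (-1 * ((dAlpha k η a * (jac k η a)⁻¹ : ℝ) : ℂ))) = 1 := by
    intro a
    have h1 : (jac k η a : ℂ) ≠ 0 := by exact_mod_cast (h.jac_pos a).ne'
    have h2 : (jac k η a : ℂ) = (xiAlpha k η a : ℂ) ^ 2 + (dAlpha k η a : ℂ) ^ 2 := by
      simp [jac]
    push_cast
    field_simp
    rw [h2]
    linear_combination (-(dAlpha k η a : ℂ) ^ 2) * Complex.I_sq
  have key := coeff_inv_of_lower h.irrational hf hw (fun j hj => by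
    have hj0 : j ≠ 0 := by rintro rfl; simp at hj
    rw [Pi.single_eq_of_ne hj0, hMult, Real.sign_of_pos hj]
    push_cast; ring) (by simp [hMult, freq]) hδ (fun a => by simpa using hle a) hprod
  have hq' := hq.congr (v := fun a => ((-(dAlpha k η a * (jac k η a)⁻¹) : ℝ) : ℂ))
    fun a => by push_cast; ring
  have h3 := hilbert_im_of_lower h.irrational hp hq' key.1 key.2 a
  have h4 := sq.hasW_ofReal.hilbert_const_mul k (-1) a
  simp only [neg_one_mul] at h4
  simp only [div_eq_mul_inv]
  linarith

lemma smooth_phi (h : GraphProfile k η) (c : ℝ) : Smooth fun a => c * hilbert k η a :=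
  (smooth_const c).mul h.smooth_hilbert

lemma dAlpha_phi (h : GraphProfile k η) (c : ℝ) (a : ℝ × ℝ) :
    dAlpha k (fun b => c * hilbert k η b) a = c * (xiAlpha k η a - 1) := by
  have h1 := h.smooth_hilbert.hasLineDerivAt a (1, k)
  have h2 : HasLineDerivAt ℝ (fun b => c * hilbert k η b) _ a (1, k) := HasDerivAt.const_mul c h1
  rw [dAlpha, h2.lineDeriv, h.xiAlpha_eq, dAlpha]; ring

/-- From φ_α = c H[η_α] one gets ψ_α = -c H²[η_α], and η_α has mean zero. -/
lemma dAlpha_stream (h : GraphProfile k η) (c : ℝ) (a : ℝ × ℝ) :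
    dAlpha k (stream k fun b => c * hilbert k η b) a = c * dAlpha k η a := by
  have h1 := (h.smooth_phi c).hasLineDerivAt_hilbert k a
  have h2 : HasLineDerivAt ℝ (stream k fun b => c * hilbert k η b) _ a (1, k) := HasDerivAt.neg h1
  have e : dAlpha k (fun b => c * hilbert k η b) =
      fun a => c * hilbert k (dAlpha k η) a := by
    funext a; rw [h.dAlpha_phi, xiAlpha]; ring
  rw [dAlpha, h2.lineDeriv, e, ((h.smooth.hasW_dAlpha k).hilbert k).hilbert_const_mul,
    (h.smooth.hasW_dAlpha k).hilbert_hilbert h.irrational (by simp [freq])]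
  ring

lemma chi_eq (h : GraphProfile k η) (c : ℝ) (a : ℝ × ℝ) :
    chi k η (fun b => c * hilbert k η b) a = c * (dAlpha k η a / jac k η a) := by
  rw [chi, h.dAlpha_stream, mul_div_assoc]

lemma hilbert_chi (h : GraphProfile k η) (c : ℝ) (a : ℝ × ℝ) :
    hilbert k (chi k η fun b => c * hilbert k η b) a = c * (1 - xiAlpha k η a / jac k η a) := by
  have s : Smooth fun a => dAlpha k η a / jac k η a := by
    simpa only [div_eq_mul_inv] using (h.smooth.dAlpha k).mul h.smooth_inv_jac
  rw [funext (h.chi_eq c), s.hasW_ofReal.hilbert_const_mul, h.hilbert_dAlpha_div_jac]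

/-- Once χ and H[χ] are explicit, the nonlinear terms cancel and only transport along (1, k)
remains. -/
lemma etaRHS_eq (h : GraphProfile k η) (c C : ℝ) (a : ℝ × ℝ) :
    etaRHS k C η (fun b => c * hilbert k η b) a = (C - c) * dAlpha k η a := by
  have := (h.jac_pos a).ne'
  rw [etaRHS, h.hilbert_chi, h.chi_eq]
  field_simp
  ring

/-- The two contributions divided by J combine through ξ_α² + η_α² = J into c/ξ_α. -/
lemma pinnedC₁_eq (h : GraphProfile k η) (c : ℝ) :
    pinnedC₁ k η (fun b => c * hilbert k η b) = c - c / xiAlpha k η (0, 0) := by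
  have h1 := (h.jac_pos (0, 0)).ne'
  have h2 := (h.xiAlpha_pos (0, 0)).ne'
  have h3 : jac k η (0, 0) = xiAlpha k η (0, 0) ^ 2 + dAlpha k η (0, 0) ^ 2 := rfl
  rw [pinnedC₁, h.hilbert_chi, h.dAlpha_stream]
  field_simp
  rw [h3]; ring

lemma torusMean_affine (h : GraphProfile k η) (A B : ℝ) :
    torusMean (fun a => A + B * xiAlpha k η a) = A + B := by
  have h1 := h.hasW_xiAlpha
  have h2 := (hasW_one.const_mul A).add (h1.const_mul B)
  have h3 := h2.congr (v := fun a => ((A + B * xiAlpha k η a : ℝ) : ℂ)) fun a => by push_cast; ring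
  have h4 := h3.torusMean_eq
  have h5 := h1.torusMean_eq
  rw [h.torusMean_xiAlpha] at h5
  rw [← h5] at h4
  simp only [Pi.single_eq_same, mul_one, Complex.ofReal_one] at h4
  exact_mod_cast h4

/-- The integrand reduces to an affine function of ξ_α, whose mean is known because ξ_α has mean
one. -/
lemma xZeroRHS_eq (h : GraphProfile k η) (c C : ℝ) :
    xZeroRHS k C η (fun b => c * hilbert k η b) = C := by
  have e : (fun a => xiAlpha k η a * (-hilbert k (chi k η fun b => c * hilbert k η b) a + C) -
      dAlpha k η a * (-chi k η (fun b => c * hilbert k η b) a)) =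
      fun a => c + (C - c) * xiAlpha k η a := by
    funext a
    have h1 := (h.jac_pos a).ne'
    have h3 : jac k η a = xiAlpha k η a ^ 2 + dAlpha k η a ^ 2 := rfl
    rw [h.hilbert_chi, h.chi_eq]
    field_simp
    rw [h3]; ring
  rw [xZeroRHS, e, h.torusMean_affine]; ring

lemma phiRHS_eq (h : GraphProfile k η) {g τ c : ℝ} (ht : IsTravelingProfile k g τ c η) (C : ℝ)
    (a : ℝ × ℝ) : phiRHS k g τ C η (fun b => c * hilbert k η b) a =
      (C - c) * (c * (xiAlpha k η a - 1)) := by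
  set m := torusMean (fun b => c ^ 2 / (2 * jac k η b) + g * η b - τ * curvature k η b) with hm
  have hT : ∀ b, c ^ 2 / (2 * jac k η b) + g * η b - τ * curvature k η b = m :=
    fun b => sub_eq_zero.1 (ht b)
  -- The traveling wave equation replaces τκ - gη by c²/(2J) - m. All terms with a denominator then
  -- add up to c²(ξ_α² + η_α²)/(2J) = c²/2, and the bracket is affine in ξ_α.
  have e : (fun a => (dAlpha k (stream k fun b => c * hilbert k η b) a ^ 2 -
        dAlpha k (fun b => c * hilbert k η b) a ^ 2) / (2 * jac k η a)
      - dAlpha k (fun b => c * hilbert k η b) a *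
        hilbert k (chi k η fun b => c * hilbert k η b) a
      + C * dAlpha k (fun b => c * hilbert k η b) a - g * η a + τ * curvature k η a) =
      fun a => (-m + 3 * c ^ 2 / 2 - C * c) + (C * c - c ^ 2) * xiAlpha k η a := by
    funext a
    have h1 := (h.jac_pos a).ne'
    have h3 : jac k η a = xiAlpha k η a ^ 2 + dAlpha k η a ^ 2 := rfl
    rw [h.hilbert_chi, h.dAlpha_phi, h.dAlpha_stream, ← hT a]
    field_simp
    rw [h3]; ring
  rw [phiRHS, e, zeroMeanPart, h.torusMean_affine]; ring

end GraphProfile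

/-! ### Translations -/

lemma dAlpha_translate (k : ℝ) (u : ℝ × ℝ → ℝ) (b a : ℝ × ℝ) :
    dAlpha k (fun a => u (a + b)) a = dAlpha k u (a + b) := by
  simp only [dAlpha, lineDeriv, add_right_comm a _ b]

lemma xiAlpha_translate {k : ℝ} {η : ℝ × ℝ → ℝ} (hη : Smooth η) (b a : ℝ × ℝ) :
    xiAlpha k (fun a => η (a + b)) a = xiAlpha k η (a + b) := by
  rw [xiAlpha, funext (dAlpha_translate k η b), (hη.hasW_dAlpha k).hilbert_translate, xiAlpha]

lemma jac_translate {k : ℝ} {η : ℝ × ℝ → ℝ} (hη : Smooth η) (b a : ℝ × ℝ) :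
    jac k (fun a => η (a + b)) a = jac k η (a + b) := by
  rw [jac, xiAlpha_translate hη, dAlpha_translate, jac]

lemma curvature_translate {k : ℝ} {η : ℝ × ℝ → ℝ} (hη : Smooth η) (b a : ℝ × ℝ) :
    curvature k (fun a => η (a + b)) a = curvature k η (a + b) := by
  rw [curvature, jac_translate hη, xiAlpha_translate hη, funext (xiAlpha_translate hη b),
    funext (dAlpha_translate k η b), dAlpha_translate, dAlpha_translate, curvature]

lemma GraphProfile.translate {k : ℝ} {η : ℝ × ℝ → ℝ} (h : GraphProfile k η) (b : ℝ × ℝ) :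
    GraphProfile k fun a => η (a + b) :=
  ⟨h.irrational, h.smooth.translate b, by
    rw [funext (h.smooth.hasW_ofReal.hilbert_translate k b)]
    exact h.smooth_hilbert.translate b, fun a => by
    rw [xiAlpha_translate h.smooth]; exact h.xiAlpha_pos _⟩

lemma torusMean_const (m : ℝ) : torusMean (fun _ => m) = m := by
  have := (hasW_one.const_mul m).cmean_eq
  simp only [mul_one, Pi.single_eq_same] at this
  rw [cmean_ofReal (fun _ => m)] at this
  exact_mod_cast this

lemma IsTravelingProfile.translate {k g τ c : ℝ} {η : ℝ × ℝ → ℝ} (hη : Smooth η)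
    (ht : IsTravelingProfile k g τ c η) (b : ℝ × ℝ) :
    IsTravelingProfile k g τ c fun a => η (a + b) := by
  set m := torusMean (fun b => c ^ 2 / (2 * jac k η b) + g * η b - τ * curvature k η b) with hm
  have hT : ∀ b, c ^ 2 / (2 * jac k η b) + g * η b - τ * curvature k η b = m :=
    fun b => sub_eq_zero.1 (ht b)
  intro a
  simp only [zeroMeanPart, jac_translate hη, curvature_translate hη, hT, torusMean_const, sub_self]

/-! ### The implicit equation -/

lemma lineDeriv_shift {S : ℝ × ℝ → ℝ} (hS : Smooth S) (k : ℝ) (x : ℝ × ℝ) (A : ℝ) :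
    HasDerivAt (fun A => S (x.1 + A, x.2 + k * A)) (dAlpha k S (x.1 + A, x.2 + k * A)) A := by
  have h1 := hS.hasLineDerivAt (x.1 + A, x.2 + k * A) (1, k)
  have h2 : HasDerivAt (fun B : ℝ => B - A) 1 A := (hasDerivAt_id A).sub_const A
  have h3 := HasDerivAt.scomp
    (g₁ := fun t : ℝ => S ((x.1 + A, x.2 + k * A) + t • ((1 : ℝ), k))) A
    (by rw [sub_self]; exact h1) h2
  have e : ∀ B : ℝ, (x.1 + A, x.2 + k * A) + (B - A) • ((1 : ℝ), k) =
      (x.1 + B, x.2 + k * B) := fun B => by ext <;> simp; ring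
  unfold dAlpha
  simpa only [Function.comp_def, e, one_smul] using h3

lemma strictMono_implicit {S : ℝ × ℝ → ℝ} (hS : Smooth S) {k : ℝ}
    (hpos : ∀ a, 0 < 1 + dAlpha k S a) (x : ℝ × ℝ) :
    StrictMono fun A : ℝ => A + S (x.1 + A, x.2 + k * A) := by
  refine strictMono_of_deriv_pos fun A => ?_
  have h : HasDerivAt (fun A : ℝ => A + S (x.1 + A, x.2 + k * A)) _ A :=
    (hasDerivAt_id A).add (lineDeriv_shift hS k x A)
  rw [h.deriv]
  exact hpos _

/-- S is bounded by its Wiener norm M, so the left-hand side is ≤ 0 at -M and ≥ 0 at M. -/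
lemma exists_implicit {S : ℝ × ℝ → ℝ} (hS : Smooth S) (k : ℝ) (x : ℝ × ℝ) :
    ∃ A : ℝ, A + S (x.1 + A, x.2 + k * A) = 0 := by
  set M := wNorm (torusCoeff S) with hM
  have hb : ∀ a, |S a| ≤ M := fun a => by
    have := hS.hasW_ofReal.norm_le a
    rwa [Complex.norm_real] at this
  have hc : Continuous fun A : ℝ => A + S (x.1 + A, x.2 + k * A) :=
    continuous_id.add (hS.continuous.comp (by fun_prop))
  have h1 := (abs_le.1 (hb (x.1 + -M, x.2 + k * -M))).2
  have h2 := (abs_le.1 (hb (x.1 + M, x.2 + k * M))).1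
  have := mem_range_of_exists_le_of_exists_ge hc (c := 0)
    ⟨-M, by linarith⟩ ⟨M, by linarith⟩
  exact this

/-- The linear equivalence `v ↦ v + ℓ(v) e`. -/
def rankOneEquiv {E : Type*} [NormedAddCommGroup E] [NormedSpace ℝ E] (ℓ : E →L[ℝ] ℝ) (e : E)
    (h : 1 + ℓ e ≠ 0) : E ≃L[ℝ] E :=
  ContinuousLinearEquiv.equivOfInverse (ContinuousLinearMap.id ℝ E + ℓ.smulRight e)
    (ContinuousLinearMap.id ℝ E - ((1 + ℓ e)⁻¹ • ℓ).smulRight e)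
    (fun v => by
      simp only [_root_.add_apply, _root_.sub_apply, ContinuousLinearMap.id_apply,
        ContinuousLinearMap.smulRight_apply, _root_.smul_apply, map_add, map_smul, smul_eq_mul]
      have h0 : ℓ v - (1 + ℓ e)⁻¹ * ℓ v - ℓ v * ((1 + ℓ e)⁻¹ * ℓ e) = 0 := by field_simp; ring
      calc _ = v + (ℓ v - (1 + ℓ e)⁻¹ * ℓ v - ℓ v * ((1 + ℓ e)⁻¹ * ℓ e)) • e := by module
        _ = v := by rw [h0, zero_smul, add_zero])
    (fun v => by
      simp only [_root_.add_apply, _root_.sub_apply, ContinuousLinearMap.id_apply,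
        ContinuousLinearMap.smulRight_apply, _root_.smul_apply, map_sub, map_smul, smul_eq_mul]
      have h0 : ℓ v - (1 + ℓ e)⁻¹ * (ℓ v + ℓ v * ℓ e) = 0 := by field_simp; ring
      calc _ = v + (ℓ v - (1 + ℓ e)⁻¹ * (ℓ v + ℓ v * ℓ e)) • e := by module
        _ = v := by rw [h0, zero_smul, add_zero])

/-- The implicit equation `A(x) + S(x + A(x)(1, k)) = 0`. -/
theorem exists_unique_implicit {S : ℝ × ℝ → ℝ} (hS : Smooth S) (hSa : AnalyticOnNhd ℝ S univ)
    {k : ℝ} (hpos : ∀ a, 0 < 1 + dAlpha k S a) :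
    ∃ A : ℝ × ℝ → ℝ, (∀ x : ℝ × ℝ, A x + S (x.1 + A x, x.2 + k * A x) = 0) ∧
      (∀ (x : ℝ × ℝ) (B : ℝ), B + S (x.1 + B, x.2 + k * B) = 0 → B = A x) ∧
      TorusPeriodic A ∧ AnalyticOnNhd ℝ A univ := by
  choose A hA using exists_implicit hS k
  have huniq : ∀ (x : ℝ × ℝ) (B : ℝ), B + S (x.1 + B, x.2 + k * B) = 0 → B = A x :=
    fun x B hB => (strictMono_implicit hS hpos x).injective (hB.trans (hA x).symm)
  refine ⟨A, hA, huniq, fun x => ⟨?_, ?_⟩, fun x₀ _ => ?_⟩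
  · refine huniq _ _ ?_
    have h1 := hA (x.1 + 2 * Real.pi, x.2)
    have h2 := (hS.periodic (x.1 + A (x.1 + 2 * Real.pi, x.2),
      x.2 + k * A (x.1 + 2 * Real.pi, x.2))).1
    rw [← h2]
    simpa only [add_right_comm] using h1
  · refine huniq _ _ ?_
    have h1 := hA (x.1, x.2 + 2 * Real.pi)
    have h2 := (hS.periodic (x.1 + A (x.1, x.2 + 2 * Real.pi),
      x.2 + k * A (x.1, x.2 + 2 * Real.pi))).2
    rw [← h2]
    simpa only [add_right_comm] using h1
  · set y₀ : ℝ × ℝ := (x₀.1 + A x₀, x₀.2 + k * A x₀) with hy₀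
    -- At y = x + A(x)(1, k) one has S(y) = -A(x), so Θ(y) = x. Thus a local inverse G of Θ yields A
    -- = -S ∘ G. The derivative of Θ is a rank-one perturbation of the identity, invertible because
    -- 1 + ∂_αS > 0.
    set Θ : ℝ × ℝ → ℝ × ℝ := fun y => y + S y • ((1 : ℝ), k) with hΘ
    have hSy : S y₀ = -A x₀ := by linarith [hA x₀]
    have hΘy : Θ y₀ = x₀ := by
      simp only [hΘ, hSy]; ext <;> simp [hy₀]; ring
    have hne : 1 + fderiv ℝ S y₀ (1, k) ≠ 0 := by
      have := hpos y₀
      rw [dAlpha, (hS.differentiable y₀).lineDeriv_eq_fderiv] at this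
      exact this.ne'
    have hder : HasFDerivAt Θ (rankOneEquiv (fderiv ℝ S y₀) (1, k) hne : ℝ × ℝ →L[ℝ] ℝ × ℝ) y₀ :=
      (hasFDerivAt_id y₀).add ((hS.differentiable y₀).hasFDerivAt.smul_const _)
    have hana : ContDiffAt ℝ ω Θ y₀ :=
      contDiffAt_id.add ((hSa y₀ (mem_univ _)).contDiffAt.smul contDiffAt_const)
    have hloc := hana.to_localInverse hder (by simp)
    set G := hana.localInverse hder (by simp) with hG
    have hGan : AnalyticAt ℝ G x₀ := by rw [← hΘy]; exact hloc.analyticAt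
    have hG0 : G x₀ = y₀ := by
      rw [← hΘy]; exact hana.localInverse_apply_image hder (by simp)
    have hright : ∀ᶠ x in 𝓝 x₀, Θ (G x) = x := by
      rw [← hΘy]
      exact (hana.hasStrictFDerivAt' hder (by simp)).eventually_right_inverse
    -- Pointwise uniqueness identifies the globally chosen A with the local analytic branch.
    have hAG : (fun x => -S (G x)) =ᶠ[𝓝 x₀] A := by
      filter_upwards [hright] with x hx
      refine huniq x _ ?_
      have e : (x.1 + -S (G x), x.2 + k * -S (G x)) = G x := by
        have h1 : (G x).1 + S (G x) = x.1 := by simpa [hΘ] using congrArg Prod.fst hx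
        have h2 : (G x).2 + S (G x) * k = x.2 := by simpa [hΘ] using congrArg Prod.snd hx
        refine Prod.ext ?_ ?_ <;> simp only <;> linarith
      rw [e]; ring
    have : AnalyticAt ℝ (fun x => -S (G x)) x₀ := by
      have h1 := (hSa (G x₀) (mem_univ _)).comp hGan
      exact h1.neg
    exact this.congr hAG

/-! ### The shifted traveling form -/

lemma smooth_of_analytic {u : ℝ × ℝ → ℝ} (hu : AnalyticOnNhd ℝ u univ) (hp : TorusPeriodic u) :
    Smooth u :=
  ⟨contDiff_iff_contDiffAt.2 fun a => (hu a (mem_univ a)).contDiffAt, hp⟩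

lemma analytic_of_ofReal {u : ℝ × ℝ → ℝ} (hu : AnalyticOnNhd ℝ (fun a => (u a : ℂ)) univ) :
    AnalyticOnNhd ℝ u univ := fun a ha => by
  have := (Complex.reCLM.analyticAt _).comp (hu a ha)
  simpa [Function.comp_def] using this

lemma torusPeriodic_of_ofReal {u : ℝ × ℝ → ℝ} (hu : TorusPeriodic fun a => (u a : ℂ)) :
    TorusPeriodic u := fun a => ⟨Complex.ofReal_injective (hu a).1, Complex.ofReal_injective (hu a).2⟩

/-- An even function has even coefficients, while the symbol of `H` is odd; at the origin all
characters equal 1, so the series changes sign under j ↦ -j. -/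
lemma hilbert_zero_of_even {k : ℝ} {u : ℝ × ℝ → ℝ} {c : ℤ × ℤ → ℂ}
    (hu : HasW (fun a => (u a : ℂ)) c) (heven : ∀ a, u (-a) = u a) : hilbert k u (0, 0) = 0 := by
  have hreal : ∀ j, c (-j) = c j := by
    have h1 := hu.conj
    have h2 : HasW (fun a => (u a : ℂ)) (fun j => c (-j)) := by
      refine ⟨hu.summable.comp_injective neg_injective, fun a => ?_⟩
      have := hu.hasSum (-a)
      rw [← (Equiv.neg (ℤ × ℤ)).hasSum_iff, heven] at this
      refine hasSum_of_eq this fun j => ?_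
      change c (-j) * torusChar (-j) (-a) = _
      congr 1
      simp [torusChar]
    exact fun j => congrFun (h2.unique hu) j
  have h1 := (hu.hilbert k).hasSum (0, 0)
  simp only [torusChar_apply_zero, mul_one] at h1
  have h2 := h1
  rw [← (Equiv.neg (ℤ × ℤ)).hasSum_iff] at h2
  have h3 := hasSum_of_eq h2 (g := fun j => -(hMult k j * c j)) fun j => by
    change hMult k (-j) * c (-j) = _
    rw [hreal, hMult_neg]
    simp [hMult]
  have h4 := h3.unique h1.neg
  have h5 : hilbert k u (0, 0) = -hilbert k u (0, 0) := by exact_mod_cast h4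
  linarith

/-- Modulo periods, the segments α ↦ (α, θ + kα) with α, θ in [0, 2π) cover the torus. This turns
the assumption ξ_{0,α} > 0 into positivity of ξ_α everywhere. -/
lemma exists_mem_Ico_line {u : ℝ × ℝ → ℝ} (hu : TorusPeriodic u) (k : ℝ) (a : ℝ × ℝ) :
    ∃ α ∈ Ico 0 (2 * Real.pi), ∃ θ ∈ Ico 0 (2 * Real.pi), u a = u (α, θ + k * α) := by
  have hp : (0 : ℝ) < 2 * Real.pi := by positivity
  have h1 : Function.Periodic (fun x => u (x, a.2)) (2 * Real.pi) := fun x => (hu (x, a.2)).1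
  obtain ⟨α, hα, hα'⟩ := h1.exists_mem_Ico₀ hp a.1
  have h2 : Function.Periodic (fun y => u (α, y + k * α)) (2 * Real.pi) := fun y => by
    simpa only [add_right_comm] using (hu (α, y + k * α)).2
  obtain ⟨θ, hθ, hθ'⟩ := h2.exists_mem_Ico₀ hp (a.2 - k * α)
  refine ⟨α, hα, θ, hθ, ?_⟩
  rw [← hθ', sub_add_cancel, ← hα']

/-- The standing facts on the initial profile. -/
lemma profile_of_series {k : ℝ} (hkirr : Irrational k) {η₀ : ℝ × ℝ → ℝ} {ηhat : ℤ × ℤ → ℂ}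
    {C σ : ℝ} (hσ : 0 < σ)
    (hseries : ∀ a : ℝ × ℝ, HasSum (fun j => ηhat j * torusChar j a) (η₀ a : ℂ))
    (hdecay : ∀ j : ℤ × ℤ, ‖ηhat j‖ ≤ C * Real.exp (-σ * supNorm j))
    (hpos : ∀ α ∈ Ico 0 (2 * Real.pi), ∀ θ ∈ Ico 0 (2 * Real.pi),
      0 < deriv (xiLine k η₀ θ) α) :
    HasW (fun a => (η₀ a : ℂ)) ηhat ∧ GraphProfile k η₀ ∧ AnalyticOnNhd ℝ η₀ univ ∧
      AnalyticOnNhd ℝ (hilbert k η₀) univ := by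
  have hW : HasW (fun a => (η₀ a : ℂ)) ηhat :=
    ⟨((summable_exp_neg_supNorm hσ).mul_left C).of_nonneg_of_le (fun _ => norm_nonneg _) hdecay,
      hseries⟩
  have hWH := hW.hilbert k
  have ha : AnalyticOnNhd ℝ η₀ univ := analytic_of_ofReal (hW.analyticOnNhd hσ hdecay)
  have hH : AnalyticOnNhd ℝ (hilbert k η₀) univ :=
    analytic_of_ofReal (hWH.analyticOnNhd hσ (C := C) fun j => by
      rw [norm_mul]
      exact (mul_le_of_le_one_left (norm_nonneg _) (norm_hMult_le k j)).trans (hdecay j))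
  have hs := smooth_of_analytic ha (torusPeriodic_of_ofReal hW.periodic)
  have hsH := smooth_of_analytic hH (torusPeriodic_of_ofReal hWH.periodic)
  refine ⟨hW, ⟨hkirr, hs, hsH, fun a => ?_⟩, ha, hH⟩
  rw [xiAlpha, ← hs.dAlpha_hilbert]
  obtain ⟨α, hα, θ, hθ, e⟩ := exists_mem_Ico_line (hsH.dAlpha k).periodic k a
  have h1 := lineDeriv_shift hsH k (0, θ) α
  simp only [zero_add] at h1
  have h2 : HasDerivAt (xiLine k η₀ θ) _ α := (hasDerivAt_id α).add h1
  have h3 := hpos α hα θ hθ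
  rw [h2.deriv] at h3
  rwa [e]

lemma shiftedZeta_im (k c : ℝ) (η₀ : ℝ × ℝ → ℝ) (α₀ : ℝ → ℝ) (t : ℝ) (a : ℝ × ℝ) :
    (shiftedZeta k c η₀ α₀ t a).im = η₀ (a + (-α₀ t, -(k * α₀ t))) := by
  simp [shiftedZeta, zetaZero, Prod.add_def, sub_eq_add_neg]

lemma shiftedZeta_re (k c : ℝ) (η₀ : ℝ × ℝ → ℝ) (α₀ : ℝ → ℝ) (t : ℝ) (a : ℝ × ℝ) :
    (shiftedZeta k c η₀ α₀ t a).re =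
      c * t - α₀ t + hilbert k η₀ (a + (-α₀ t, -(k * α₀ t))) := by
  simp [shiftedZeta, zetaZero, Prod.add_def, sub_eq_add_neg]
  ring

/-- As `H` commutes with translations, the shifted potential is again c times the Hilbert transform
of the shifted profile, so the formulas for `GraphProfile` apply at every time. -/
lemma shiftedPhi_eq {k : ℝ} {η₀ : ℝ × ℝ → ℝ} (h : GraphProfile k η₀) (c : ℝ) (α₀ : ℝ → ℝ)
    (t : ℝ) : shiftedPhi k c η₀ α₀ t =
      fun a => c * hilbert k (fun b => η₀ (b + (-α₀ t, -(k * α₀ t)))) a := by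
  funext a
  rw [h.smooth.hasW_ofReal.hilbert_translate]
  simp [shiftedPhi, phiZero, Prod.add_def, sub_eq_add_neg]

lemma hasDerivAt_shift {k : ℝ} {S : ℝ × ℝ → ℝ} (hS : Smooth S) {α₀ : ℝ → ℝ} {α₁ t : ℝ}
    (hα : HasDerivAt α₀ α₁ t) (a : ℝ × ℝ) :
    HasDerivAt (fun s => S (a + (-α₀ s, -(k * α₀ s))))
      (-α₁ * dAlpha k S (a + (-α₀ t, -(k * α₀ t)))) t := by
  have h1 := lineDeriv_shift hS k a (-α₀ t)
  have h2 := h1.comp t hα.neg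
  have e : ∀ s, (a.1 + -α₀ s, a.2 + k * -α₀ s) = a + (-α₀ s, -(k * α₀ s)) := fun s => by
    ext <;> simp
  simp only [Function.comp_def, Pi.neg_apply, e] at h2
  rwa [mul_comm] at h2

/-- The velocity of the phase of the shifted traveling form. -/
lemma hasDerivAt_phase {k c : ℝ} {η : ℝ × ℝ → ℝ} (h : GraphProfile k η) {α₀ : ℝ → ℝ}
    (hα : AnalyticOnNhd ℝ α₀ univ)
    (himp : ∀ t, c * t - α₀ t + hilbert k η (-α₀ t, -(k * α₀ t)) = 0) (t : ℝ) :
    HasDerivAt α₀ (c / xiAlpha k η (-α₀ t, -(k * α₀ t))) t := by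
  have h1 := (hα t (mem_univ t)).differentiableAt.hasDerivAt
  have h2 := hasDerivAt_shift (k := k) h.smooth_hilbert h1 (0, 0)
  have h3 : HasDerivAt (fun s => c * s - α₀ s + hilbert k η ((0, 0) + (-α₀ s, -(k * α₀ s)))) _ t :=
    (((hasDerivAt_id t).const_mul c).sub h1).add h2
  have e : (fun s => c * s - α₀ s + hilbert k η ((0, 0) + (-α₀ s, -(k * α₀ s)))) = fun _ => 0 := by
    funext s
    rw [Prod.mk_zero_zero, zero_add]; exact himp s
  rw [e] at h3
  -- Differentiating the constraint in time gives c - α₀'(1 + ∂_αξ̃₀) = 0.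
  have h4 := h3.unique (hasDerivAt_const t (0 : ℝ))
  have h5 := h.xiAlpha_eq (-α₀ t, -(k * α₀ t))
  have h6 := (h.xiAlpha_pos (-α₀ t, -(k * α₀ t))).ne'
  rw [Prod.mk_zero_zero, zero_add] at h4
  refine h1.congr_deriv ?_
  rw [eq_div_iff h6, h5]
  linarith

/-- Here α₀' = c/ξ_α = c - C₁, so translation by α₀ produces exactly the transport terms (C₁ -
c)∂_α. The offset is x₀ = ct - α₀, whose derivative is C₁. -/
theorem shifted_isSolution {k g τ c : ℝ} {η : ℝ × ℝ → ℝ} (h : GraphProfile k η)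
    (hη : AnalyticOnNhd ℝ η univ) (hS : AnalyticOnNhd ℝ (hilbert k η) univ)
    (ht : IsTravelingProfile k g τ c η) {α₀ : ℝ → ℝ} (hα : AnalyticOnNhd ℝ α₀ univ)
    (himp : ∀ t, c * t - α₀ t + hilbert k η (-α₀ t, -(k * α₀ t)) = 0) :
    IsPinnedTorusSolution k g τ univ (shiftedZeta k c η α₀) (shiftedPhi k c η α₀) := by
  have hg : ∀ t, GraphProfile k fun b => η (b + (-α₀ t, -(k * α₀ t))) := fun t => h.translate _
  have hα' := hasDerivAt_phase h hα himp
  have hC : ∀ t, pinnedC₁ k (fun b => (shiftedZeta k c η α₀ t b).im) (shiftedPhi k c η α₀ t) =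
      c - c / xiAlpha k η (-α₀ t, -(k * α₀ t)) := fun t => by
    simp only [shiftedZeta_im, shiftedPhi_eq h]
    rw [(hg t).pinnedC₁_eq, xiAlpha_translate h.smooth, Prod.mk_zero_zero, zero_add]
  have hbase : ∀ p : ℝ × (ℝ × ℝ),
      AnalyticAt ℝ (fun p : ℝ × (ℝ × ℝ) => (p.2.1 - α₀ p.1, p.2.2 - k * α₀ p.1)) p := fun p => by
    have h1 : AnalyticAt ℝ (fun p : ℝ × (ℝ × ℝ) => α₀ p.1) p :=
      (hα p.1 (mem_univ _)).comp analyticAt_fst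
    have h2 : AnalyticAt ℝ (fun p : ℝ × (ℝ × ℝ) => p.2.1) p := analyticAt_fst.comp analyticAt_snd
    have h3 : AnalyticAt ℝ (fun p : ℝ × (ℝ × ℝ) => p.2.2) p := analyticAt_snd.comp analyticAt_snd
    exact (h2.sub h1).prod (h3.sub (analyticAt_const.mul h1))
  have hreal : ∀ {u : ℝ × (ℝ × ℝ) → ℝ} {p}, AnalyticAt ℝ u p → AnalyticAt ℝ (fun p => (u p : ℂ)) p :=
    fun hu => (Complex.ofRealCLM.analyticAt _).comp hu
  have hSb : ∀ p : ℝ × (ℝ × ℝ), AnalyticAt ℝ (fun p : ℝ × (ℝ × ℝ) =>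
      hilbert k η (p.2.1 - α₀ p.1, p.2.2 - k * α₀ p.1)) p :=
    fun p => (hS _ (mem_univ _)).comp (hbase p)
  have hηb : ∀ p : ℝ × (ℝ × ℝ), AnalyticAt ℝ (fun p : ℝ × (ℝ × ℝ) =>
      η (p.2.1 - α₀ p.1, p.2.2 - k * α₀ p.1)) p :=
    fun p => (hη _ (mem_univ _)).comp (hbase p)
  refine ⟨fun t _ => ?_, ⟨fun p _ => ?_, fun p _ => ?_, fun t _ => ?_, fun t _ => ?_,
    fun t _ a => ?_, ?_, fun t _ a => ?_, fun t _ a => ?_⟩⟩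
  · simp only [shiftedZeta_im]
    exact ((hg t).xiAlpha_pos _).ne'
  · have h1 : AnalyticAt ℝ (fun p : ℝ × (ℝ × ℝ) => c * p.1 - α₀ p.1) p :=
      (analyticAt_const.mul analyticAt_fst).sub ((hα p.1 (mem_univ _)).comp analyticAt_fst)
    exact ((hreal (hSb p)).add (analyticAt_const.mul (hreal (hηb p)))).add (hreal h1)
  · exact analyticAt_const.mul (hSb p)
  · have h1 := (hg t).smooth.periodic
    have h2 := (h.smooth_hilbert.translate (-α₀ t, -(k * α₀ t))).periodic
    intro a
    refine ⟨Complex.ext ?_ ?_, Complex.ext ?_ ?_⟩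
    · simp only [shiftedZeta_re]; exact congrArg _ (h2 a).1
    · simp only [shiftedZeta_im]; exact (h1 a).1
    · simp only [shiftedZeta_re]; exact congrArg _ (h2 a).2
    · simp only [shiftedZeta_im]; exact (h1 a).2
  · rw [shiftedPhi_eq h]
    exact ((hg t).smooth_phi c).periodic
  · simp only [shiftedZeta_im]
    exact ((hg t).jac_pos a).ne'
  · refine ⟨fun t => c * t - α₀ t, fun t _ => ⟨fun a => ?_, ?_⟩⟩
    · simp only [shiftedZeta_im, shiftedZeta_re]
      rw [h.smooth.hasW_ofReal.hilbert_translate]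
    · rw [hC]
      simp only [shiftedZeta_im, shiftedPhi_eq h]
      rw [(hg t).xZeroRHS_eq]
      have := ((hasDerivAt_id t).const_mul c).sub (hα' t)
      rw [mul_one] at this
      exact this.hasDerivWithinAt
  · rw [hC]
    simp only [shiftedZeta_im, shiftedPhi_eq h]
    rw [(hg t).etaRHS_eq, dAlpha_translate]
    have := hasDerivAt_shift (k := k) h.smooth (hα' t) a
    refine (this.congr_deriv ?_).hasDerivWithinAt
    ring
  · rw [hC]
    have e : (fun s => shiftedPhi k c η α₀ s a) =
        fun s => c * hilbert k η (a + (-α₀ s, -(k * α₀ s))) := by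
      funext s
      rw [shiftedPhi_eq h]
      beta_reduce
      rw [h.smooth.hasW_ofReal.hilbert_translate]
    rw [e]
    simp only [shiftedZeta_im, shiftedPhi_eq h]
    rw [(hg t).phiRHS_eq (ht.translate h.smooth _), xiAlpha_translate h.smooth]
    have := (hasDerivAt_shift (k := k) h.smooth_hilbert (hα' t) a).const_mul c
    refine (this.congr_deriv ?_).hasDerivWithinAt
    rw [h.xiAlpha_eq (a + _)]
    ring

/-! ### Taylor expansion in time of analytic functions of time and space -/

/-- The partial derivative in the direction `v`. -/
def pd (v : ℝ × (ℝ × ℝ)) (F : ℝ × (ℝ × ℝ) → ℝ) (p : ℝ × (ℝ × ℝ)) : ℝ := fderiv ℝ F p v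

/-- The time direction. -/
def tdir : ℝ × (ℝ × ℝ) := (1, 0)

lemma analyticAt_pd {F : ℝ × (ℝ × ℝ) → ℝ} {p : ℝ × (ℝ × ℝ)} (hF : AnalyticAt ℝ F p)
    (v : ℝ × (ℝ × ℝ)) : AnalyticAt ℝ (pd v F) p :=
  ((ContinuousLinearMap.apply ℝ ℝ v).analyticAt _).comp hF.fderiv

lemma analyticAt_iterate_pd {F : ℝ × (ℝ × ℝ) → ℝ} {p : ℝ × (ℝ × ℝ)} (hF : AnalyticAt ℝ F p)
    (v : ℝ × (ℝ × ℝ)) (i : ℕ) : AnalyticAt ℝ ((pd v)^[i] F) p := by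
  induction i generalizing F with
  | zero => exact hF
  | succ i ih => exact ih (analyticAt_pd hF v)

lemma pd_congr {F G : ℝ × (ℝ × ℝ) → ℝ} {p : ℝ × (ℝ × ℝ)} (h : F =ᶠ[𝓝 p] G)
    (v : ℝ × (ℝ × ℝ)) : pd v F =ᶠ[𝓝 p] pd v G :=
  h.fderiv.mono fun q hq => by rw [pd, pd, hq]

lemma iterate_pd_congr {F G : ℝ × (ℝ × ℝ) → ℝ} {p : ℝ × (ℝ × ℝ)} (h : F =ᶠ[𝓝 p] G)
    (v : ℝ × (ℝ × ℝ)) (i : ℕ) : (pd v)^[i] F =ᶠ[𝓝 p] (pd v)^[i] G := by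
  induction i generalizing F G with
  | zero => exact h
  | succ i ih => exact ih (pd_congr h v)

lemma pd_comm {F : ℝ × (ℝ × ℝ) → ℝ} {p : ℝ × (ℝ × ℝ)} (hF : AnalyticAt ℝ F p)
    (v w : ℝ × (ℝ × ℝ)) : pd v (pd w F) p = pd w (pd v F) p := by
  have h1 : ∀ w v, pd v (pd w F) p = fderiv ℝ (fderiv ℝ F) p v w := fun w v => by
    have h := (ContinuousLinearMap.apply ℝ ℝ w).hasFDerivAt.comp p
      hF.fderiv.differentiableAt.hasFDerivAt
    have h' : HasFDerivAt (pd w F) _ p := h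
    rw [pd, h'.fderiv]; rfl
  rw [h1, h1]
  exact (hF.contDiffAt (n := ω)).isSymmSndFDerivAt (by simp) v w

lemma iterate_pd_comm {F : ℝ × (ℝ × ℝ) → ℝ} {p : ℝ × (ℝ × ℝ)} (hF : AnalyticAt ℝ F p)
    (v w : ℝ × (ℝ × ℝ)) (i : ℕ) : (pd v)^[i] (pd w F) =ᶠ[𝓝 p] pd w ((pd v)^[i] F) := by
  induction i generalizing F with
  | zero => exact EventuallyEq.rfl
  | succ i ih =>
    have h1 : pd v (pd w F) =ᶠ[𝓝 p] pd w (pd v F) :=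
      hF.eventually_analyticAt.mono fun q hq => pd_comm hq v w
    exact (iterate_pd_congr h1 v i).trans (ih (analyticAt_pd hF v))

lemma hasDerivAt_time {F : ℝ × (ℝ × ℝ) → ℝ} {t : ℝ} {a : ℝ × ℝ} (hF : AnalyticAt ℝ F (t, a)) :
    HasDerivAt (fun s => F (s, a)) (pd tdir F (t, a)) t := by
  have h1 : HasDerivAt (fun s : ℝ => (s, a)) ((1 : ℝ), (0 : ℝ × ℝ)) t :=
    (hasDerivAt_id t).prodMk (hasDerivAt_const t a)
  exact hF.differentiableAt.hasFDerivAt.comp_hasDerivAt t h1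

lemma analyticAt_time {F : ℝ × (ℝ × ℝ) → ℝ} {t : ℝ} {a : ℝ × ℝ} (hF : AnalyticAt ℝ F (t, a)) :
    AnalyticAt ℝ (fun s => F (s, a)) t :=
  hF.comp (f := fun s : ℝ => (s, a)) (analyticAt_id.prod analyticAt_const)

lemma iteratedDeriv_time {F : ℝ × (ℝ × ℝ) → ℝ} {t : ℝ} {a : ℝ × ℝ}
    (hF : AnalyticAt ℝ F (t, a)) (i : ℕ) :
    iteratedDeriv i (fun s => F (s, a)) t = (pd tdir)^[i] F (t, a) := by
  induction i generalizing F with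
  | zero => simp
  | succ i ih =>
    have hc : Tendsto (fun s : ℝ => (s, a)) (𝓝 t) (𝓝 (t, a)) :=
      Continuous.tendsto (by fun_prop) t
    have h1 : deriv (fun s => F (s, a)) =ᶠ[𝓝 t] fun s => pd tdir F (s, a) :=
      (hc.eventually hF.eventually_analyticAt).mono fun s hs => (hasDerivAt_time hs).deriv
    rw [iteratedDeriv_succ', h1.iteratedDeriv_eq, ih (analyticAt_pd hF tdir),
      Function.iterate_succ_apply]

/-- The first `n` time derivatives of `F` vanish at time zero. -/
def VanishOrder (n : ℕ) (F : ℝ × (ℝ × ℝ) → ℝ) : Prop :=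
  ∀ i < n, ∀ a, (pd tdir)^[i] F (0, a) = 0

/-- Spatial and time derivatives commute, and the vanishing at t = 0 holds for all a. The loss of
spatial derivatives in the equations therefore costs no order in t. -/
lemma VanishOrder.pd {n : ℕ} {F : ℝ × (ℝ × ℝ) → ℝ} (hF : ∀ a, AnalyticAt ℝ F (0, a))
    (h : VanishOrder n F) (w : ℝ × ℝ) : VanishOrder n (TorusWave.pd (0, w) F) := by
  intro i hi a
  rw [(iterate_pd_comm (hF a) tdir (0, w) i).self_of_nhds]
  have h1 : HasDerivAt (fun s : ℝ => ((0 : ℝ), a + s • w)) ((0 : ℝ), w) 0 := by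
    refine (hasDerivAt_const (0 : ℝ) (0 : ℝ)).prodMk ?_
    simpa using ((hasDerivAt_id (0 : ℝ)).smul_const w).const_add a
  have h2 := (analyticAt_iterate_pd (hF a) tdir i).differentiableAt.hasFDerivAt
  have h3 := HasFDerivAt.comp_hasDerivAt_of_eq (0 : ℝ) h2 h1 (by simp)
  have e : ((TorusWave.pd tdir)^[i] F ∘ fun s : ℝ => ((0 : ℝ), a + s • w)) = fun _ => 0 :=
    funext fun s => h i hi _
  rw [e] at h3
  exact h3.unique (hasDerivAt_const _ _)

/-- Induction on n with the mean value inequality on [-|t|, |t|]: each passage from ∂_tF to F gains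
one factor |t|. -/
lemma abs_le_of_vanish {n : ℕ} {F : ℝ × (ℝ × ℝ) → ℝ} {δ M : ℝ} {a : ℝ × ℝ}
    (hF : ∀ t, |t| ≤ δ → AnalyticAt ℝ F (t, a)) (h0 : ∀ i < n, (pd tdir)^[i] F (0, a) = 0)
    (hM : ∀ t, |t| ≤ δ → |(pd tdir)^[n] F (t, a)| ≤ M) {t : ℝ} (ht : |t| ≤ δ) :
    |F (t, a)| ≤ M * |t| ^ n := by
  induction n generalizing F t with
  | zero => simpa using hM t ht
  | succ n ih =>
    have hM0 : 0 ≤ M := (abs_nonneg _).trans (hM t ht)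
    have h1 : ∀ s, |s| ≤ δ → |pd tdir F (s, a)| ≤ M * |s| ^ n := fun s hs =>
      ih (F := pd tdir F) (fun t ht => analyticAt_pd (hF t ht) _)
        (fun i hi => h0 (i + 1) (by omega)) hM hs
    have h2 := Convex.norm_image_sub_le_of_norm_hasDerivWithin_le (𝕜 := ℝ)
      (f := fun s => F (s, a)) (f' := fun s => pd tdir F (s, a)) (s := Icc (-|t|) |t|)
      (C := M * |t| ^ n) (x := 0) (y := t)
      (fun s hs => (hasDerivAt_time (hF s ((abs_le.2 hs).trans ht))).hasDerivWithinAt)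
      (fun s hs => by
        have h3 : |s| ≤ |t| := abs_le.2 hs
        exact (h1 s (h3.trans ht)).trans (by gcongr))
      (convex_Icc _ _) (by simp) (abs_le.1 le_rfl)
    have h4 : F (0, a) = 0 := h0 0 (by omega)
    rw [h4, sub_zero, sub_zero, Real.norm_eq_abs, Real.norm_eq_abs] at h2
    rw [pow_succ, ← mul_assoc]
    exact h2

/-- The tube lemma provides one time interval on which F is analytic over all of K, and compactness
then bounds the n-th time derivative. -/
lemma VanishOrder.exists_bound {n : ℕ} {F : ℝ × (ℝ × ℝ) → ℝ} (hF : ∀ a, AnalyticAt ℝ F (0, a))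
    (h : VanishOrder n F) {K : Set (ℝ × ℝ)} (hK : IsCompact K) :
    ∃ M, 0 ≤ M ∧ ∀ᶠ t in 𝓝 (0 : ℝ), ∀ a ∈ K, |F (t, a)| ≤ M * |t| ^ n := by
  have hsub : ({0} : Set ℝ) ×ˢ K ⊆ {p | AnalyticAt ℝ F p} := by
    rintro ⟨t, a⟩ ⟨ht, _⟩
    obtain rfl : t = 0 := ht
    exact hF a
  obtain ⟨V, W, hV, _, h0V, hKW, hVW⟩ :=
    generalized_tube_lemma isCompact_singleton hK (isOpen_analyticAt ℝ F) hsub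
  obtain ⟨δ, hδ, hball⟩ := Metric.nhds_basis_closedBall.mem_iff.1
    (hV.mem_nhds (h0V (mem_singleton 0)))
  have hU : ∀ t, |t| ≤ δ → ∀ a ∈ K, AnalyticAt ℝ F (t, a) := fun t ht a ha =>
    hVW ⟨hball (by simpa using ht), hKW ha⟩
  obtain ⟨M, hM⟩ := ((isCompact_Icc (a := -δ) (b := δ)).prod hK).exists_bound_of_continuousOn
    (f := (TorusWave.pd tdir)^[n] F) fun p hp =>
      (analyticAt_iterate_pd (hU p.1 (abs_le.2 hp.1) p.2 hp.2) tdir n).continuousAt.continuousWithinAt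
  refine ⟨max M 0, le_max_right _ _, ?_⟩
  have hev : ∀ᶠ t in 𝓝 (0 : ℝ), |t| ≤ δ := by
    filter_upwards [Metric.closedBall_mem_nhds (0 : ℝ) hδ] with t ht
    simpa using ht
  filter_upwards [hev] with t ht a ha
  exact abs_le_of_vanish (fun t ht => hU t ht a ha) (fun i hi => h i hi a)
    (fun t ht => (hM (t, a) ⟨abs_le.1 ht, ha⟩).trans (le_max_left _ _)) ht

/-- If the order were m < n, then f = t^m g with g(0) ≠ 0 near 0, while the bound divided by |t|^m
forces g(0) = 0. A general filter l is allowed because 0 may be an endpoint of the time interval. -/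
lemma le_analyticOrderAt_of_bound {f : ℝ → ℝ} (hf : AnalyticAt ℝ f 0) {l : Filter ℝ} [l.NeBot]
    (hl : l ≤ 𝓝[≠] 0) {n : ℕ} {C : ℝ} (hC : ∀ᶠ t in l, |f t| ≤ C * |t| ^ n) :
    (n : ℕ∞) ≤ analyticOrderAt f 0 := by
  by_contra hlt
  rw [not_le] at hlt
  obtain ⟨m, hm⟩ := ENat.ne_top_iff_exists.1 (ne_top_of_lt hlt)
  rw [← hm] at hlt
  have hmn : m < n := by exact_mod_cast hlt
  obtain ⟨g, hg, hg0, hfg⟩ := hf.analyticOrderAt_eq_natCast.1 hm.symm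
  have hl0 : l ≤ 𝓝 0 := hl.trans nhdsWithin_le_nhds
  have h1 : ∀ᶠ t in l, |g t| ≤ C * |t| ^ (n - m) := by
    filter_upwards [hC, hl0 hfg, hl self_mem_nhdsWithin] with t ht hgt ht0
    have ht0' : (0 : ℝ) < |t| := abs_pos.2 ht0
    rw [hgt, sub_zero, smul_eq_mul, abs_mul, abs_pow,
      show n = m + (n - m) by omega, pow_add] at ht
    have h2 : |t| ^ m * |g t| ≤ |t| ^ m * (C * |t| ^ (n - m)) := by
      refine ht.trans_eq ?_
      ring
    exact le_of_mul_le_mul_left h2 (by positivity)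
  have h2 : Tendsto (fun t : ℝ => C * |t| ^ (n - m)) l (𝓝 0) := by
    have : Tendsto (fun t : ℝ => C * |t| ^ (n - m)) (𝓝 0) (𝓝 (C * |(0 : ℝ)| ^ (n - m))) :=
      Continuous.tendsto (by fun_prop) 0
    rw [abs_zero, zero_pow (by omega), mul_zero] at this
    exact this.mono_left hl0
  have h3 : Tendsto (fun t => |g t|) l (𝓝 |g 0|) := (hg.continuousAt.tendsto.mono_left hl0).abs
  have h4 := le_of_tendsto_of_tendsto h3 h2 h1
  exact hg0 (abs_eq_zero.1 (le_antisymm h4 (abs_nonneg _)))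

/-- The bound makes ∂_tF vanish to order n, which supplies the n-th time derivative of F. With n ≥
1, the value of F itself is already known to vanish. -/
lemma VanishOrder.succ {n : ℕ} (hn : 1 ≤ n) {F : ℝ × (ℝ × ℝ) → ℝ}
    (hF : ∀ a, AnalyticAt ℝ F (0, a)) (h : VanishOrder n F) {l : Filter ℝ} [l.NeBot]
    (hl : l ≤ 𝓝[≠] 0)
    (hb : ∀ a, ∃ C, ∀ᶠ t in l, |TorusWave.pd tdir F (t, a)| ≤ C * |t| ^ n) :
    VanishOrder (n + 1) F := by
  intro i hi a
  rcases Nat.lt_succ_iff_lt_or_eq.1 hi with hi | rfl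
  · exact h i hi a
  · obtain ⟨C, hC⟩ := hb a
    have h1 := analyticAt_pd (hF a) tdir
    have h2 := le_analyticOrderAt_of_bound (analyticAt_time h1) hl hC
    have h3 := (natCast_le_analyticOrderAt_iff_iteratedDeriv_eq_zero (analyticAt_time h1)).1 h2
      (i - 1) (by omega)
    rw [iteratedDeriv_time h1] at h3
    obtain ⟨j, rfl⟩ : ∃ j, i = j + 1 := ⟨i - 1, by omega⟩
    exact h3

/-- For fixed a, the function of time has infinite order at 0; the identity theorem spreads its
vanishing over the interval. -/
lemma eqOn_zero_of_vanishOrder {F : ℝ × (ℝ × ℝ) → ℝ} {I : Set ℝ} (hI : I.OrdConnected)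
    (h0 : (0 : ℝ) ∈ I) (hF : AnalyticOnNhd ℝ F (I ×ˢ univ)) (h : ∀ n, VanishOrder n F) :
    ∀ t ∈ I, ∀ a, F (t, a) = 0 := by
  intro t ht a
  have h1 : AnalyticOnNhd ℝ (fun s => F (s, a)) I := fun s hs =>
    analyticAt_time (hF (s, a) ⟨hs, mem_univ _⟩)
  have h2 : analyticOrderAt (fun s => F (s, a)) 0 = ⊤ := by
    refine ENat.eq_top_iff_forall_ge.2 fun n => ?_
    refine (natCast_le_analyticOrderAt_iff_iteratedDeriv_eq_zero (h1 0 h0)).2 fun i hi => ?_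
    rw [iteratedDeriv_time (hF (0, a) ⟨h0, mem_univ _⟩)]
    exact h n i hi a
  exact h1.eqOn_zero_of_preconnected_of_eventuallyEq_zero hI.isPreconnected h0
    (analyticOrderAt_eq_top.1 h2) ht

/-! ### Families of functions that are small in the Wiener norm -/

/-- `u(t) = O(tⁿ)` along `l` in the Wiener norm. -/
def WienerO (l : Filter ℝ) (n : ℕ) (u : ℝ → ℝ × ℝ → ℝ) : Prop :=
  ∃ C, 0 ≤ C ∧ ∀ᶠ t in l, ∃ c, HasW (fun a => (u t a : ℂ)) c ∧ wNorm c ≤ C * |t| ^ n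

section WienerO

variable {l : Filter ℝ} {n m : ℕ} {u v : ℝ → ℝ × ℝ → ℝ}

lemma WienerO.congr (hu : WienerO l n u) (h : ∀ᶠ t in l, v t = u t) : WienerO l n v := by
  obtain ⟨C, hC, hu⟩ := hu
  refine ⟨C, hC, ?_⟩
  filter_upwards [hu, h] with t ht e
  rwa [e]

lemma WienerO.add (hu : WienerO l n u) (hv : WienerO l n v) :
    WienerO l n fun t a => u t a + v t a := by
  obtain ⟨C, hC, hu⟩ := hu
  obtain ⟨D, hD, hv⟩ := hv
  refine ⟨C + D, by positivity, ?_⟩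
  filter_upwards [hu, hv] with t ⟨c, hc, hc'⟩ ⟨d, hd, hd'⟩
  refine ⟨_, (hc.add hd).congr fun a => by push_cast; rfl, (wNorm_add_le hc hd).trans ?_⟩
  linarith

lemma WienerO.const_mul (hu : WienerO l n u) (z : ℝ) : WienerO l n fun t a => z * u t a := by
  obtain ⟨C, hC, hu⟩ := hu
  refine ⟨|z| * C, by positivity, ?_⟩
  filter_upwards [hu] with t ⟨c, hc, hc'⟩
  refine ⟨_, (hc.const_mul z).congr fun a => by push_cast; rfl, ?_⟩
  rw [wNorm_const_mul, Complex.norm_real, Real.norm_eq_abs, mul_assoc]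
  gcongr

lemma WienerO.mul (hu : WienerO l n u) (hv : WienerO l m v) :
    WienerO l (n + m) fun t a => u t a * v t a := by
  obtain ⟨C, hC, hu⟩ := hu
  obtain ⟨D, hD, hv⟩ := hv
  refine ⟨C * D, by positivity, ?_⟩
  filter_upwards [hu, hv] with t ⟨c, hc, hc'⟩ ⟨d, hd, hd'⟩
  refine ⟨_, (hc.mul hd).congr fun a => by push_cast; rfl,
    (wNorm_wConv_le hc.summable hd.summable).trans ?_⟩
  calc wNorm c * wNorm d ≤ (C * |t| ^ n) * (D * |t| ^ m) :=
        mul_le_mul hc' hd' (wNorm_nonneg _) (by positivity)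
    _ = C * D * |t| ^ (n + m) := by rw [pow_add]; ring

lemma WienerO.hilbert (hu : WienerO l n u) (k : ℝ) : WienerO l n fun t => hilbert k (u t) := by
  obtain ⟨C, hC, hu⟩ := hu
  refine ⟨C, hC, ?_⟩
  filter_upwards [hu] with t ⟨c, hc, hc'⟩
  exact ⟨_, hc.hilbert k, (wNorm_multiplier_le hc.summable (norm_hMult_le k)).trans hc'⟩

lemma WienerO.zero_of (hl : l ≤ 𝓝 0) (hu : WienerO l n u) : WienerO l 0 u := by
  obtain ⟨C, hC, hu⟩ := hu
  refine ⟨C, hC, ?_⟩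
  have h1 : ∀ᶠ t in l, |t| ≤ 1 := hl (by
    filter_upwards [Metric.closedBall_mem_nhds (0 : ℝ) one_pos] with t ht
    simpa using ht)
  filter_upwards [hu, h1] with t ⟨c, hc, hc'⟩ ht
  refine ⟨c, hc, hc'.trans ?_⟩
  rw [pow_zero]
  exact mul_le_mul_of_nonneg_left (pow_le_one₀ (abs_nonneg _) ht) hC

/-- Translations preserve the Wiener norm, so the bound does not depend on the path b. -/
lemma wienerO_translate {w : ℝ × ℝ → ℝ} (hw : Smooth w) (b : ℝ → ℝ × ℝ) :
    WienerO l 0 fun t a => w (a + b t) := by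
  refine ⟨wNorm (torusCoeff w), wNorm_nonneg _, Eventually.of_forall fun t =>
    ⟨_, hw.hasW_ofReal.translate (b t), ?_⟩⟩
  rw [wNorm_translate, pow_zero, mul_one]

end WienerO

/-- `u₁` is bounded and `u - u₁ = O(tⁿ)` in the Wiener norm. -/
structure WienerClose (l : Filter ℝ) (n : ℕ) (u u₁ : ℝ → ℝ × ℝ → ℝ) : Prop where
  base : WienerO l 0 u₁
  diff : WienerO l n fun t a => u t a - u₁ t a

namespace WienerClose

variable {l : Filter ℝ} {n : ℕ} {u u₁ v v₁ : ℝ → ℝ × ℝ → ℝ}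

lemma bounded (hl : l ≤ 𝓝 0) (hu : WienerClose l n u u₁) : WienerO l 0 u := by
  simpa using hu.base.add (hu.diff.zero_of hl)

lemma add (hu : WienerClose l n u u₁) (hv : WienerClose l n v v₁) :
    WienerClose l n (fun t a => u t a + v t a) (fun t a => u₁ t a + v₁ t a) :=
  ⟨hu.base.add hv.base, (hu.diff.add hv.diff).congr (Eventually.of_forall fun t => by
    funext a; ring)⟩

lemma mul (hl : l ≤ 𝓝 0) (hu : WienerClose l n u u₁) (hv : WienerClose l n v v₁) :
    WienerClose l n (fun t a => u t a * v t a) (fun t a => u₁ t a * v₁ t a) := by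
  refine ⟨hu.base.mul hv.base, ?_⟩
  have h1 := hu.diff.mul (hv.bounded hl)
  have h2 := hv.diff.mul hu.base
  exact (h1.add h2).congr (Eventually.of_forall fun t => by funext a; ring)

lemma hilbert (hl : l ≤ 𝓝 0) (hu : WienerClose l n u u₁) (k : ℝ) :
    WienerClose l n (fun t => hilbert k (u t)) (fun t => hilbert k (u₁ t)) := by
  refine ⟨hu.base.hilbert k, (hu.diff.hilbert k).congr ?_⟩
  obtain ⟨C, _, h1⟩ := hu.base
  obtain ⟨D, _, h2⟩ := hu.bounded hl
  filter_upwards [h1, h2] with t ⟨c, hc, _⟩ ⟨d, hd, _⟩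
  funext a
  rw [hd.hilbert_sub hc]

/-- Write u = u₁(1 + (u - u₁)/u₁). For n ≥ 1 the perturbation tends to zero and the Neumann series
inverts the second factor, so only u₁ has to be invertible beforehand. -/
lemma inv (hl : l ≤ 𝓝 0) (hn : 1 ≤ n) (hu : WienerClose l n u u₁) (h0 : ∀ t a, u₁ t a ≠ 0)
    (hinv : WienerO l 0 fun t a => (u₁ t a)⁻¹) :
    WienerClose l n (fun t a => (u t a)⁻¹) (fun t a => (u₁ t a)⁻¹) := by
  obtain ⟨C, hC, hE⟩ := hu.diff.mul hinv
  have hsmall : ∀ᶠ t in l, C * |t| ^ (n + 0) ≤ 1 / 2 := by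
    have : Tendsto (fun t : ℝ => C * |t| ^ (n + 0)) (𝓝 0) (𝓝 (C * |(0 : ℝ)| ^ (n + 0))) :=
      Continuous.tendsto (by fun_prop) 0
    rw [abs_zero, zero_pow (by omega), mul_zero] at this
    exact hl (this.eventually_le_const (by norm_num))
  have hfac : ∀ t a, u t a = u₁ t a * (1 + (u t a - u₁ t a) * (u₁ t a)⁻¹) := fun t a => by
    field_simp [h0 t a]; ring
  have hone : WienerO l 0 fun t a => (1 + (u t a - u₁ t a) * (u₁ t a)⁻¹)⁻¹ := by
    refine ⟨2, by norm_num, ?_⟩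
    filter_upwards [hE, hsmall] with t ⟨c, hc, hc'⟩ hs
    obtain ⟨d, hd, hd'⟩ := hc.inv_one_add (hc'.trans hs)
    exact ⟨d, hd.congr fun a => by push_cast; rfl, by simpa using hd'⟩
  have hne : ∀ᶠ t in l, ∀ a, u t a ≠ 0 := by
    filter_upwards [hE, hsmall] with t ⟨c, hc, hc'⟩ hs a
    have h1 := (hc.norm_le a).trans (hc'.trans hs)
    rw [Complex.norm_real, Real.norm_eq_abs] at h1
    rw [hfac]
    refine mul_ne_zero (h0 t a) ?_
    have := (abs_le.1 h1).1
    intro h2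
    linarith
  have hui : WienerO l 0 fun t a => (u t a)⁻¹ :=
    (hinv.mul hone).congr (Eventually.of_forall fun t => by
      funext a; rw [← mul_inv, ← hfac])
  -- The resolvent identity u⁻¹ - u₁⁻¹ = -(u - u₁) u₁⁻¹ u⁻¹.
  refine ⟨hinv, (((hu.diff.mul hinv).mul hui).const_mul (-1)).congr ?_⟩
  filter_upwards [hne] with t ht
  funext a
  have h1 := ht a
  have h2 := h0 t a
  field_simp
  ring

end WienerClose

/-! ### Families of functions that are small in the sup norm -/

/-- `u` and `u₁` are continuous and bounded, and `u - u₁ = O(tⁿ)` uniformly. -/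
def SupClose (l : Filter ℝ) (n : ℕ) (u u₁ : ℝ → ℝ × ℝ → ℝ) : Prop :=
  ∃ C, 0 ≤ C ∧ ∀ᶠ t in l, Continuous (u t) ∧ Continuous (u₁ t) ∧
    ∀ a, |u t a| ≤ C ∧ |u₁ t a| ≤ C ∧ |u t a - u₁ t a| ≤ C * |t| ^ n

section SupClose

variable {l : Filter ℝ} {n : ℕ} {u u₁ v v₁ : ℝ → ℝ × ℝ → ℝ}

lemma WienerClose.sup (hl : l ≤ 𝓝 0) (hu : WienerClose l n u u₁) : SupClose l n u u₁ := by
  obtain ⟨C, hC, h1⟩ := hu.base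
  obtain ⟨D, hD, h2⟩ := hu.bounded hl
  obtain ⟨E, hE, h3⟩ := hu.diff
  have hcont : ∀ {w : ℝ × ℝ → ℝ} {c : ℤ × ℤ → ℂ}, HasW (fun a => (w a : ℂ)) c → Continuous w :=
    fun h => by
      have := Complex.continuous_re.comp h.continuous
      simpa only [Function.comp_def, Complex.ofReal_re] using this
  have habs : ∀ {w : ℝ × ℝ → ℝ} {c : ℤ × ℤ → ℂ}, HasW (fun a => (w a : ℂ)) c →
      ∀ a, |w a| ≤ wNorm c := fun h a => by simpa using h.norm_le a
  refine ⟨max C (max D E), le_max_of_le_left hC, ?_⟩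
  filter_upwards [h1, h2, h3] with t ⟨c, hc, hc'⟩ ⟨d, hd, hd'⟩ ⟨e, he, he'⟩
  rw [pow_zero, mul_one] at hc' hd'
  refine ⟨hcont hd, hcont hc, fun a => ⟨?_, ?_, ?_⟩⟩
  · exact (habs hd a).trans (hd'.trans (by simp))
  · exact (habs hc a).trans (hc'.trans (by simp))
  · refine (habs he a).trans (he'.trans ?_)
    gcongr
    simp

lemma SupClose.congr {w w₁ : ℝ → ℝ × ℝ → ℝ} (hu : SupClose l n u u₁)
    (h : ∀ᶠ t in l, w t = u t) (h₁ : ∀ᶠ t in l, w₁ t = u₁ t) : SupClose l n w w₁ := by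
  obtain ⟨C, hC, hu⟩ := hu
  refine ⟨C, hC, ?_⟩
  filter_upwards [hu, h, h₁] with t ht e e₁
  rwa [e, e₁]

lemma SupClose.mul (hu : SupClose l n u u₁) (hv : SupClose l n v v₁) :
    SupClose l n (fun t a => u t a * v t a) (fun t a => u₁ t a * v₁ t a) := by
  obtain ⟨C, hC, hu⟩ := hu
  obtain ⟨D, hD, hv⟩ := hv
  refine ⟨2 * (C * D), by positivity, ?_⟩
  filter_upwards [hu, hv] with t ⟨c1, c2, h⟩ ⟨d1, d2, h'⟩
  refine ⟨c1.mul d1, c2.mul d2, fun a => ?_⟩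
  obtain ⟨h1, h2, h3⟩ := h a
  obtain ⟨k1, k2, k3⟩ := h' a
  have hCD : 0 ≤ C * D := by positivity
  refine ⟨?_, ?_, ?_⟩
  · rw [abs_mul]
    linarith [mul_le_mul h1 k1 (abs_nonneg _) hC]
  · rw [abs_mul]
    linarith [mul_le_mul h2 k2 (abs_nonneg _) hC]
  · have e : u t a * v t a - u₁ t a * v₁ t a =
        (u t a - u₁ t a) * v t a + u₁ t a * (v t a - v₁ t a) := by ring
    rw [e]
    refine (abs_add_le _ _).trans ?_
    rw [abs_mul, abs_mul]
    have e1 := mul_le_mul h3 k1 (abs_nonneg _) (by positivity)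
    have e2 := mul_le_mul h2 k3 (abs_nonneg _) hC
    linarith

lemma SupClose.add (hu : SupClose l n u u₁) (hv : SupClose l n v v₁) :
    SupClose l n (fun t a => u t a + v t a) (fun t a => u₁ t a + v₁ t a) := by
  obtain ⟨C, hC, hu⟩ := hu
  obtain ⟨D, hD, hv⟩ := hv
  refine ⟨C + D, by positivity, ?_⟩
  filter_upwards [hu, hv] with t ⟨c1, c2, h⟩ ⟨d1, d2, h'⟩
  refine ⟨c1.add d1, c2.add d2, fun a => ?_⟩
  obtain ⟨h1, h2, h3⟩ := h a
  obtain ⟨k1, k2, k3⟩ := h' a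
  refine ⟨(abs_add_le _ _).trans (by linarith), (abs_add_le _ _).trans (by linarith), ?_⟩
  rw [add_sub_add_comm]
  exact (abs_add_le _ _).trans (by linarith)

lemma supClose_const (z : ℝ) : SupClose l n (fun _ _ => z) fun _ _ => z :=
  ⟨|z|, abs_nonneg _, Eventually.of_forall fun t => ⟨continuous_const, continuous_const, fun a =>
    ⟨le_rfl, le_rfl, by rw [sub_self, abs_zero]; positivity⟩⟩⟩

lemma SupClose.sub (hu : SupClose l n u u₁) (hv : SupClose l n v v₁) :
    SupClose l n (fun t a => u t a - v t a) (fun t a => u₁ t a - v₁ t a) := by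
  simpa [sub_eq_add_neg] using hu.add ((supClose_const (-1)).mul hv)

lemma SupClose.eval (hu : SupClose l n u u₁) (b : ℝ × ℝ) :
    SupClose l n (fun t _ => u t b) fun t _ => u₁ t b := by
  obtain ⟨C, hC, hu⟩ := hu
  refine ⟨C, hC, ?_⟩
  filter_upwards [hu] with t ⟨_, _, h⟩
  exact ⟨continuous_const, continuous_const, fun _ => h b⟩

/-- Rationalization: √u - √u₁ is (u - u₁)/(√u + √u₁), and the lower bound on u₁ alone controls the
denominator. -/
lemma SupClose.sqrt (hu : SupClose l n u u₁) {δ : ℝ} (hδ : 0 < δ) (h₁ : ∀ t a, δ ≤ u₁ t a)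
    (h : ∀ᶠ t in l, ∀ a, 0 ≤ u t a) :
    SupClose l n (fun t a => √(u t a)) fun t a => √(u₁ t a) := by
  obtain ⟨C, hC, hu⟩ := hu
  have hs : 0 < √δ := Real.sqrt_pos.2 hδ
  refine ⟨max (√C) (C / √δ), le_max_of_le_left (Real.sqrt_nonneg _), ?_⟩
  filter_upwards [hu, h] with t ⟨c1, c2, hb⟩ h0
  refine ⟨c1.sqrt, c2.sqrt, fun a => ?_⟩
  obtain ⟨b1, b2, b3⟩ := hb a
  refine ⟨?_, ?_, ?_⟩
  · rw [abs_of_nonneg (Real.sqrt_nonneg _)]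
    exact (Real.sqrt_le_sqrt ((le_abs_self _).trans b1)).trans (le_max_left _ _)
  · rw [abs_of_nonneg (Real.sqrt_nonneg _)]
    exact (Real.sqrt_le_sqrt ((le_abs_self _).trans b2)).trans (le_max_left _ _)
  · have e : (√(u t a) - √(u₁ t a)) * (√(u t a) + √(u₁ t a)) = u t a - u₁ t a := by
      have e1 := Real.mul_self_sqrt (h0 a)
      have e2 := Real.mul_self_sqrt (hδ.le.trans (h₁ t a))
      linear_combination e1 - e2
    have e3 : √δ ≤ √(u t a) + √(u₁ t a) :=
      (Real.sqrt_le_sqrt (h₁ t a)).trans (by linarith [Real.sqrt_nonneg (u t a)])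
    have e4 : |√(u t a) - √(u₁ t a)| * √δ ≤ C * |t| ^ n := by
      refine le_trans ?_ b3
      rw [← e, abs_mul]
      gcongr
      exact e3.trans (le_abs_self _)
    calc |√(u t a) - √(u₁ t a)| ≤ (C * |t| ^ n) / √δ := (le_div_iff₀ hs).2 e4
      _ = C / √δ * |t| ^ n := by ring
      _ ≤ _ := by gcongr; exact le_max_right _ _

lemma abs_torusMean_le {w : ℝ × ℝ → ℝ} {M : ℝ} (h : ∀ a, |w a| ≤ M) : |torusMean w| ≤ M := by
  have := norm_cmean_le (u := fun a => (w a : ℂ)) (M := M) fun s _ r _ => by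
    rw [Complex.norm_real]; exact h _
  rwa [cmean_ofReal, Complex.norm_real] at this

lemma torusMean_sub {w w₁ : ℝ × ℝ → ℝ} (h : Continuous w) (h₁ : Continuous w₁) :
    torusMean w - torusMean w₁ = torusMean fun a => w a - w₁ a := by
  have h2 := cmean_add (u := fun a => (w a : ℂ)) (v := fun a => (-1 : ℂ) * (w₁ a : ℂ))
    (by fun_prop) (by fun_prop)
  rw [cmean_const_mul, cmean_ofReal, cmean_ofReal] at h2
  have h3 : (fun a => (w a : ℂ) + -1 * (w₁ a : ℂ)) = fun a => ((w a - w₁ a : ℝ) : ℂ) := by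
    funext a; push_cast; ring
  rw [h3, cmean_ofReal] at h2
  have h4 : torusMean (fun a => w a - w₁ a) = torusMean w + -1 * torusMean w₁ := by
    exact_mod_cast h2
  rw [h4]; ring

lemma SupClose.torusMean (hu : SupClose l n u u₁) :
    SupClose l n (fun t _ => torusMean (u t)) fun t _ => torusMean (u₁ t) := by
  obtain ⟨C, hC, hu⟩ := hu
  refine ⟨C, hC, ?_⟩
  filter_upwards [hu] with t ⟨c1, c2, h⟩
  refine ⟨continuous_const, continuous_const, fun a =>
    ⟨abs_torusMean_le fun a => (h a).1, abs_torusMean_le fun a => (h a).2.1, ?_⟩⟩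
  rw [torusMean_sub c1 c2]
  exact abs_torusMean_le fun a => (h a).2.2

end SupClose

/-! ### Continuous dependence of the right-hand sides -/

lemma WienerClose.congr {l : Filter ℝ} {n : ℕ} {u u₁ w w₁ : ℝ → ℝ × ℝ → ℝ}
    (hu : WienerClose l n u u₁) (h : ∀ᶠ t in l, w t = u t) (h₁ : ∀ᶠ t in l, w₁ t = u₁ t) :
    WienerClose l n w w₁ := by
  refine ⟨hu.base.congr h₁, hu.diff.congr ?_⟩
  filter_upwards [h, h₁] with t e e₁
  rw [e, e₁]

lemma wienerClose_const {l : Filter ℝ} {n : ℕ} (z : ℝ) :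
    WienerClose l n (fun _ _ => z) fun _ _ => z := by
  have h : WienerO l n fun _ _ => (0 : ℝ) := by
    refine ⟨0, le_rfl, Eventually.of_forall fun t => ⟨_, (hasW_one.const_mul 0).congr fun a => by
      simp, ?_⟩⟩
    rw [wNorm_const_mul]; simp
  exact ⟨wienerO_translate (smooth_const z) fun _ => 0,
    h.congr (Eventually.of_forall fun t => by funext a; ring)⟩

lemma Smooth.dAlpha_xiAlpha {η : ℝ × ℝ → ℝ} (hη : Smooth η) (k : ℝ) :
    TorusWave.dAlpha k (xiAlpha k η) = hilbert k (TorusWave.dAlpha k (TorusWave.dAlpha k η)) := by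
  funext a
  have h1 := (hη.dAlpha k).hasLineDerivAt_hilbert k a
  have h2 : HasLineDerivAt ℝ (xiAlpha k η) _ a (1, k) := HasDerivAt.const_add 1 h1
  exact h2.lineDeriv

lemma Smooth.dAlpha_stream {φ : ℝ × ℝ → ℝ} (hφ : Smooth φ) (k : ℝ) :
    TorusWave.dAlpha k (stream k φ) = fun a => -1 * hilbert k (TorusWave.dAlpha k φ) a := by
  funext a
  have h1 := hφ.hasLineDerivAt_hilbert k a
  have h2 : HasLineDerivAt ℝ (stream k φ) _ a (1, k) := HasDerivAt.neg h1
  rw [neg_one_mul]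
  exact h2.lineDeriv

lemma jac_nonneg (k : ℝ) (η : ℝ × ℝ → ℝ) (a : ℝ × ℝ) : 0 ≤ jac k η a := by
  unfold jac; positivity

lemma rpow_three_halves {x : ℝ} (hx : 0 ≤ x) : x ^ (3 / 2 : ℝ) = x * √x := by
  rw [show (3 / 2 : ℝ) = 1 + 1 / 2 by norm_num, Real.rpow_add_of_nonneg hx zero_le_one
    (by norm_num), Real.rpow_one, Real.sqrt_eq_rpow]

/-- Closeness of two families of data `(η, φ)`, the second of which is a bounded family of
profiles. -/
structure DataClose (k : ℝ) (l : Filter ℝ) (n : ℕ) (η φ η₁ φ₁ : ℝ → ℝ × ℝ → ℝ) : Prop where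
  eta : WienerClose l n η η₁
  dEta : WienerClose l n (fun t => dAlpha k (η t)) fun t => dAlpha k (η₁ t)
  ddEta : WienerClose l n (fun t => dAlpha k (dAlpha k (η t))) fun t => dAlpha k (dAlpha k (η₁ t))
  dPhi : WienerClose l n (fun t => dAlpha k (φ t)) fun t => dAlpha k (φ₁ t)
  smooth : ∀ᶠ t in l, Smooth (η t) ∧ Smooth (φ t)
  smooth₁ : ∀ t, Smooth (η₁ t) ∧ Smooth (φ₁ t)
  profile : ∀ t, GraphProfile k (η₁ t)
  inv_jac : WienerO l 0 fun t a => (jac k (η₁ t) a)⁻¹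
  inv_xi : WienerO l 0 fun t a => (xiAlpha k (η₁ t) a)⁻¹
  lower : ∃ δ > 0, ∀ t a, δ ≤ (jac k (η₁ t) a)⁻¹

namespace DataClose

variable {k : ℝ} {l : Filter ℝ} {n : ℕ} {η φ η₁ φ₁ : ℝ → ℝ × ℝ → ℝ}

lemma xi (h : DataClose k l n η φ η₁ φ₁) (hl : l ≤ 𝓝 0) :
    WienerClose l n (fun t => xiAlpha k (η t)) fun t => xiAlpha k (η₁ t) :=
  (wienerClose_const 1).add (h.dEta.hilbert hl k)

lemma dXi (h : DataClose k l n η φ η₁ φ₁) (hl : l ≤ 𝓝 0) :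
    WienerClose l n (fun t => dAlpha k (xiAlpha k (η t))) fun t => dAlpha k (xiAlpha k (η₁ t)) :=
  (h.ddEta.hilbert hl k).congr (h.smooth.mono fun _ ht => ht.1.dAlpha_xiAlpha k)
    (Eventually.of_forall fun t => (h.smooth₁ t).1.dAlpha_xiAlpha k)

lemma jac (h : DataClose k l n η φ η₁ φ₁) (hl : l ≤ 𝓝 0) :
    WienerClose l n (fun t => jac k (η t)) fun t => TorusWave.jac k (η₁ t) :=
  (((h.xi hl).mul hl (h.xi hl)).add (h.dEta.mul hl h.dEta)).congr
    (Eventually.of_forall fun t => by funext a; simp only [TorusWave.jac, sq])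
    (Eventually.of_forall fun t => by funext a; simp only [TorusWave.jac, sq])

lemma jac_inv (h : DataClose k l n η φ η₁ φ₁) (hl : l ≤ 𝓝 0) (hn : 1 ≤ n) :
    WienerClose l n (fun t a => (TorusWave.jac k (η t) a)⁻¹)
      fun t a => (TorusWave.jac k (η₁ t) a)⁻¹ :=
  (h.jac hl).inv hl hn (fun t a => ((h.profile t).jac_pos a).ne') h.inv_jac

lemma xi_inv (h : DataClose k l n η φ η₁ φ₁) (hl : l ≤ 𝓝 0) (hn : 1 ≤ n) :
    WienerClose l n (fun t a => (xiAlpha k (η t) a)⁻¹) fun t a => (xiAlpha k (η₁ t) a)⁻¹ :=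
  (h.xi hl).inv hl hn (fun t a => ((h.profile t).xiAlpha_pos a).ne') h.inv_xi

lemma dStream (h : DataClose k l n η φ η₁ φ₁) (hl : l ≤ 𝓝 0) :
    WienerClose l n (fun t => dAlpha k (stream k (φ t))) fun t => dAlpha k (stream k (φ₁ t)) :=
  ((wienerClose_const (-1)).mul hl (h.dPhi.hilbert hl k)).congr
    (h.smooth.mono fun _ ht => ht.2.dAlpha_stream k)
    (Eventually.of_forall fun t => (h.smooth₁ t).2.dAlpha_stream k)

lemma chi (h : DataClose k l n η φ η₁ φ₁) (hl : l ≤ 𝓝 0) (hn : 1 ≤ n) :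
    WienerClose l n (fun t => chi k (η t) (φ t)) fun t => TorusWave.chi k (η₁ t) (φ₁ t) :=
  (h.dStream hl).mul hl (h.jac_inv hl hn)

/-- Evaluation at the origin is controlled by the sup norm, so C₁ inherits the closeness; it is
treated as a family constant in a. -/
lemma pinned (h : DataClose k l n η φ η₁ φ₁) (hl : l ≤ 𝓝 0) (hn : 1 ≤ n) :
    SupClose l n (fun t _ => pinnedC₁ k (η t) (φ t)) fun t _ => pinnedC₁ k (η₁ t) (φ₁ t) := by
  have h1 := (((h.chi hl hn).hilbert hl k).sup hl).sub
    (((h.dEta.sup hl).mul ((h.dStream hl).sup hl)).mul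
      (((h.xi_inv hl hn).sup hl).mul ((h.jac_inv hl hn).sup hl)))
  refine (h1.eval (0, 0)).congr ?_ ?_ <;>
  · refine Eventually.of_forall fun t => ?_
    funext a
    simp only [pinnedC₁, div_eq_mul_inv, mul_inv]

lemma etaRHS (h : DataClose k l n η φ η₁ φ₁) (hl : l ≤ 𝓝 0) (hn : 1 ≤ n) :
    SupClose l n (fun t => etaRHS k (pinnedC₁ k (η t) (φ t)) (η t) (φ t))
      fun t => TorusWave.etaRHS k (pinnedC₁ k (η₁ t) (φ₁ t)) (η₁ t) (φ₁ t) := by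
  have hH := ((h.chi hl hn).hilbert hl k).sup hl
  have h1 := ((((supClose_const (-1)).mul (h.dEta.sup hl)).mul hH).sub
    (((h.xi hl).sup hl).mul ((h.chi hl hn).sup hl))).add
    ((h.pinned hl hn).mul (h.dEta.sup hl))
  refine h1.congr ?_ ?_ <;>
  · refine Eventually.of_forall fun t => ?_
    funext a
    simp only [TorusWave.etaRHS, neg_one_mul]

/-- The factor J^{-3/2} is J⁻¹√(J⁻¹), a form that needs only closeness of J⁻¹ and a positive lower
bound for the reference one. -/
lemma curvature (h : DataClose k l n η φ η₁ φ₁) (hl : l ≤ 𝓝 0) (hn : 1 ≤ n) :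
    SupClose l n (fun t => curvature k (η t)) fun t => TorusWave.curvature k (η₁ t) := by
  obtain ⟨δ, hδ, hle⟩ := h.lower
  have hJ := (h.jac_inv hl hn).sup hl
  have hs := hJ.sqrt hδ hle (Eventually.of_forall fun t a => inv_nonneg.2 (jac_nonneg _ _ _))
  have h1 := ((((h.xi hl).mul hl h.ddEta).sup hl).sub ((h.dEta.mul hl (h.dXi hl)).sup hl)).mul
    (hJ.mul hs)
  refine h1.congr ?_ ?_ <;>
  · refine Eventually.of_forall fun t => ?_
    funext a
    rw [TorusWave.curvature, rpow_three_halves (jac_nonneg _ _ _), div_eq_mul_inv, mul_inv,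
      Real.sqrt_inv]

lemma phiRHS (h : DataClose k l n η φ η₁ φ₁) (hl : l ≤ 𝓝 0) (hn : 1 ≤ n) (g τ : ℝ) :
    SupClose l n (fun t => phiRHS k g τ (pinnedC₁ k (η t) (φ t)) (η t) (φ t))
      fun t => TorusWave.phiRHS k g τ (pinnedC₁ k (η₁ t) (φ₁ t)) (η₁ t) (φ₁ t) := by
  have hH := ((h.chi hl hn).hilbert hl k).sup hl
  have hφ := h.dPhi.sup hl
  have hψ := (h.dStream hl).sup hl
  have h1 := (((((((hψ.mul hψ).sub (hφ.mul hφ)).mul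
    ((supClose_const 2⁻¹).mul ((h.jac_inv hl hn).sup hl))).sub (hφ.mul hH)).add
    ((h.pinned hl hn).mul hφ)).sub ((supClose_const g).mul (h.eta.sup hl))).add
    ((supClose_const τ).mul (h.curvature hl hn)))
  refine (h1.sub h1.torusMean).congr ?_ ?_ <;>
  · refine Eventually.of_forall fun t => ?_
    funext a
    simp only [TorusWave.phiRHS, zeroMeanPart, div_eq_mul_inv, mul_inv, sq]

end DataClose

/-! ### Analytic families of functions on the torus -/

/-- `F(t, a)` is analytic for `t` in `I`, and periodic in `a`. -/
structure AnalyticFamily (I : Set ℝ) (F : ℝ × (ℝ × ℝ) → ℝ) : Prop where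
  analytic : AnalyticOnNhd ℝ F (I ×ˢ univ)
  periodic : ∀ t ∈ I, TorusPeriodic fun a => F (t, a)

lemma Smooth.dAlpha_sub {u v : ℝ × ℝ → ℝ} (hu : Smooth u) (hv : Smooth v) (k : ℝ) (a : ℝ × ℝ) :
    TorusWave.dAlpha k (fun b => u b - v b) a = TorusWave.dAlpha k u a - TorusWave.dAlpha k v a :=
  HasLineDerivAt.lineDeriv ((hu.hasLineDerivAt a (1, k)).fun_sub (hv.hasLineDerivAt a (1, k)))

namespace AnalyticFamily

variable {I : Set ℝ} {F G : ℝ × (ℝ × ℝ) → ℝ} {n : ℕ}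

lemma analyticAt (hF : AnalyticFamily I F) {t : ℝ} (ht : t ∈ I) (a : ℝ × ℝ) :
    AnalyticAt ℝ F (t, a) := hF.analytic _ ⟨ht, mem_univ a⟩

lemma sub (hF : AnalyticFamily I F) (hG : AnalyticFamily I G) :
    AnalyticFamily I fun p => F p - G p :=
  ⟨hF.analytic.sub hG.analytic, fun t ht a => by
    simp only [(hF.periodic t ht a).1, (hF.periodic t ht a).2, (hG.periodic t ht a).1,
      (hG.periodic t ht a).2, and_self]⟩

lemma smooth (hF : AnalyticFamily I F) {t : ℝ} (ht : t ∈ I) : Smooth fun a => F (t, a) :=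
  smooth_of_analytic (fun a _ => (hF.analyticAt ht a).comp (f := fun a => (t, a))
    (analyticAt_const.prod analyticAt_id)) (hF.periodic t ht)

lemma lineDeriv_eq (hF : AnalyticFamily I F) {t : ℝ} (ht : t ∈ I) (a w : ℝ × ℝ) :
    lineDeriv ℝ (fun a => F (t, a)) a w = pd (0, w) F (t, a) := by
  have h1 : HasFDerivAt (fun a : ℝ × ℝ => (t, a)) (ContinuousLinearMap.inr ℝ ℝ (ℝ × ℝ)) a :=
    hasFDerivAt_prodMk_right t a
  have h2 := (hF.analyticAt ht a).differentiableAt.hasFDerivAt.comp a h1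
  have h3 : HasLineDerivAt ℝ (fun a => F (t, a)) _ a w := h2.hasLineDerivAt w
  rw [h3.lineDeriv]
  rfl

lemma pd (hF : AnalyticFamily I F) (w : ℝ × ℝ) : AnalyticFamily I (TorusWave.pd (0, w) F) :=
  ⟨fun p hp => analyticAt_pd (hF.analytic p hp) _, fun t ht => by
    rw [← funext fun a => hF.lineDeriv_eq ht a w]
    exact ((hF.smooth ht).lineDeriv w).periodic⟩

lemma dAlpha_eq (hF : AnalyticFamily I F) {t : ℝ} (ht : t ∈ I) (k : ℝ) :
    dAlpha k (fun a => F (t, a)) = fun a => TorusWave.pd (0, (1, k)) F (t, a) :=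
  funext fun a => hF.lineDeriv_eq ht a (1, k)

lemma lineDeriv_ofReal (hF : AnalyticFamily I F) {t : ℝ} (ht : t ∈ I) (w : ℝ × ℝ) :
    (fun a => lineDeriv ℝ (fun a => (F (t, a) : ℂ)) a w) =
      fun a => (TorusWave.pd (0, w) F (t, a) : ℂ) :=
  funext fun a => by rw [(hF.smooth ht).lineDeriv_ofReal, hF.lineDeriv_eq ht]

/-- A family vanishing to order `n` at `t = 0` is `O(tⁿ)` in the Wiener norm. -/
lemma wienerO (hF : AnalyticFamily I F) (h0 : (0 : ℝ) ∈ I) (h : VanishOrder n F) {l : Filter ℝ}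
    (hl : l ≤ 𝓝[I] 0) : WienerO l n fun t a => F (t, a) := by
  have hK : IsCompact (Icc 0 (2 * Real.pi) ×ˢ Icc 0 (2 * Real.pi)) :=
    isCompact_Icc.prod isCompact_Icc
  -- Two derivatives in one direction keep both the analytic family and the order of vanishing.
  -- Applied to ∂₁², ∂₂² and ∂₂²∂₁², this provides the inputs of `DerivBound`.
  have key : ∀ {G : ℝ × (ℝ × ℝ) → ℝ} (w : ℝ × ℝ), AnalyticFamily I G → VanishOrder n G →
      AnalyticFamily I (TorusWave.pd (0, w) (TorusWave.pd (0, w) G)) ∧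
        VanishOrder n (TorusWave.pd (0, w) (TorusWave.pd (0, w) G)) := fun w hG hv =>
    ⟨(hG.pd w).pd w, (hv.pd (hG.analyticAt h0) w).pd ((hG.pd w).analyticAt h0) w⟩
  obtain ⟨f1, v1⟩ := key (1, 0) hF h
  obtain ⟨f2, v2⟩ := key (0, 1) hF h
  obtain ⟨f3, v3⟩ := key (0, 1) f1 v1
  obtain ⟨M0, p0, b0⟩ := h.exists_bound (hF.analyticAt h0) hK
  obtain ⟨M1, p1, b1⟩ := v1.exists_bound (f1.analyticAt h0) hK
  obtain ⟨M2, p2, b2⟩ := v2.exists_bound (f2.analyticAt h0) hK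
  obtain ⟨M3, p3, b3⟩ := v3.exists_bound (f3.analyticAt h0) hK
  have hl0 : l ≤ 𝓝 0 := hl.trans nhdsWithin_le_nhds
  have hw : 0 ≤ ∑' j, sqWeight j := tsum_nonneg fun j => by unfold sqWeight; positivity
  refine ⟨4 * (M0 + M1 + M2 + M3) * ∑' j, sqWeight j, by positivity, ?_⟩
  filter_upwards [hl0 b0, hl0 b1, hl0 b2, hl0 b3, hl self_mem_nhdsWithin] with t b0 b1 b2 b3 ht
  have hle : ∀ {x M : ℝ}, |x| ≤ M * |t| ^ n → M ≤ M0 + M1 + M2 + M3 →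
      ‖(x : ℂ)‖ ≤ (M0 + M1 + M2 + M3) * |t| ^ n := fun hx hM => by
    rw [Complex.norm_real]
    exact hx.trans (mul_le_mul_of_nonneg_right hM (by positivity))
  have hM : DerivBound (fun a => (F (t, a) : ℂ)) ((M0 + M1 + M2 + M3) * |t| ^ n) := by
    refine ⟨fun a ha => hle (b0 a ha) (by linarith), fun a ha => ?_, fun a ha => ?_,
      fun a ha => ?_⟩
    · rw [hF.lineDeriv_ofReal ht, congrFun ((hF.pd _).lineDeriv_ofReal ht _) a]
      exact hle (b1 a ha) (by linarith)
    · rw [hF.lineDeriv_ofReal ht, congrFun ((hF.pd _).lineDeriv_ofReal ht _) a]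
      exact hle (b2 a ha) (by linarith)
    · rw [hF.lineDeriv_ofReal ht, (hF.pd _).lineDeriv_ofReal ht, f1.lineDeriv_ofReal ht,
        congrFun ((f1.pd _).lineDeriv_ofReal ht _) a]
      exact hle (b3 a ha) (by linarith)
  obtain ⟨e1, e2⟩ := (hF.smooth ht).ofReal.hasW_of_derivBound hM
  exact ⟨_, e1, e2.trans_eq (by ring)⟩

lemma wienerO_sub (hF : AnalyticFamily I F) (hG : AnalyticFamily I G) (h0 : (0 : ℝ) ∈ I)
    (h : VanishOrder n fun p => F p - G p) {l : Filter ℝ} (hl : l ≤ 𝓝[I] 0) (k : ℝ) :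
    WienerO l n (fun t a => F (t, a) - G (t, a)) ∧
    WienerO l n (fun t a => dAlpha k (fun a => F (t, a)) a - dAlpha k (fun a => G (t, a)) a) ∧
    WienerO l n (fun t a => dAlpha k (dAlpha k fun a => F (t, a)) a -
      dAlpha k (dAlpha k fun a => G (t, a)) a) := by
  have hs := hF.sub hG
  have hI : ∀ᶠ t in l, t ∈ I := hl self_mem_nhdsWithin
  have v1 := h.pd (hs.analyticAt h0) (1, k)
  have v2 := v1.pd ((hs.pd (1, k)).analyticAt h0) (1, k)
  have e : ∀ t ∈ I, (fun a => dAlpha k (fun a => F (t, a)) a - dAlpha k (fun a => G (t, a)) a) =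
      fun a => TorusWave.pd (0, (1, k)) (fun p => F p - G p) (t, a) := fun t ht => by
    rw [← hs.dAlpha_eq ht]
    exact (funext fun a => (hF.smooth ht).dAlpha_sub (hG.smooth ht) k a).symm
  refine ⟨hs.wienerO h0 h hl, ((hs.pd (1, k)).wienerO h0 v1 hl).congr (hI.mono e),
    (((hs.pd (1, k)).pd (1, k)).wienerO h0 v2 hl).congr (hI.mono fun t ht => ?_)⟩
  rw [← (hs.pd (1, k)).dAlpha_eq ht, ← e t ht]
  exact (funext fun a => ((hF.smooth ht).dAlpha k).dAlpha_sub ((hG.smooth ht).dAlpha k) k a).symm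

end AnalyticFamily

/-! ### Uniqueness -/

/-- The profile in the frame of the shifted traveling form. -/
def shiftedEta (k : ℝ) (η : ℝ × ℝ → ℝ) (α₀ : ℝ → ℝ) (t : ℝ) (a : ℝ × ℝ) : ℝ :=
  η (a + (-α₀ t, -(k * α₀ t)))

/-- All reference quantities are translates of fixed smooth functions, hence bounded uniformly in t.
The differences are O(tⁿ) because the vanishing order passes to spatial derivatives. -/
lemma dataClose_shifted {k : ℝ} {η : ℝ × ℝ → ℝ} (h : GraphProfile k η) (c : ℝ) {α₀ : ℝ → ℝ}
    {I : Set ℝ} {F G : ℝ × (ℝ × ℝ) → ℝ} (hF : AnalyticFamily I F) (hG : AnalyticFamily I G)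
    (hF₁ : AnalyticFamily I fun p => shiftedEta k η α₀ p.1 p.2)
    (hG₁ : AnalyticFamily I fun p => shiftedPhi k c η α₀ p.1 p.2) (h0 : (0 : ℝ) ∈ I) {n : ℕ}
    (hvF : VanishOrder n fun p => F p - shiftedEta k η α₀ p.1 p.2)
    (hvG : VanishOrder n fun p => G p - shiftedPhi k c η α₀ p.1 p.2) {l : Filter ℝ}
    (hl : l ≤ 𝓝[I] 0) :
    DataClose k l n (fun t a => F (t, a)) (fun t a => G (t, a)) (shiftedEta k η α₀)
      (shiftedPhi k c η α₀) := by
  set b : ℝ → ℝ × ℝ := fun t => (-α₀ t, -(k * α₀ t)) with hb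
  have hη : ∀ t, shiftedEta k η α₀ t = fun a => η (a + b t) := fun t => rfl
  have hp : ∀ t, GraphProfile k (shiftedEta k η α₀ t) := fun t => h.translate (b t)
  have hφ : ∀ t, shiftedPhi k c η α₀ t = fun a => c * hilbert k (shiftedEta k η α₀ t) a :=
    shiftedPhi_eq h c α₀
  have d1 : ∀ t, dAlpha k (shiftedEta k η α₀ t) = fun a => dAlpha k η (a + b t) :=
    fun t => funext fun a => dAlpha_translate k η (b t) a
  have d2 : ∀ t, dAlpha k (dAlpha k (shiftedEta k η α₀ t)) =
      fun a => dAlpha k (dAlpha k η) (a + b t) := fun t => by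
    rw [d1]; exact funext fun a => dAlpha_translate k _ (b t) a
  have d3 : ∀ t, dAlpha k (shiftedPhi k c η α₀ t) =
      fun a => c * (xiAlpha k η (a + b t) - 1) := fun t => by
    rw [hφ]
    funext a
    rw [(hp t).dAlpha_phi, hη, xiAlpha_translate h.smooth]
  have sp : Smooth fun a => c * (xiAlpha k η a - 1) :=
    (smooth_const c).mul (h.smooth_xiAlpha.sub (smooth_const 1))
  have sx : Smooth fun a => (xiAlpha k η a)⁻¹ := h.smooth_xiAlpha.inv fun a => (h.xiAlpha_pos a).ne'
  obtain ⟨e1, e2, e3⟩ := hF.wienerO_sub hF₁ h0 hvF hl k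
  obtain ⟨_, e4, _⟩ := hG.wienerO_sub hG₁ h0 hvG hl k
  have hj : ∀ t a, jac k (shiftedEta k η α₀ t) a = jac k η (a + b t) :=
    fun t a => jac_translate h.smooth (b t) a
  refine ⟨⟨wienerO_translate h.smooth b, e1⟩,
    ⟨(wienerO_translate (h.smooth.dAlpha k) b).congr (Eventually.of_forall d1), e2⟩,
    ⟨(wienerO_translate ((h.smooth.dAlpha k).dAlpha k) b).congr (Eventually.of_forall d2), e3⟩,
    ⟨(wienerO_translate sp b).congr (Eventually.of_forall d3), e4⟩, ?_, fun t => ⟨(hp t).smooth, ?_⟩,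
    hp, ?_, ?_, ?_⟩
  · filter_upwards [hl self_mem_nhdsWithin] with t ht using ⟨hF.smooth ht, hG.smooth ht⟩
  · rw [hφ]; exact (hp t).smooth_phi c
  · exact (wienerO_translate h.smooth_inv_jac b).congr
      (Eventually.of_forall fun t => funext fun a => by rw [hj])
  · exact (wienerO_translate sx b).congr
      (Eventually.of_forall fun t => funext fun a => by rw [hη, xiAlpha_translate h.smooth])
  · obtain ⟨δ, hδ, hle⟩ := h.smooth_inv_jac.periodic.exists_pos_le h.smooth_inv_jac.continuous
      fun a => inv_pos.2 (h.jac_pos a)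
    exact ⟨δ, hδ, fun t a => by rw [hj]; exact hle _⟩

lemma interior_nonempty_of_ordConnected {I : Set ℝ} (hI : I.OrdConnected) {s t : ℝ} (hs : s ∈ I)
    (ht : t ∈ I) (hst : s ≠ t) : (interior I).Nonempty := by
  have hsub : Ioo (min s t) (max s t) ⊆ I :=
    Ioo_subset_Icc_self.trans (hI.uIcc_subset hs ht)
  have hne : (Ioo (min s t) (max s t)).Nonempty := nonempty_Ioo.2 (min_lt_max.2 hst)
  exact hne.mono (interior_maximal hsub isOpen_Ioo)

lemma neBot_nhdsWithin_diff {I : Set ℝ} (hI : I.OrdConnected) {s t : ℝ} (hs : s ∈ I)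
    (ht : t ∈ I) (hst : s ≠ t) : (𝓝[I \ {s}] s).NeBot := by
  rw [← mem_closure_iff_nhdsWithin_neBot]
  rcases lt_or_gt_of_ne hst with h | h
  · have hsub : Ioo s t ⊆ I \ {s} := fun x hx => ⟨hI.out hs ht ⟨hx.1.le, hx.2.le⟩, hx.1.ne'⟩
    refine closure_mono hsub ?_
    rw [closure_Ioo hst]; exact left_mem_Icc.2 h.le
  · have hsub : Ioo t s ⊆ I \ {s} := fun x hx => ⟨hI.out ht hs ⟨hx.1.le, hx.2.le⟩, hx.2.ne⟩
    refine closure_mono hsub ?_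
    rw [closure_Ioo hst.symm]; exact right_mem_Icc.2 h.le

lemma IsTorusSolution.eta_family {k g τ : ℝ} {C₁ : ℝ → ℝ} {I : Set ℝ} {ζ : ℝ → ℝ × ℝ → ℂ}
    {φ : ℝ → ℝ × ℝ → ℝ} (h : IsTorusSolution k g τ C₁ I ζ φ) :
    AnalyticFamily I fun p => (ζ p.1 p.2).im :=
  ⟨fun p hp => (Complex.imCLM.analyticAt _).comp (h.analytic_zeta p hp), fun t ht a =>
    ⟨congrArg Complex.im (h.periodic_zeta t ht a).1, congrArg Complex.im (h.periodic_zeta t ht a).2⟩⟩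

lemma IsTorusSolution.phi_family {k g τ : ℝ} {C₁ : ℝ → ℝ} {I : Set ℝ} {ζ : ℝ → ℝ × ℝ → ℂ}
    {φ : ℝ → ℝ × ℝ → ℝ} (h : IsTorusSolution k g τ C₁ I ζ φ) :
    AnalyticFamily I fun p => φ p.1 p.2 := ⟨h.analytic_phi, h.periodic_phi⟩

/-- The restriction of a solution to a smaller set of times. -/
lemma IsTorusSolution.mono {k g τ : ℝ} {C₁ : ℝ → ℝ} {I I' : Set ℝ} {ζ : ℝ → ℝ × ℝ → ℂ}
    {φ : ℝ → ℝ × ℝ → ℝ} (h : IsTorusSolution k g τ C₁ I ζ φ) (hI : I' ⊆ I) :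
    IsTorusSolution k g τ C₁ I' ζ φ := by
  obtain ⟨x₀, hx⟩ := h.reconstruct
  exact ⟨h.analytic_zeta.mono (prod_mono hI subset_rfl),
    h.analytic_phi.mono (prod_mono hI subset_rfl), fun t ht => h.periodic_zeta t (hI ht),
    fun t ht => h.periodic_phi t (hI ht), fun t ht => h.jac_ne_zero t (hI ht),
    ⟨x₀, fun t ht => ⟨(hx t (hI ht)).1, (hx t (hI ht)).2.mono hI⟩⟩,
    fun t ht a => (h.eta_eq t (hI ht) a).mono hI, fun t ht a => (h.phi_eq t (hI ht) a).mono hI⟩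

/-- The time derivative of the difference of two families, along `I`, is the difference of the
derivatives within `I`. -/
lemma pd_tdir_eq {I : Set ℝ} {F F₁ : ℝ → ℝ × ℝ → ℝ}
    (hX : AnalyticFamily I fun p => F p.1 p.2 - F₁ p.1 p.2) (hU : UniqueDiffOn ℝ I) {t : ℝ}
    (ht : t ∈ I) {a : ℝ × ℝ} {d d₁ : ℝ} (h : HasDerivWithinAt (fun s => F s a) d I t)
    (h₁ : HasDerivWithinAt (fun s => F₁ s a) d₁ I t) :
    pd tdir (fun p => F p.1 p.2 - F₁ p.1 p.2) (t, a) = d - d₁ :=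
  (hU t ht).eq_deriv _ (hasDerivAt_time (hX.analyticAt ht a)).hasDerivWithinAt (h.sub h₁)

/-- Two solutions that agree at the initial time, one of which is the shifted traveling form, have
the same elevation and potential. -/
theorem eta_phi_unique {k g τ c : ℝ} {η : ℝ × ℝ → ℝ} (h : GraphProfile k η) {α₀ : ℝ → ℝ}
    {I : Set ℝ} (hI : I.OrdConnected) (h0 : (0 : ℝ) ∈ I) {t₁ : ℝ} (ht₁ : t₁ ∈ I) (hne : 0 ≠ t₁)
    (h₁ : IsPinnedTorusSolution k g τ I (shiftedZeta k c η α₀) (shiftedPhi k c η α₀))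
    {ζ : ℝ → ℝ × ℝ → ℂ} {φ : ℝ → ℝ × ℝ → ℝ} (h₂ : IsPinnedTorusSolution k g τ I ζ φ)
    (hζ : ζ 0 = shiftedZeta k c η α₀ 0) (hφ : φ 0 = shiftedPhi k c η α₀ 0) :
    ∀ t ∈ I, ∀ a, (ζ t a).im = shiftedEta k η α₀ t a ∧ φ t a = shiftedPhi k c η α₀ t a := by
  have hU : UniqueDiffOn ℝ I :=
    uniqueDiffOn_convex hI.convex (interior_nonempty_of_ordConnected hI h0 ht₁ hne)
  have hNe := neBot_nhdsWithin_diff hI h0 ht₁ hne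
  -- Nonzero times of I tending to 0: the equations hold only within I, and division by |t| requires
  -- t ≠ 0.
  set l := 𝓝[I \ {0}] (0 : ℝ) with hl
  have hlI : l ≤ 𝓝[I] 0 := nhdsWithin_mono _ sdiff_subset
  have hl0 : l ≤ 𝓝 0 := nhdsWithin_le_nhds
  have hlne : l ≤ 𝓝[≠] 0 := nhdsWithin_mono _ fun x hx => hx.2
  have im_eq : ∀ t, (fun b => (shiftedZeta k c η α₀ t b).im) = shiftedEta k η α₀ t :=
    fun t => funext (shiftedZeta_im k c η α₀ t)
  have f := h₂.2.eta_family
  have f' := h₂.2.phi_family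
  have f₁ : AnalyticFamily I fun p => shiftedEta k η α₀ p.1 p.2 := by
    have := h₁.2.eta_family
    simp only [shiftedZeta_im] at this
    exact this
  have f₁' := h₁.2.phi_family
  have hd₁ : ∀ t ∈ I, ∀ a, HasDerivWithinAt (fun s => shiftedEta k η α₀ s a)
      (etaRHS k (pinnedC₁ k (shiftedEta k η α₀ t) (shiftedPhi k c η α₀ t))
        (shiftedEta k η α₀ t) (shiftedPhi k c η α₀ t) a) I t := fun t ht a => by
    have := h₁.2.eta_eq t ht a
    simp only [shiftedZeta_im] at this
    exact this
  have hd₁' : ∀ t ∈ I, ∀ a, HasDerivWithinAt (fun s => shiftedPhi k c η α₀ s a)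
      (phiRHS k g τ (pinnedC₁ k (shiftedEta k η α₀ t) (shiftedPhi k c η α₀ t))
        (shiftedEta k η α₀ t) (shiftedPhi k c η α₀ t) a) I t := fun t ht a => by
    have := h₁.2.phi_eq t ht a
    simp only [im_eq] at this
    exact this
  have hI' : ∀ᶠ t in l, t ∈ I := hlI self_mem_nhdsWithin
  have step : ∀ n, VanishOrder n (fun p => (ζ p.1 p.2).im - shiftedEta k η α₀ p.1 p.2) ∧
      VanishOrder n (fun p => φ p.1 p.2 - shiftedPhi k c η α₀ p.1 p.2) := by
    intro n
    induction n with
    | zero => exact ⟨fun i hi => absurd hi (Nat.not_lt_zero _), fun i hi => absurd hi (Nat.not_lt_zero _)⟩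
    | succ n ih =>
      -- Order one comes from the initial data, not from the equations: the reciprocal estimates
      -- require n ≥ 1.
      rcases Nat.eq_zero_or_pos n with rfl | hn
      · refine ⟨fun i hi a => ?_, fun i hi a => ?_⟩
        · obtain rfl : i = 0 := by omega
          simp only [Function.iterate_zero, id_eq, hζ, shiftedZeta_im, shiftedEta, sub_self]
        · obtain rfl : i = 0 := by omega
          simp only [Function.iterate_zero, id_eq, hφ, sub_self]
      · have D := dataClose_shifted h c f f' f₁ f₁' h0 ih.1 ih.2 hlI
        refine ⟨ih.1.succ hn ((f.sub f₁).analyticAt h0) hlne fun a => ?_,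
          ih.2.succ hn ((f'.sub f₁').analyticAt h0) hlne fun a => ?_⟩
        · obtain ⟨C, _, hC⟩ := D.etaRHS hl0 hn
          refine ⟨C, ?_⟩
          filter_upwards [hC, hI'] with t ⟨_, _, hb⟩ ht
          rw [pd_tdir_eq (F := fun t a => (ζ t a).im) (f.sub f₁) hU ht (h₂.2.eta_eq t ht a)
            (hd₁ t ht a)]
          exact (hb a).2.2
        · obtain ⟨C, _, hC⟩ := D.phiRHS hl0 hn g τ
          refine ⟨C, ?_⟩
          filter_upwards [hC, hI'] with t ⟨_, _, hb⟩ ht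
          rw [pd_tdir_eq (f'.sub f₁') hU ht (h₂.2.phi_eq t ht a) (hd₁' t ht a)]
          exact (hb a).2.2
  intro t ht a
  exact ⟨sub_eq_zero.1 (eqOn_zero_of_vanishOrder hI h0 (f.sub f₁).analytic (fun n => (step n).1) t ht a),
    sub_eq_zero.1 (eqOn_zero_of_vanishOrder hI h0 (f'.sub f₁').analytic (fun n => (step n).2) t ht a)⟩

/-- A solution with the initial data of the shifted traveling form coincides with it. -/
theorem shifted_unique {k g τ c : ℝ} {η : ℝ × ℝ → ℝ} (h : GraphProfile k η) {α₀ : ℝ → ℝ}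
    {I : Set ℝ} (hI : I.OrdConnected) (h0 : (0 : ℝ) ∈ I)
    (h₁ : IsPinnedTorusSolution k g τ I (shiftedZeta k c η α₀) (shiftedPhi k c η α₀))
    {ζ : ℝ → ℝ × ℝ → ℂ} {φ : ℝ → ℝ × ℝ → ℝ} (h₂ : IsPinnedTorusSolution k g τ I ζ φ)
    (hζ : ζ 0 = shiftedZeta k c η α₀ 0) (hφ : φ 0 = shiftedPhi k c η α₀ 0) :
    ∀ t ∈ I, ζ t = shiftedZeta k c η α₀ t ∧ φ t = shiftedPhi k c η α₀ t := by
  intro t ht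
  rcases eq_or_ne 0 t with rfl | hne
  · exact ⟨hζ, hφ⟩
  have hu := eta_phi_unique h hI h0 ht hne h₁ h₂ hζ hφ
  have eη : ∀ s ∈ I, (fun b => (ζ s b).im) = fun b => (shiftedZeta k c η α₀ s b).im :=
    fun s hs => funext fun a => by rw [(hu s hs a).1, shiftedZeta_im]; rfl
  have eφ : ∀ s ∈ I, φ s = shiftedPhi k c η α₀ s := fun s hs => funext fun a => (hu s hs a).2
  refine ⟨funext fun a => Complex.ext ?_ (congrFun (eη t ht) a), eφ t ht⟩
  obtain ⟨x, hx⟩ := h₂.2.reconstruct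
  obtain ⟨y, hy⟩ := h₁.2.reconstruct
  -- The right-hand side for x₀ depends only on η and φ, which already agree, so the two offsets
  -- differ by a constant. The constant is zero because the real parts agree at t = 0.
  have hd : ∀ s ∈ I, HasDerivWithinAt (fun s => x s - y s) 0 I s := fun s hs => by
    have h3 := (hx s hs).2
    simp only [eη s hs, eφ s hs] at h3
    exact (h3.sub (hy s hs).2).congr_deriv (sub_self _)
  have hc := hI.convex.norm_image_sub_le_of_norm_hasDerivWithin_le hd
    (fun _ _ => norm_zero.le) h0 ht
  rw [zero_mul] at hc
  have hc' : x t - y t = x 0 - y 0 := sub_eq_zero.1 (norm_le_zero_iff.1 hc)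
  have i1 := (hx 0 h0).1 a
  have i2 := (hy 0 h0).1 a
  rw [eη 0 h0, hζ] at i1
  rw [(hx t ht).1, (hy t ht).1, eη t ht]
  linarith

end TorusWave

end

/-! ### The theorem: phase, solution and uniqueness combined -/

theorem mainTheorem3 (k g τ c : ℝ) (hk : 0 < k) (hkirr : Irrational k)
    (η₀ : ℝ × ℝ → ℝ) (ηhat : ℤ × ℤ → ℂ) (C ε : ℝ) (hε : 0 < ε)
    (hseries : ∀ a : ℝ × ℝ, HasSum (fun j => ηhat j * TorusWave.torusChar j a) (η₀ a : ℂ))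
    (hsymm : ∀ j, ηhat (-j) = (starRingEnd ℂ) (ηhat j))
    (hdecay : ∀ j : ℤ × ℤ,
      ‖ηhat j‖ ≤ C * Real.exp (-3 * ε * max k 1 * max |(j.1 : ℝ)| |(j.2 : ℝ)|))
    (heven : ∀ a, η₀ (-a) = η₀ a)
    (htrav : TorusWave.IsTravelingProfile k g τ c η₀)
    (hinj : ∀ θ ∈ Set.Ico 0 (2 * Real.pi), Function.Injective (TorusWave.zetaLine k η₀ θ))
    (hne : ∀ θ ∈ Set.Ico 0 (2 * Real.pi), ∀ α : ℝ, deriv (TorusWave.zetaLine k η₀ θ) α ≠ 0)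
    (hpos : ∀ α ∈ Set.Ico 0 (2 * Real.pi), ∀ θ ∈ Set.Ico 0 (2 * Real.pi),
      0 < deriv (TorusWave.xiLine k η₀ θ) α) :
    ∃ (A₀ : ℝ × ℝ → ℝ) (α₀ : ℝ → ℝ),
      -- the implicit equation defines `A₀`, which is periodic and real analytic
      (∀ x : ℝ × ℝ, A₀ x + TorusWave.hilbert k η₀ (x.1 + A₀ x, x.2 + k * A₀ x) = 0) ∧
      (∀ B : ℝ × ℝ → ℝ,
        (∀ x : ℝ × ℝ, B x + TorusWave.hilbert k η₀ (x.1 + B x, x.2 + k * B x) = 0) → B = A₀) ∧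
      TorusWave.TorusPeriodic A₀ ∧
      AnalyticOnNhd ℝ A₀ Set.univ ∧
      (∀ t : ℝ, α₀ t = c * t - A₀ (-(c * t), -(k * c * t))) ∧
      -- the shifted traveling form is a solution for all times, with the initial data
      TorusWave.IsPinnedTorusSolution k g τ Set.univ
        (TorusWave.shiftedZeta k c η₀ α₀) (TorusWave.shiftedPhi k c η₀ α₀) ∧
      TorusWave.shiftedZeta k c η₀ α₀ 0 = TorusWave.zetaZero k η₀ ∧
      TorusWave.shiftedPhi k c η₀ α₀ 0 = TorusWave.phiZero k c η₀ ∧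
      (∀ t : ℝ, (TorusWave.shiftedZeta k c η₀ α₀ t (0, 0)).re = 0) ∧
      -- and every solution with these initial data, on any time interval, has this form
      (∀ I : Set ℝ, I.OrdConnected → (0 : ℝ) ∈ I →
        ∀ (ζ : ℝ → ℝ × ℝ → ℂ) (φ : ℝ → ℝ × ℝ → ℝ),
          TorusWave.IsPinnedTorusSolution k g τ I ζ φ →
          ζ 0 = TorusWave.zetaZero k η₀ → φ 0 = TorusWave.phiZero k c η₀ →
          ∀ t ∈ I, ζ t = TorusWave.shiftedZeta k c η₀ α₀ t ∧
            φ t = TorusWave.shiftedPhi k c η₀ α₀ t) := by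
  have hσ : 0 < 3 * ε * max k 1 := by positivity
  obtain ⟨hW, h, hη, hS⟩ := TorusWave.profile_of_series hkirr hσ hseries
    (fun j => (hdecay j).trans_eq (by rw [TorusWave.supNorm]; ring_nf)) hpos
  obtain ⟨A, hA, huniq, hper, han⟩ := TorusWave.exists_unique_implicit (k := k) h.smooth_hilbert hS
    fun a => by
      have := h.xiAlpha_pos a
      rwa [h.xiAlpha_eq] at this
  set α₀ : ℝ → ℝ := fun t => c * t - A (-(c * t), -(k * c * t)) with hα₀
  -- This is the implicit equation at x = (-ct, -kct), where x + A(x)(1, k) = (-α₀, -kα₀). It also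
  -- states that the surface point with label (0, 0) stays at ξ̃ = 0.
  have himp : ∀ t, c * t - α₀ t + TorusWave.hilbert k η₀ (-α₀ t, -(k * α₀ t)) = 0 := fun t => by
    have := hA (-(c * t), -(k * c * t))
    rw [← this]
    have e1 : c * t - α₀ t = A (-(c * t), -(k * c * t)) := by rw [hα₀]; ring
    have e2 : -α₀ t = -(c * t) + A (-(c * t), -(k * c * t)) := by rw [hα₀]; ring
    have e3 : -(k * α₀ t) = -(k * c * t) + k * A (-(c * t), -(k * c * t)) := by rw [hα₀]; ring
    rw [e1, e2, e3]
  have hα : AnalyticOnNhd ℝ α₀ Set.univ := fun t _ => by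
    have h1 : AnalyticAt ℝ (fun t : ℝ => c * t) t := analyticAt_const.mul analyticAt_id
    have h2 : AnalyticAt ℝ (fun t : ℝ => k * c * t) t := analyticAt_const.mul analyticAt_id
    exact h1.sub ((han _ (Set.mem_univ _)).comp (f := fun t : ℝ => (-(c * t), -(k * c * t)))
      (h1.neg.prod h2.neg))
  -- By evenness H[η₀] vanishes at the origin, so 0 solves the implicit equation there and A(0, 0) =
  -- 0.
  have hα0 : α₀ 0 = 0 := by
    have h1 : (0 : ℝ) = A (0, 0) := huniq (0, 0) 0 (by
      simpa using TorusWave.hilbert_zero_of_even hW heven)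
    simp [hα₀, ← h1]
  have hsol := TorusWave.shifted_isSolution (g := g) (τ := τ) h hη hS htrav hα himp
  have hζ0 : TorusWave.shiftedZeta k c η₀ α₀ 0 = TorusWave.zetaZero k η₀ := by
    funext a; simp [TorusWave.shiftedZeta, hα0]
  have hφ0 : TorusWave.shiftedPhi k c η₀ α₀ 0 = TorusWave.phiZero k c η₀ := by
    funext a; simp [TorusWave.shiftedPhi, hα0]
  refine ⟨A, α₀, hA, fun B hB => funext fun x => huniq x (B x) (hB x), hper, han, fun _ => rfl, hsol,
    hζ0, hφ0, fun t => ?_, fun I hI h0 ζ φ h₂ hζ hφ => ?_⟩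
  · rw [TorusWave.shiftedZeta_re, Prod.mk_zero_zero, zero_add]
    exact himp t
  · exact TorusWave.shifted_unique h hI h0
      ⟨fun t _ => hsol.1 t (Set.mem_univ t), hsol.2.mono (Set.subset_univ I)⟩ h₂
      (hζ.trans hζ0.symm) (hφ.trans hφ0.symm)
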